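/- Let $f(x)=\ln(1+|x|)$, applied entrywise to vectors, and for $x\in\mathbb R^{d+1}$ let $g(x)=(f(x_{1:d}),x_{d+1})\in\mathbb R^{d+1}$. Let $A\in\mathbb R^{n\times d}$ and $b\in\mathbb R^n$ be not both zero, let $Q=(A\ \ b)\in\mathbb R^{n\times(d+1)}$ have rows $Q_i=(A_i,b_i)$, and let $M=\sum_i\|g(Q_i)\|_2^2$. **The algorithm (H-Sketch sampling with transform $g$).** The input is $Q$, $\epsilon>0$, $K\ge 1$ and a number $\widehat M$ with $M\le\widehat M\le KM$. Put $L=\lceil\log_2(Kn/\epsilon)\rceil$, $\hat L=\lceil\log_2 n\rceil$, $j_0=\lceil\log_2(4K\epsilon^{-3}L^3)\rceil$ and $\delta=1/(\hat L+1)$. *Sketch.* For $\ell=0,\dots,\hat L$, let $Q^{(\ell)}$ be obtained from $Q$ by keeping each row independently with probability $2^{-\ell}$ and replacing the other rows by $0$. The structure $\mathcal D_\ell$ consists of $R=O(\log(2n/\delta))$ independent repetitions of the following: a pairwise independent uniform hash function $h:[n]\to[w]$, with $w=O(1/(\phi^2\nu^3))$; independently, $4$-wise independent uniform random signs $\sigma_1,\dots,\sigma_n$;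 and the buckets $H_v=\sum_{i:\,h(i)=v}\sigma_iQ^{(\ell)}_i$ for $v\in[w]$. Here $\nu=O(1)$, $0<\nu\le 1/20$, and $\phi=O(\epsilon^3/(KL^3))$ for $\ell=0$, $\phi=O(\epsilon^3/L^3)$ for $\ell\ge1$. Hash functions and signs are independent of the row sampling. The query $\mathrm{Query}_\ell(i)$ returns, of the $R$ buckets to which $i$ is hashed, the one with median value of $\|g(\cdot)\|_2$. Put $\lambda^{(\ell)}_i=\|g(\mathrm{Query}_\ell(i))\|_2^2$ and let $\Lambda_\ell$ be the set of the $\Theta(L^3/\epsilon^3)$ indices $i$ with largest $\lambda_i^{(\ell)}$. Let $\zeta$ be uniform on $[1/2,1]$, independent of everything else. No assumption is made on how different structures $\mathcal D_\ell$ depend on each other. *Levels.* For $j=0,1,\dots,L$ let $W_{j,\ell}$ be the set of $i\in\Lambda_\ell$ with $\lambda^{(\ell)}_i\in\left[(1+\epsilon)\zeta\widehat M/2^j,\ (2-\epsilon)\zeta\widehat M/2^j\right]$. If $j\le j_0$ put $\ell(j)=0$; if $j>j_0$ let $\ell(j)$ be the largest $\ell\in\{0,\dots,\hat L\}$ with $(1-\sqrt{20}\epsilon)L^2/\epsilon^2\le|W_{j,\ell}|\le2(1+\sqrt{20}\epsilon)L^2/\epsilon^2$,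 if there is one. Put $\widetilde M_j=2^{\ell(j)}\sum_{i\in W_{j,\ell(j)}}\lambda_i^{(\ell(j))}$, and $\widetilde M_j=0$ if $\ell(j)$ does not exist. *Output.* Sample $j^*\in\{0,\dots,L\}$ with probability proportional to $\widetilde M_j$, then $i^*\in W_{j^*,\ell(j^*)}$ with probability proportional to $\lambda_i^{(\ell(j^*))}$, and return $H=\mathrm{Query}_{\ell(j^*)}(i^*)$. If all $\widetilde M_j$ vanish, the algorithm fails. **Theorem.** There are absolute constants in the $O(\cdot)$ and $\Theta(\cdot)$ of the algorithm and an absolute constant $C>0$ such that for every $K\ge1$ the following holds for all sufficiently small $\epsilon>0$ (that is, $0<\epsilon\le\epsilon_0(K)$) and for all $n,d,A,b,\widehat M$ as above: with probability at least $0.9$, over all random choices, the algorithm does not fail and there exists $u\in[n]$ such that $$(1-C\epsilon)\left(\|f(A_u)\|_2^2+|b_u|^2\right)\le\|g(H)\|_2^2\le(1+C\epsilon)\left(\|f(A_u)\|_2^2+|b_u|^2\right).$$ -/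

import Mathlib

open MeasureTheory ProbabilityTheory
open scoped ENNReal

noncomputable section

namespace HSketch

/-! ### The entrywise transformations -/

/-- `f(x) = ln(1 + |x|)`. -/
def f (x : ℝ) : ℝ := Real.log (1 + |x|)

/-- `f` applied to each entry of a vector; the result carries the Euclidean norm. -/
def fVec {d : ℕ} (x : Fin d → ℝ) : EuclideanSpace ℝ (Fin d) :=
  WithLp.toLp 2 fun t => f (x t)

/-- `g(x) = (f(x_{1:d}), x_{d+1})`; the result carries the Euclidean norm. -/
def g {d : ℕ} (x : Fin (d + 1) → ℝ) : EuclideanSpace ℝ (Fin (d + 1)) :=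
  WithLp.toLp 2 (Fin.snoc (α := fun _ => ℝ) (fun t : Fin d => f (x t.castSucc)) (x (Fin.last d)))

/-- The concatenated matrix `(A b)`. -/
def concat {n d : ℕ} (A : Matrix (Fin n) (Fin d) ℝ) (b : Fin n → ℝ) :
    Matrix (Fin n) (Fin (d + 1)) ℝ :=
  Matrix.of fun i => Fin.snoc (α := fun _ => ℝ) (A i) (b i)

/-- `M = ∑ i, ‖T(B_i)‖²`, the squared Frobenius norm of the transformed matrix. -/
def mass {n m : ℕ} (T : (Fin m → ℝ) → EuclideanSpace ℝ (Fin m))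
    (B : Matrix (Fin n) (Fin m) ℝ) : ℝ :=
  ∑ i, ‖T (B i)‖ ^ 2

/-! ### The heavy hitter structures -/

/-- Bucket `v` of the basic structure: `∑_{i ∈ h⁻¹(v)} ε_i B_i`. -/
def bucket {n m w : ℕ} (B : Matrix (Fin n) (Fin m) ℝ) (h : Fin n → Fin w) (s : Fin n → ℤˣ)
    (v : Fin w) : Fin m → ℝ :=
  fun t => ∑ i with h i = v, ((s i : ℤ) : ℝ) * B i t

/-- The index of the (lower) median of the numbers `x r`. -/
def medianIndex {R : ℕ} (hR : 0 < R) (x : Fin R → ℝ) : Fin R :=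
  Tuple.sort x ⟨(R - 1) / 2, by omega⟩

/-- The answer of the complete structure (`R` basic structures) to the query `i`: of the `R`
vectors in the buckets to which `i` is hashed, the one whose transformed norm is the median. -/
def query {n m w R : ℕ} (T : (Fin m → ℝ) → EuclideanSpace ℝ (Fin m))
    (B : Matrix (Fin n) (Fin m) ℝ) (h : Fin R → Fin n → Fin w) (s : Fin R → Fin n → ℤˣ)
    (i : Fin n) : Fin m → ℝ :=
  if hR : 0 < R then
    bucket B (h (medianIndex hR fun r => ‖T (bucket B (h r) (s r) (h r i))‖))
      (s (medianIndex hR fun r => ‖T (bucket B (h r) (s r) (h r i))‖))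
      (h (medianIndex hR fun r => ‖T (bucket B (h r) (s r) (h r i))‖) i)
  else 0

/-- The indices of the `k` largest values of `x` (ties are broken in favour of small indices;
all indices if there are at most `k`). -/
def topIndices {n : ℕ} (k : ℕ) (x : Fin n → ℝ) : Finset (Fin n) :=
  {i | Finset.card {i' : Fin n | x i < x i' ∨ (x i' = x i ∧ i' < i)} < k}

/-! ### Parameters of the sampling algorithm -/

/-- The constants hidden in the `O(·)` and `Θ(·)` of the algorithm. -/
structure Constants where
  /-- the number of buckets is `cw / (φ²ν³)` -/
  cw : ℝ
  /-- the number of repetitions is `cR log(2n/δ)` -/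
  cR : ℝ
  /-- the accuracy parameter `ν = O(1)` of the heavy hitter structures -/
  ν : ℝ
  /-- `φ = cφ₀ ε³/(KL³)` in the structure for the full matrix -/
  cφ₀ : ℝ
  /-- `φ = cφ ε³/L³` in the structures for the downsampled matrices -/
  cφ : ℝ
  /-- the `cΛ L³/ε³` heaviest hitters of each structure are used -/
  cΛ : ℝ
  cw_pos : 0 < cw
  cR_pos : 0 < cR
  ν_pos : 0 < ν
  ν_le : ν ≤ 1 / 20
  cφ₀_pos : 0 < cφ₀
  cφ_pos : 0 < cφ
  cΛ_pos : 0 < cΛ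

/-- `L = log(Kn/ε)`, the index of the last level. -/
def levels (K ε : ℝ) (n : ℕ) : ℕ := ⌈Real.logb 2 (K * n / ε)⌉₊

/-- `L̂ = log n`, the number of downsampled structures. -/
def rates (n : ℕ) : ℕ := ⌈Real.logb 2 n⌉₊

/-- `j₀ = log(4Kε⁻³L³)`, the last level that is read off the full matrix. -/
def lastHeavyLevel (K ε : ℝ) (n : ℕ) : ℕ :=
  ⌈Real.logb 2 (4 * K * (levels K ε n : ℝ) ^ 3 / ε ^ 3)⌉₊

/-- The heaviness parameter `φ` of the `ℓ`-th structure. -/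
def phi (c : Constants) (K ε : ℝ) (n : ℕ) (ℓ : Fin (rates n + 1)) : ℝ :=
  if ℓ = 0 then c.cφ₀ * ε ^ 3 / (K * (levels K ε n : ℝ) ^ 3)
  else c.cφ * ε ^ 3 / (levels K ε n : ℝ) ^ 3

/-- The number of buckets `w = O(1/(φ²ν³))` of the `ℓ`-th structure. -/
def width (c : Constants) (K ε : ℝ) (n : ℕ) (ℓ : Fin (rates n + 1)) : ℕ :=
  ⌈c.cw / (phi c K ε n ℓ ^ 2 * c.ν ^ 3)⌉₊

/-- The number of repetitions `R = O(log(n/δ))`, where `δ = 1/(L̂ + 1)`. -/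
def reps (c : Constants) (n : ℕ) : ℕ :=
  ⌈c.cR * Real.log (2 * n / (1 / ((rates n : ℝ) + 1)))⌉₊

/-- The number `Θ(L³/ε³)` of heavy hitters taken from each structure. -/
def topSize (c : Constants) (K ε : ℝ) (n : ℕ) : ℕ :=
  ⌈c.cΛ * (levels K ε n : ℝ) ^ 3 / ε ^ 3⌉₊

/-! ### The randomness of the sketch -/

/-- A realisation of the random choices made by the sketch (the final sampling step excepted). -/
structure Seed (c : Constants) (K ε : ℝ) (n : ℕ) where
  /-- does row `i` survive in the matrix downsampled at rate `2⁻ℓ`? -/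
  keep : Fin (rates n + 1) → Fin n → Bool
  /-- the hash functions of the `ℓ`-th structure -/
  hash : (ℓ : Fin (rates n + 1)) → Fin (reps c n) → Fin n → Fin (width c K ε n ℓ)
  /-- the random signs of the `ℓ`-th structure -/
  sign : Fin (rates n + 1) → Fin (reps c n) → Fin n → ℤˣ
  /-- the random shift of the levels -/
  ζ : ℝ

/-- The values of the random function `X` at any `k` distinct points are independent and
uniformly distributed. -/
def KWiseIndependent {Ω ι β : Type*} [MeasurableSpace Ω] [Fintype β] (k : ℕ) (μ : Measure Ω)
    (X : Ω → ι → β) : Prop :=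
  ∀ s : Finset ι, s.card ≤ k → ∀ y : ι → β,
    μ {ω | ∀ i ∈ s, X ω i = y i} = (Fintype.card β : ℝ≥0∞)⁻¹ ^ s.card

/-- The joint law of the random choices of the sketch. Within each of the structures the
downsampling, the hash functions and the signs of all the repetitions are independent, and `ζ` is
independent of all of these; how different structures depend on each other does not matter (so
that both nested and independent downsampling are covered). -/
structure IsRandomSeed {Ω : Type*} [MeasurableSpace Ω] {c : Constants} {K ε : ℝ} {n : ℕ}
    (μ : Measure Ω) (S : Ω → Seed c K ε n) : Prop where
  measurable_keep : ∀ ℓ, Measurable fun ω => (S ω).keep ℓ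
  measurable_hash : ∀ ℓ r, Measurable fun ω => (S ω).hash ℓ r
  measurable_sign : ∀ ℓ r, Measurable fun ω => (S ω).sign ℓ r
  measurable_ζ : Measurable fun ω => (S ω).ζ
  /-- at rate `2⁻ℓ` each row survives with probability `2⁻ℓ` … -/
  keep_prob : ∀ ℓ i, μ {ω | (S ω).keep ℓ i = true} = (2 : ℝ≥0∞)⁻¹ ^ (ℓ : ℕ)
  /-- … independently of the other rows -/
  keep_indep : ∀ ℓ, iIndepFun (fun i ω => (S ω).keep ℓ i) μ
  hash_pairwise : ∀ ℓ r, KWiseIndependent 2 μ fun ω => (S ω).hash ℓ r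
  sign_fourwise : ∀ ℓ r, KWiseIndependent 4 μ fun ω => (S ω).sign ℓ r
  hash_indep_sign : ∀ ℓ r, IndepFun (fun ω => (S ω).hash ℓ r) (fun ω => (S ω).sign ℓ r) μ
  reps_indep : ∀ ℓ, iIndepFun (fun r ω => ((S ω).hash ℓ r, (S ω).sign ℓ r)) μ
  keep_indep_sketch : ∀ ℓ,
    IndepFun (fun ω => (S ω).keep ℓ) (fun ω => ((S ω).hash ℓ, (S ω).sign ℓ)) μ
  ζ_uniform : pdf.IsUniform (fun ω => (S ω).ζ) (Set.Icc (1 / 2) 1) μ volume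
  ζ_indep : IndepFun (fun ω => (S ω).ζ) (fun ω => ((S ω).keep, (S ω).hash, (S ω).sign)) μ

/-! ### The sampling algorithm -/

/-- Pick `a` with probability proportional to `wt a` (weights are nonnegative); `none` (failure)
if all the weights vanish. -/
def pick {α : Type} [Fintype α] (wt : α → ℝ) : PMF (Option α) :=
  if h : ∑ a, ENNReal.ofReal (wt a) = 0 then PMF.pure none
  else (PMF.normalize (fun a => ENNReal.ofReal (wt a)) (by rwa [tsum_fintype])
    (by rw [tsum_fintype]; exact ENNReal.sum_ne_top.2 fun _ _ => ENNReal.ofReal_ne_top)).map some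

section Algorithm

variable {c : Constants} {K ε : ℝ} {n m : ℕ} (T : (Fin m → ℝ) → EuclideanSpace ℝ (Fin m))
  (B : Matrix (Fin n) (Fin m) ℝ) (Mhat : ℝ) (σ : Seed c K ε n)

/-- The matrix downsampled at rate `2⁻ℓ`: the rows that do not survive are replaced by zero. -/
def downsample (ℓ : Fin (rates n + 1)) : Matrix (Fin n) (Fin m) ℝ :=
  Matrix.of fun i => if σ.keep ℓ i then B i else 0

/-- The answer of the `ℓ`-th structure to the query `i`. -/
def answer (ℓ : Fin (rates n + 1)) (i : Fin n) : Fin m → ℝ :=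
  query T (downsample B σ ℓ) (σ.hash ℓ) (σ.sign ℓ) i

/-- The estimate `λ_i` of the squared norm of the `i`-th transformed row by the `ℓ`-th
structure. -/
def estimate (ℓ : Fin (rates n + 1)) (i : Fin n) : ℝ := ‖T (answer T B σ ℓ i)‖ ^ 2

/-- `Λ_ℓ`, the top heavy hitters of the `ℓ`-th structure. -/
def heavyHitters (ℓ : Fin (rates n + 1)) : Finset (Fin n) :=
  topIndices (topSize c K ε n) (estimate T B σ ℓ)

/-- The elements of `Λ_ℓ` with estimate in `[(1+ε)ζM̂/2^j, (2-ε)ζM̂/2^j]`. -/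
def levelElements (j : ℕ) (ℓ : Fin (rates n + 1)) : Finset (Fin n) :=
  {i ∈ heavyHitters T B σ ℓ |
    estimate T B σ ℓ i ∈
      Set.Icc ((1 + ε) * (σ.ζ * Mhat / 2 ^ j)) ((2 - ε) * (σ.ζ * Mhat / 2 ^ j))}

/-- The `ℓ` for which `Λ_ℓ` contains an admissible number `s_j` of elements of level `j`. -/
def admissible (j : ℕ) : Finset (Fin (rates n + 1)) :=
  {ℓ | (1 - √20 * ε) * (levels K ε n : ℝ) ^ 2 / ε ^ 2 ≤ (levelElements T B Mhat σ j ℓ).card ∧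
    ((levelElements T B Mhat σ j ℓ).card : ℝ) ≤
      2 * (1 + √20 * ε) * (levels K ε n : ℝ) ^ 2 / ε ^ 2}

/-- The structure used for level `j`: the one for the full matrix if `j ≤ j₀`, and the largest
admissible one, if any, otherwise. -/
def chosen (j : ℕ) : Option (Fin (rates n + 1)) :=
  if j ≤ lastHeavyLevel K ε n then some 0
  else if h : (admissible T B Mhat σ j).Nonempty then some ((admissible T B Mhat σ j).max' h)
  else none

/-- The estimate `M̃_j` of the contribution of level `j`. -/
def levelMass (j : ℕ) : ℝ :=
  match chosen T B Mhat σ j with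
  | none => 0
  | some ℓ => (∑ i ∈ levelElements T B Mhat σ j ℓ, estimate T B σ ℓ i) * 2 ^ (ℓ : ℕ)

/-- The law of the returned vector, given the seed: a level `j ∈ {0, …, L}` is sampled with
probability proportional to `M̃_j`, then an element `i` of this level with probability
proportional to its estimate, and the answer to the query `i` is returned. -/
def output : PMF (Option (Fin m → ℝ)) :=
  (pick fun j : Fin (levels K ε n + 1) => levelMass T B Mhat σ j).bind fun j? =>
    match j? with
    | none => PMF.pure none
    | some j =>
      match chosen T B Mhat σ j with
      | none => PMF.pure none
      | some ℓ =>
        (pick fun i : Fin n =>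
          if i ∈ levelElements T B Mhat σ j ℓ then estimate T B σ ℓ i else 0).map
          (Option.map (answer T B σ ℓ))

/-- The probability, over the seed and over the final sampling, that the algorithm returns a
vector (that is, does not fail) and that this vector has the property `P`. -/
def successProb {Ω : Type*} [MeasurableSpace Ω] (μ : Measure Ω) (S : Ω → Seed c K ε n)
    (P : (Fin m → ℝ) → Prop) : ℝ≥0∞ :=
  ∫⁻ ω, (output T B Mhat (S ω)).toOuterMeasure {v? | ∃ v, v? = some v ∧ P v} ∂μ

end Algorithm

end HSketch

end

/-!
If every structure `ℓ` answered every query to relative accuracy `ε`, then any sampled row would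
do, so the point is to show that little of the total level mass comes from structures that do not.

A structure with `w` buckets estimates every `‖T (B i)‖` up to an additive error of order
`√(mass / w)`: signs with pairwise independent hashing make the expected squared norm of the noise
in a bucket at most `2 / w` times the mass of the sampled matrix, the norm `‖T ·‖` is even and
subadditive, and the median over independent repetitions makes the bound hold for all rows at
once. A heavy level (`j ≤ j₀`) is therefore read off accurately from the full matrix, and a lighter
one from the sample in which it retains about `L² / ε²` rows, which concentrate by Chebyshev's
inequality.

The random shift `ζ` keeps the mass near the boundaries of the levels small (Markov's inequality),
so the levels account for a fraction of order `1 / (K L)` of the total mass. A level whose estimate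
comes from a structure that is not accurate at its scale contributes only `O(ε² mass / L³)`,
because an admissible level has `O(L² / ε²)` elements. The sampled row hence belongs to an
accurately read level with probability at least `99 / 100`.
-/

namespace HSketch

section Probability

variable {Ω : Type*} [MeasurableSpace Ω] {μ : Measure Ω}

theorem measure_mem_le_of_indepFun [IsProbabilityMeasure μ] {α β : Type*} [MeasurableSpace α]
    [MeasurableSpace β] [Finite β] [MeasurableSingletonClass β] {Y : Ω → β} {X : Ω → α}
    (hY : Measurable Y) (hYX : IndepFun Y X μ) {D : β → Set α} (hD : ∀ y, MeasurableSet (D y))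
    {p : ℝ≥0∞} (hp : ∀ y, μ (X ⁻¹' D y) ≤ p) : μ {ω | X ω ∈ D (Y ω)} ≤ p := by
  cases nonempty_fintype β
  have hunion : {ω | X ω ∈ D (Y ω)} = ⋃ y ∈ Finset.univ, (Y ⁻¹' {y} ∩ X ⁻¹' D y) := by
    ext ω; simp
  calc μ {ω | X ω ∈ D (Y ω)} ≤ ∑ y, μ (Y ⁻¹' {y} ∩ X ⁻¹' D y) := by
        rw [hunion]; exact measure_biUnion_finset_le _ _
    _ ≤ ∑ y, μ (Y ⁻¹' {y}) * p := Finset.sum_le_sum fun y _ => by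
        rw [hYX.measure_inter_preimage_eq_mul _ _ (measurableSet_singleton y) (hD y)]
        gcongr; exact hp y
    _ = p := by
        rw [← Finset.sum_mul, sum_measure_preimage_singleton _ fun y _ =>
          hY (measurableSet_singleton y)]
        simp

theorem lintegral_le_of_indepFun [IsFiniteMeasure μ] {α β : Type*} [MeasurableSpace α]
    [MeasurableSpace β] {X : Ω → α} {Y : Ω → β} (hX : Measurable X) (hY : Measurable Y)
    (hXY : IndepFun X Y μ) {F : α → β → ℝ≥0∞} (hF : Measurable F.uncurry) {G : α → ℝ≥0∞}
    (hG : Measurable G) (hFG : ∀ a, ∫⁻ ω, F a (Y ω) ∂μ ≤ G a) :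
    ∫⁻ ω, F (X ω) (Y ω) ∂μ ≤ ∫⁻ ω, G (X ω) ∂μ := by
  calc ∫⁻ ω, F (X ω) (Y ω) ∂μ = ∫⁻ q, F.uncurry q ∂μ.map fun ω => (X ω, Y ω) :=
        (lintegral_map hF (hX.prodMk hY)).symm
    _ = ∫⁻ a, ∫⁻ b, F a b ∂μ.map Y ∂μ.map X := by
        rw [(indepFun_iff_map_prod_eq_prod_map_map hX.aemeasurable hY.aemeasurable).1 hXY,
          lintegral_prod _ hF.aemeasurable]
        rfl
    _ ≤ ∫⁻ a, G a ∂μ.map X := lintegral_mono fun a =>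
        (lintegral_map (hF.comp measurable_prodMk_left) hY).trans_le (hFG a)
    _ = ∫⁻ ω, G (X ω) ∂μ := lintegral_map hG hX

/-- Each of the at most `2 ^ R` index sets containing half of the indices contributes `q ^ R`. -/
theorem measure_half_mem_le {ι α : Type*} [Fintype ι] [MeasurableSpace α] {X : ι → Ω → α}
    (hX : iIndepFun X μ) {D : ι → Set α} (hD : ∀ r, MeasurableSet (D r)) {q : ℝ≥0∞}
    (hq : q ≤ 1) (hp : ∀ r, μ (X r ⁻¹' D r) ≤ q ^ 2) :
    μ {ω | ∃ J : Finset ι, Fintype.card ι ≤ 2 * J.card ∧ ∀ r ∈ J, X r ω ∈ D r} ≤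
      (2 * q) ^ Fintype.card ι := by
  classical
  set R := Fintype.card ι
  have hunion : {ω | ∃ J : Finset ι, R ≤ 2 * J.card ∧ ∀ r ∈ J, X r ω ∈ D r} =
      ⋃ J ∈ Finset.univ.filter fun J : Finset ι => R ≤ 2 * J.card, ⋂ r ∈ J, X r ⁻¹' D r := by
    ext ω; simp
  have hinter (J : Finset ι) (hJ : R ≤ 2 * J.card) : μ (⋂ r ∈ J, X r ⁻¹' D r) ≤ q ^ R := by
    rw [hX.measure_inter_preimage_eq_mul J fun r _ => hD r]
    calc ∏ r ∈ J, μ (X r ⁻¹' D r)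
        ≤ (q ^ 2) ^ J.card := Finset.prod_le_pow_card _ _ _ fun r _ => hp r
      _ = q ^ (2 * J.card) := (pow_mul _ _ _).symm
      _ ≤ q ^ R := pow_le_pow_right_of_le_one' hq hJ
  calc _ ≤ ∑ J ∈ Finset.univ.filter fun J : Finset ι => R ≤ 2 * J.card,
          μ (⋂ r ∈ J, X r ⁻¹' D r) := by rw [hunion]; exact measure_biUnion_finset_le _ _
    _ ≤ ∑ _ ∈ Finset.univ.filter fun J : Finset ι => R ≤ 2 * J.card, q ^ R :=
        Finset.sum_le_sum fun J hJ => hinter J (Finset.mem_filter.1 hJ).2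
    _ ≤ 2 ^ R * q ^ R := by
        rw [Finset.sum_const, nsmul_eq_mul]
        gcongr
        exact_mod_cast (Finset.card_le_univ _).trans_eq Fintype.card_finset
    _ = (2 * q) ^ R := (mul_pow _ _ _).symm

theorem mul_le_lintegral_of_measure_not_le [IsProbabilityMeasure μ] {F : Ω → ℝ≥0∞}
    {good : Ω → Prop} {a p : ℝ≥0∞} (hp : μ {ω | ¬ good ω} ≤ p) (hF : ∀ ω, good ω → a ≤ F ω) :
    a * (1 - p) ≤ ∫⁻ ω, F ω ∂μ := by
  set D := toMeasurable μ {ω | ¬ good ω}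
  have hD : MeasurableSet D := measurableSet_toMeasurable _ _
  calc a * (1 - p) ≤ a * μ Dᶜ := by
        rw [prob_compl_eq_one_sub hD, measure_toMeasurable]; gcongr
    _ = ∫⁻ ω, Dᶜ.indicator (fun _ => a) ω ∂μ := (lintegral_indicator_const hD.compl a).symm
    _ ≤ ∫⁻ ω, F ω ∂μ := lintegral_mono fun ω => Set.indicator_apply_le fun hω =>
        hF ω (not_not.1 fun hgood => hω (subset_toMeasurable μ _ hgood))

theorem measure_mul_lt_le_inv {X : Ω → ℝ} (hX : Measurable X) {q : ℝ} (hq : 0 ≤ q)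
    (hint : ∫⁻ ω, ENNReal.ofReal (X ω) ∂μ ≤ ENNReal.ofReal q) {c : ℝ} (hc : 0 < c) :
    μ {ω | c * q < X ω} ≤ (ENNReal.ofReal c)⁻¹ := by
  rcases hq.eq_or_lt with rfl | hq
  · have hzero : ∀ᵐ ω ∂μ, ENNReal.ofReal (X ω) = 0 :=
      (lintegral_eq_zero_iff hX.ennreal_ofReal).1 (by simpa using hint)
    refine (measure_mono_null (fun ω hω => ?_) (ae_iff.1 hzero)).trans_le zero_le
    simpa using hω
  · calc μ {ω | c * q < X ω} ≤ μ {ω | ENNReal.ofReal (c * q) ≤ ENNReal.ofReal (X ω)} :=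
          measure_mono fun ω hω => ENNReal.ofReal_le_ofReal (le_of_lt hω)
      _ ≤ (∫⁻ ω, ENNReal.ofReal (X ω) ∂μ) / ENNReal.ofReal (c * q) :=
          meas_ge_le_lintegral_div hX.ennreal_ofReal.aemeasurable
            (ENNReal.ofReal_pos.2 (by positivity)).ne' ENNReal.ofReal_ne_top
      _ ≤ ENNReal.ofReal q / ENNReal.ofReal (c * q) := by gcongr
      _ = (ENNReal.ofReal c)⁻¹ := by
          rw [← ENNReal.ofReal_div_of_pos (by positivity), ← ENNReal.ofReal_inv_of_pos hc]
          congr 1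
          field_simp

theorem KWiseIndependent.mono {ι β : Type*} [Fintype β] {k l : ℕ} {X : Ω → ι → β}
    (h : KWiseIndependent l μ X) (hkl : k ≤ l) : KWiseIndependent k μ X :=
  fun s hs => h s (hs.trans hkl)

theorem KWiseIndependent.map {ι β : Type*} [Finite ι] [Fintype β] [MeasurableSpace β]
    [MeasurableSingletonClass β] {k : ℕ} {X : Ω → ι → β} (h : KWiseIndependent k μ X)
    (hX : Measurable X) : KWiseIndependent k (μ.map X) id := by
  intro s hs y
  rw [Measure.map_apply hX (Set.toFinite _).measurableSet]
  exact h s hs y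

theorem KWiseIndependent.measure_collision {ι β : Type*} [Finite ι] [Fintype β] [Nonempty β]
    [MeasurableSpace β] [MeasurableSingletonClass β] {X : Ω → ι → β} (h : KWiseIndependent 2 μ X)
    (hX : Measurable X) {k i : ι} (hki : k ≠ i) :
    μ {ω | X ω k = X ω i} = (Fintype.card β : ℝ≥0∞)⁻¹ := by
  classical
  have hunion : {ω | X ω k = X ω i} =
      ⋃ v ∈ Finset.univ, {ω | ∀ l ∈ ({k, i} : Finset ι), X ω l = v} := by
    ext ω
    simp only [Set.mem_ofPred_eq, Set.mem_iUnion, Finset.mem_insert, Finset.mem_singleton,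
      forall_eq_or_imp, forall_eq]
    exact ⟨fun hω => ⟨X ω i, Finset.mem_univ _, hω, rfl⟩, fun ⟨v, _, hk, hi⟩ => hk.trans hi.symm⟩
  have hdisjoint : Set.PairwiseDisjoint (↑(Finset.univ : Finset β))
      fun v => {ω | ∀ l ∈ ({k, i} : Finset ι), X ω l = v} := by
    intro u _ v _ huv
    rw [Function.onFun, Set.disjoint_left]
    exact fun ω hu hv => huv ((hu k (by simp)).symm.trans (hv k (by simp)))
  rw [hunion, measure_biUnion_finset hdisjoint fun v _ =>
      hX (Set.toFinite {x : ι → β | ∀ l ∈ ({k, i} : Finset ι), x l = v}).measurableSet,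
    Finset.sum_congr rfl fun v _ => h {k, i} (Finset.card_pair hki).le fun _ => v,
    Finset.card_pair hki, Finset.sum_const, nsmul_eq_mul, Finset.card_univ, sq, ← mul_assoc,
    ENNReal.mul_inv_cancel (by simp) (by simp), one_mul]

theorem KWiseIndependent.lintegral_sum_collisions_le {ι β : Type*} [Fintype ι] [DecidableEq ι]
    [Fintype β] [Nonempty β] [DecidableEq β] [MeasurableSpace β] [MeasurableSingletonClass β]
    {X : Ω → ι → β} (h : KWiseIndependent 2 μ X) (hX : Measurable X) (i : ι) (x : ι → ℝ≥0∞) :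
    ∫⁻ ω, ∑ k with X ω k = X ω i ∧ k ≠ i, x k ∂μ ≤ (∑ k, x k) / Fintype.card β := by
  have hsum (ω : Ω) : ∑ k with X ω k = X ω i ∧ k ≠ i, x k =
      ∑ k ∈ Finset.univ.erase i, {ω | X ω k = X ω i}.indicator (fun _ => x k) ω := by
    simp only [Set.indicator_apply, Set.mem_ofPred_eq]
    rw [← Finset.sum_filter]
    exact Finset.sum_congr (by ext k; simp [and_comm]) fun _ _ => rfl
  have hmeas (k : ι) : MeasurableSet {ω | X ω k = X ω i} :=
    hX (Set.toFinite {x : ι → β | x k = x i}).measurableSet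
  simp only [hsum]
  rw [lintegral_finsetSum _ fun k _ => measurable_const.indicator (hmeas k)]
  calc ∑ k ∈ Finset.univ.erase i, ∫⁻ ω, {ω | X ω k = X ω i}.indicator (fun _ => x k) ω ∂μ
      = ∑ k ∈ Finset.univ.erase i, x k / Fintype.card β := Finset.sum_congr rfl fun k hk => by
        rw [lintegral_indicator_const (hmeas k),
          h.measure_collision hX (Finset.ne_of_mem_erase hk), div_eq_mul_inv]
    _ ≤ ∑ k, x k / Fintype.card β := Finset.sum_le_univ_sum_of_nonneg fun _ => zero_le
    _ = (∑ k, x k) / Fintype.card β := by simp only [div_eq_mul_inv, Finset.sum_mul]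

end Probability

section OrderStatistics

theorem medianIndex_mem_Icc {R : ℕ} (hR : 0 < R) (x : Fin R → ℝ) {lo hi : ℝ}
    (h : 2 * Finset.card {r | x r ∉ Set.Icc lo hi} < R) :
    x (medianIndex hR x) ∈ Set.Icc lo hi := by
  set mid : Fin R := ⟨(R - 1) / 2, by lia⟩ with hmid
  have hmono : Monotone (x ∘ Tuple.sort x) := Tuple.monotone_sort x
  have hcard (s : Finset (Fin R)) (hs : ∀ k ∈ s, x (Tuple.sort x k) ∉ Set.Icc lo hi) :
      2 * s.card < R := by
    have := Finset.card_le_card_of_injOn (t := {r | x r ∉ Set.Icc lo hi}) (Tuple.sort x)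
      (fun k hk => by simpa using hs k hk) (Tuple.sort x).injective.injOn
    lia
  change lo ≤ x (Tuple.sort x mid) ∧ x (Tuple.sort x mid) ≤ hi
  constructor
  · by_contra hlo
    have := hcard (Finset.Iic mid) fun k hk hk' =>
      hlo (hk'.1.trans (hmono (Finset.mem_Iic.1 hk)))
    rw [Fin.card_Iic, hmid] at this
    lia
  · by_contra hhi
    have := hcard (Finset.Ici mid) fun k hk hk' =>
      hhi ((hmono (Finset.mem_Ici.1 hk)).trans hk'.2)
    rw [Fin.card_Ici, hmid] at this
    lia

variable {n : ℕ} {k : ℕ} {x : Fin n → ℝ}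

/-- The number of entries preceding `x i` in the decreasing order, with the tie-breaking of
`topIndices`. -/
noncomputable def rank (x : Fin n → ℝ) (i : Fin n) : ℕ :=
  Finset.card {i' : Fin n | x i < x i' ∨ (x i' = x i ∧ i' < i)}

theorem mem_topIndices {i : Fin n} : i ∈ topIndices k x ↔ rank x i < k := by
  simp [topIndices, rank]

theorem rank_lt_rank {i j : Fin n} (h : x i < x j ∨ (x j = x i ∧ j < i)) :
    rank x j < rank x i := by
  refine Finset.card_lt_card ((Finset.ssubset_iff_of_subset fun i' hi' => ?_).2
    ⟨j, by simpa using h, by simp⟩)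
  simp only [Finset.mem_filter, Finset.mem_univ, true_and] at hi' ⊢
  grind

theorem mem_topIndices_of_card_le {i : Fin n} (h : Finset.card {i' | x i ≤ x i'} ≤ k) :
    i ∈ topIndices k x := by
  refine mem_topIndices.2 (lt_of_lt_of_le (Finset.card_lt_card
    ((Finset.ssubset_iff_of_subset fun i' hi' => ?_).2 ⟨i, by simp, by simp⟩)) h)
  simp only [Finset.mem_filter, Finset.mem_univ, true_and] at hi' ⊢
  grind

theorem le_card_topIndices_of_notMem {i : Fin n} (h : i ∉ topIndices k x) :
    k ≤ (topIndices k x).card := by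
  obtain ⟨j, hj, hmin⟩ := Finset.exists_min_image {j | j ∉ topIndices k x} (rank x)
    ⟨i, by simpa using h⟩
  rw [Finset.mem_filter_univ, mem_topIndices, not_lt] at hj
  refine hj.trans (Finset.card_le_card fun i' hi' => ?_)
  by_contra hi'_notMem
  exact (rank_lt_rank (by simpa using hi')).not_ge (hmin i' (by simpa using hi'_notMem))

theorem le_of_notMem_topIndices {i i' : Fin n} (h : i ∉ topIndices k x)
    (h' : i' ∈ topIndices k x) : x i ≤ x i' := by
  rw [mem_topIndices] at h h'
  by_contra hlt
  exact h (((rank_lt_rank (Or.inl (not_le.1 hlt))).trans h'))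

end OrderStatistics

instance : MeasurableSingletonClass ℤˣ where
  measurableSet_singleton u :=
    ⟨{(u : ℤ)}, measurableSet_singleton _, by ext v; simp [Units.ext_iff]⟩

/-- The transformations to which the sketch applies: the norm `‖T ·‖` is even and subadditive, and
adding up rows with `4`-wise independent signs at most doubles the expected squared norm. -/
structure IsSketchable {m : ℕ} (T : (Fin m → ℝ) → EuclideanSpace ℝ (Fin m)) : Prop where
  norm_neg : ∀ x, ‖T (-x)‖ = ‖T x‖
  norm_add_le : ∀ x y, ‖T (x + y)‖ ≤ ‖T x‖ + ‖T y‖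
  integral_norm_sq_le : ∀ {n : ℕ} (ν : Measure (Fin n → ℤˣ)) [IsProbabilityMeasure ν],
    KWiseIndependent 4 ν id → ∀ (I : Finset (Fin n)) (B : Matrix (Fin n) (Fin m) ℝ),
      ∫ s, ‖T fun t => ∑ k ∈ I, ((s k : ℤ) : ℝ) * B k t‖ ^ 2 ∂ν ≤ 2 * ∑ k ∈ I, ‖T (B k)‖ ^ 2

theorem mass_nonneg {n m : ℕ} (T : (Fin m → ℝ) → EuclideanSpace ℝ (Fin m))
    (B : Matrix (Fin n) (Fin m) ℝ) : 0 ≤ mass T B :=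
  Finset.sum_nonneg fun _ _ => by positivity

/-- The rows, other than row `i`, that are hashed to the bucket of `i`. -/
def noise {n m w : ℕ} (B : Matrix (Fin n) (Fin m) ℝ) (h : Fin n → Fin w) (s : Fin n → ℤˣ)
    (i : Fin n) : Fin m → ℝ :=
  fun t => ∑ k with h k = h i ∧ k ≠ i, ((s k : ℤ) : ℝ) * B k t

theorem bucket_eq_add_noise {n m w : ℕ} (B : Matrix (Fin n) (Fin m) ℝ) (h : Fin n → Fin w)
    (s : Fin n → ℤˣ) (i : Fin n) :
    bucket B h s (h i) = (fun t => ((s i : ℤ) : ℝ) * B i t) + noise B h s i := by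
  have hfilter : (Finset.univ.filter fun k => h k = h i) =
      insert i (Finset.univ.filter fun k => h k = h i ∧ k ≠ i) := by
    ext k
    by_cases hk : k = i <;> simp [hk]
  ext t
  simp only [bucket, noise, Pi.add_apply, hfilter]
  rw [Finset.sum_insert (by simp)]

namespace IsSketchable

variable {m : ℕ} {T : (Fin m → ℝ) → EuclideanSpace ℝ (Fin m)} (hT : IsSketchable T)

include hT

theorem norm_zero : ‖T 0‖ = 0 := by
  have : IsProbabilityMeasure (Measure.dirac (fun _ : Fin 0 => (1 : ℤˣ))) := inferInstance
  have hindep : KWiseIndependent 4 (Measure.dirac fun _ : Fin 0 => (1 : ℤˣ)) id := by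
    intro s _ y
    simp [Finset.eq_empty_of_isEmpty s]
  have hle := hT.integral_norm_sq_le _ hindep ∅ 0
  simp only [Finset.sum_empty, mul_zero, integral_const, probReal_univ, one_smul] at hle
  exact pow_eq_zero_iff two_ne_zero |>.1 (hle.antisymm (sq_nonneg _))

theorem norm_unit_mul (u : ℤˣ) (x : Fin m → ℝ) : ‖T fun t => ((u : ℤ) : ℝ) * x t‖ = ‖T x‖ := by
  rcases Int.units_eq_one_or u with rfl | rfl
  · simp
  · rw [← hT.norm_neg x]
    congr! 2
    ext t
    simp

theorem abs_norm_add_sub_le (x y : Fin m → ℝ) : |‖T (x + y)‖ - ‖T x‖| ≤ ‖T y‖ := by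
  have hle := hT.norm_add_le x y
  have hge := hT.norm_add_le (x + y) (-y)
  rw [hT.norm_neg, add_neg_cancel_right] at hge
  exact abs_le.2 ⟨by linarith, by linarith⟩

theorem abs_norm_bucket_sub_le {n w : ℕ} (B : Matrix (Fin n) (Fin m) ℝ) (h : Fin n → Fin w)
    (s : Fin n → ℤˣ) (i : Fin n) :
    |‖T (bucket B h s (h i))‖ - ‖T (B i)‖| ≤ ‖T (noise B h s i)‖ := by
  rw [bucket_eq_add_noise, ← hT.norm_unit_mul (s i) (B i)]
  exact hT.abs_norm_add_sub_le _ _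

end IsSketchable

section Accuracy

variable {Ω : Type*} [MeasurableSpace Ω] {μ : Measure Ω} [IsProbabilityMeasure μ] {n m w : ℕ}
  {T : (Fin m → ℝ) → EuclideanSpace ℝ (Fin m)}

theorem lintegral_norm_noise_le (hT : IsSketchable T) (B : Matrix (Fin n) (Fin m) ℝ)
    {h : Ω → Fin n → Fin w} {s : Ω → Fin n → ℤˣ} (hh : Measurable h) (hs : Measurable s)
    (hh2 : KWiseIndependent 2 μ h) (hs4 : KWiseIndependent 4 μ s) (hhs : IndepFun h s μ)
    (i : Fin n) :
    ∫⁻ ω, ENNReal.ofReal (‖T (noise B (h ω) (s ω) i)‖ ^ 2) ∂μ ≤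
      ENNReal.ofReal (2 * mass T B / w) := by
  have hbuckets : Nonempty (Fin w) := ⟨h μ.nonempty_of_neZero.some i⟩
  have := Measure.isProbabilityMeasure_map (μ := μ) hs.aemeasurable
  have hnoise (a : Fin n → Fin w) : ∫⁻ ω, ENNReal.ofReal (‖T (noise B a (s ω) i)‖ ^ 2) ∂μ ≤
      2 * ∑ k with a k = a i ∧ k ≠ i, ENNReal.ofReal (‖T (B k)‖ ^ 2) := by
    rw [← lintegral_map (f := fun b => ENNReal.ofReal (‖T (noise B a b i)‖ ^ 2))
      (measurable_of_countable _) hs, ← ofReal_integral_eq_lintegral_ofReal Integrable.of_finite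
      (Filter.Eventually.of_forall fun b => by positivity)]
    refine (ENNReal.ofReal_le_ofReal (hT.integral_norm_sq_le _ (hs4.map hs) _ B)).trans_eq ?_
    rw [ENNReal.ofReal_mul zero_le_two, ENNReal.ofReal_sum_of_nonneg fun _ _ => by positivity,
      ENNReal.ofReal_ofNat]
  calc _ ≤ ∫⁻ ω, 2 * ∑ k with h ω k = h ω i ∧ k ≠ i, ENNReal.ofReal (‖T (B k)‖ ^ 2) ∂μ :=
        lintegral_le_of_indepFun hh hs hhs
          (F := fun a b => ENNReal.ofReal (‖T (noise B a b i)‖ ^ 2)) (measurable_of_countable _)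
          (G := fun a => 2 * ∑ k with a k = a i ∧ k ≠ i, ENNReal.ofReal (‖T (B k)‖ ^ 2))
          (measurable_of_countable _) hnoise
    _ ≤ 2 * ((∑ k, ENNReal.ofReal (‖T (B k)‖ ^ 2)) / Fintype.card (Fin w)) := by
        rw [lintegral_const_mul' _ _ ENNReal.ofNat_ne_top]
        gcongr
        exact hh2.lintegral_sum_collisions_le hh i _
    _ = ENNReal.ofReal (2 * mass T B / w) := by
        have hw : (0 : ℝ) < w := by exact_mod_cast Fin.pos_iff_nonempty.2 hbuckets
        rw [mul_div_assoc, ENNReal.ofReal_mul zero_le_two, ENNReal.ofReal_div_of_pos hw, mass,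
          ENNReal.ofReal_sum_of_nonneg fun _ _ => by positivity]
        simp

theorem measure_noise_le (hT : IsSketchable T) (B : Matrix (Fin n) (Fin m) ℝ)
    {h : Ω → Fin n → Fin w} {s : Ω → Fin n → ℤˣ} (hh : Measurable h) (hs : Measurable s)
    (hh2 : KWiseIndependent 2 μ h) (hs4 : KWiseIndependent 4 μ s) (hhs : IndepFun h s μ)
    (i : Fin n) {c : ℝ} (hc : 0 < c) :
    μ {ω | c * (2 * mass T B / w) < ‖T (noise B (h ω) (s ω) i)‖ ^ 2} ≤ (ENNReal.ofReal c)⁻¹ := by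
  have hmeas : Measurable fun q : (Fin n → Fin w) × (Fin n → ℤˣ) => ‖T (noise B q.1 q.2 i)‖ ^ 2 :=
    measurable_of_countable _
  have := mass_nonneg T B
  exact measure_mul_lt_le_inv (hmeas.comp (hh.prodMk hs)) (by positivity)
    (lintegral_norm_noise_le hT B hh hs hh2 hs4 hhs i) hc

theorem abs_norm_query_sub_le {R : ℕ} (hT : IsSketchable T) (hR : 0 < R)
    (B : Matrix (Fin n) (Fin m) ℝ) (h : Fin R → Fin n → Fin w) (s : Fin R → Fin n → ℤˣ) (i : Fin n)
    {τ : ℝ} (hτ : ∀ J : Finset (Fin R), R ≤ 2 * J.card →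
      ∃ r ∈ J, ‖T (noise B (h r) (s r) i)‖ ≤ τ) :
    |‖T (query T B h s i)‖ - ‖T (B i)‖| ≤ τ := by
  set x : Fin R → ℝ := fun r => ‖T (bucket B (h r) (s r) (h r i))‖
  have hquery : ‖T (query T B h s i)‖ = x (medianIndex hR x) := by rw [query, dif_pos hR]
  have hmem : x (medianIndex hR x) ∈ Set.Icc (‖T (B i)‖ - τ) (‖T (B i)‖ + τ) := by
    refine medianIndex_mem_Icc hR x (not_le.1 fun hmany => ?_)
    obtain ⟨r, hr, hle⟩ := hτ _ hmany
    have := abs_le.1 ((hT.abs_norm_bucket_sub_le B (h r) (s r) i).trans hle)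
    exact (Finset.mem_filter.1 hr).2 ⟨by linarith [this.1], by linarith [this.2]⟩
  rw [hquery]
  exact abs_le.2 ⟨by linarith [hmem.1], by linarith [hmem.2]⟩

theorem measure_query_le {R : ℕ} (hT : IsSketchable T) (hR : 0 < R) (B : Matrix (Fin n) (Fin m) ℝ)
    {h : Ω → Fin R → Fin n → Fin w} {s : Ω → Fin R → Fin n → ℤˣ}
    (hh : ∀ r, Measurable fun ω => h ω r) (hs : ∀ r, Measurable fun ω => s ω r)
    (hh2 : ∀ r, KWiseIndependent 2 μ fun ω => h ω r)
    (hs4 : ∀ r, KWiseIndependent 4 μ fun ω => s ω r)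
    (hhs : ∀ r, IndepFun (fun ω => h ω r) (fun ω => s ω r) μ)
    (hreps : iIndepFun (fun r ω => (h ω r, s ω r)) μ) (i : Fin n) :
    μ {ω | √(128 * mass T B / w) < |‖T (query T B (h ω) (s ω) i)‖ - ‖T (B i)‖|} ≤ 4⁻¹ ^ R := by
  have hnoise (r : Fin R) :
      μ {ω | 128 * mass T B / w < ‖T (noise B (h ω r) (s ω r) i)‖ ^ 2} ≤ 8⁻¹ ^ 2 := by
    convert measure_noise_le hT B (hh r) (hs r) (hh2 r) (hs4 r) (hhs r) i (c := 64) (by norm_num)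
      using 1
    · ring_nf
    · rw [← ENNReal.inv_pow]; norm_num
  have hmany := measure_half_mem_le hreps
    (D := fun _ => {q | 128 * mass T B / w < ‖T (noise B q.1 q.2 i)‖ ^ 2})
    (fun _ => (Set.toFinite _).measurableSet) (by simp) hnoise
  have htwo : (2 * 8⁻¹ : ℝ≥0∞) = 4⁻¹ := by
    rw [show (8 : ℝ≥0∞) = 2 * 4 by norm_num, ENNReal.mul_inv (by simp) (by simp), ← mul_assoc,
      ENNReal.mul_inv_cancel (by simp) (by simp), one_mul]
  rw [htwo, Fintype.card_fin] at hmany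
  refine (measure_mono fun ω hω => ?_).trans hmany
  by_contra hfew
  refine (not_le.2 hω) (abs_norm_query_sub_le hT hR B (h ω) (s ω) i fun J hJ => ?_)
  simp only [Set.mem_ofPred_eq, not_exists, not_and, not_forall, not_lt] at hfew
  obtain ⟨r, hr, hle⟩ := hfew J hJ
  exact ⟨r, hr, Real.le_sqrt_of_sq_le hle⟩

end Accuracy

theorem downsample_apply {c : Constants} {K ε : ℝ} {n m : ℕ} (B : Matrix (Fin n) (Fin m) ℝ)
    (σ : Seed c K ε n) (ℓ : Fin (rates n + 1)) (i : Fin n) :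
    downsample B σ ℓ i = if σ.keep ℓ i then B i else 0 := rfl

/-- The additive error with which the `ℓ`-th structure estimates the norms of the transformed
rows. -/
noncomputable def tol {c : Constants} {K ε : ℝ} {n m : ℕ}
    (T : (Fin m → ℝ) → EuclideanSpace ℝ (Fin m)) (B : Matrix (Fin n) (Fin m) ℝ)
    (σ : Seed c K ε n) (ℓ : Fin (rates n + 1)) : ℝ :=
  √(128 * mass T (downsample B σ ℓ) / width c K ε n ℓ)

theorem measure_answer_le {Ω : Type*} [MeasurableSpace Ω] {μ : Measure Ω}
    [IsProbabilityMeasure μ] {c : Constants} {K ε : ℝ} {n m : ℕ} {S : Ω → Seed c K ε n}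
    (hS : IsRandomSeed μ S) (hR : 0 < reps c n) {T : (Fin m → ℝ) → EuclideanSpace ℝ (Fin m)}
    (hT : IsSketchable T) (B : Matrix (Fin n) (Fin m) ℝ) (ℓ : Fin (rates n + 1)) :
    μ {ω | ∃ i, tol T B (S ω) ℓ < |‖T (answer T B (S ω) ℓ i)‖ - ‖T (downsample B (S ω) ℓ i)‖|} ≤
      n * 4⁻¹ ^ reps c n := by
  set kept : (Fin n → Bool) → Matrix (Fin n) (Fin m) ℝ := fun κ =>
    Matrix.of fun i => if κ i then B i else 0
  have hquery (i : Fin n) : μ {ω | tol T B (S ω) ℓ <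
      |‖T (answer T B (S ω) ℓ i)‖ - ‖T (downsample B (S ω) ℓ i)‖|} ≤ 4⁻¹ ^ reps c n :=
    measure_mem_le_of_indepFun (hS.measurable_keep ℓ) (hS.keep_indep_sketch ℓ)
      (D := fun κ => {q | √(128 * mass T (kept κ) / width c K ε n ℓ) <
        |‖T (query T (kept κ) q.1 q.2 i)‖ - ‖T (kept κ i)‖|})
      (fun κ => (Set.toFinite _).measurableSet)
      fun κ => measure_query_le hT hR (kept κ) (hS.measurable_hash ℓ) (hS.measurable_sign ℓ)
        (hS.hash_pairwise ℓ) (hS.sign_fourwise ℓ) (hS.hash_indep_sign ℓ) (hS.reps_indep ℓ) i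
  rw [Set.ofPred_exists]
  calc _ ≤ ∑ i : Fin n, _ := measure_iUnion_fintype_le _ _
    _ ≤ ∑ _ : Fin n, 4⁻¹ ^ reps c n := Finset.sum_le_sum fun i _ => hquery i
    _ = n * 4⁻¹ ^ reps c n := by simp

section Downsampling

variable {Ω : Type*} [MeasurableSpace Ω] {μ : Measure Ω}

theorem measure_le_abs_card_filter_sub_le [IsProbabilityMeasure μ] {ι : Type*} {X : ι → Ω → Bool}
    (hX : ∀ i, Measurable (X i)) (hindep : Pairwise fun i j => IndepFun (X i) (X j) μ) {p : ℝ}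
    (hp : ∀ i, μ.real {ω | X i ω = true} = p) (I : Finset ι) {t : ℝ} (ht : 0 < t) :
    μ {ω | t ≤ |((I.filter fun i => X i ω = true).card : ℝ) - I.card * p|} ≤
      ENNReal.ofReal (I.card * p / t ^ 2) := by
  set φ : Bool → ℝ := fun b => if b = true then 1 else 0
  have hφ : Measurable φ := measurable_of_countable φ
  set Y : ι → Ω → ℝ := fun i => φ ∘ X i
  have hY (i : ι) : Y i = {ω | X i ω = true}.indicator 1 := by
    ext ω
    simp [Y, φ, Set.indicator_apply]
  have hevent (i : ι) : MeasurableSet {ω | X i ω = true} := hX i (measurableSet_singleton true)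
  have hmem (i : ι) : MemLp (Y i) 2 μ := by
    rw [hY]
    exact (memLp_const 1).indicator (hevent i)
  have hmean (i : ι) : ∫ ω, Y i ω ∂μ = p := by
    rw [hY, integral_indicator_one (hevent i), hp]
  have hvar (i : ι) : variance (Y i) μ ≤ p := by
    refine (variance_le_expectation_sq (hφ.comp (hX i)).aestronglyMeasurable).trans_eq ?_
    rw [← hmean i]
    exact integral_congr_ae (Filter.Eventually.of_forall fun ω => by simp [Y, φ])
  have hcard (ω : Ω) : ((I.filter fun i => X i ω = true).card : ℝ) = (∑ i ∈ I, Y i) ω := by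
    simp [Y, φ]
  have hsum : ∫ ω, (∑ i ∈ I, Y i) ω ∂μ = I.card * p := by
    simp only [Finset.sum_apply]
    rw [integral_finsetSum _ fun i _ => (hmem i).integrable one_le_two]
    simp [hmean]
  have hchebyshev := meas_ge_le_variance_div_sq (memLp_finsetSum' I fun i _ => hmem i) ht
  simp only [hcard, ← hsum]
  refine hchebyshev.trans (ENNReal.ofReal_le_ofReal ?_)
  gcongr
  rw [hsum, IndepFun.variance_sum (fun i _ => hmem i) fun i _ j _ hij =>
    (hindep hij).comp hφ hφ]
  exact (Finset.sum_le_sum fun i _ => hvar i).trans_eq (by simp)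

theorem measurable_finset {α ι : Type*} [MeasurableSpace α] [Finite ι] {I : α → Finset ι}
    (h : ∀ i, MeasurableSet {z | i ∈ I z}) : @Measurable _ _ _ ⊤ I := by
  let _ : MeasurableSpace (Finset ι) := ⊤
  refine measurable_to_countable' fun J => ?_
  have hfiber : I ⁻¹' {J} = ⋂ i, {z | i ∈ I z ↔ i ∈ J} := by
    ext z; simp [Finset.ext_iff]
  rw [hfiber]
  refine MeasurableSet.iInter fun i => ?_
  by_cases hi : i ∈ J
  · simpa [hi] using h i
  · simp only [hi, iff_false]
    exact (h i).compl

variable {c : Constants} {K ε : ℝ} {n m : ℕ}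

/-- The members of a set of rows that survive in the matrix downsampled at rate `2⁻ℓ`. -/
def sampled (σ : Seed c K ε n) (ℓ : Fin (rates n + 1)) (I : Finset (Fin n)) : Finset (Fin n) :=
  {i ∈ I | σ.keep ℓ i = true}

theorem mass_downsample {T : (Fin m → ℝ) → EuclideanSpace ℝ (Fin m)} (hT : IsSketchable T)
    (B : Matrix (Fin n) (Fin m) ℝ) (σ : Seed c K ε n) (ℓ : Fin (rates n + 1)) :
    mass T (downsample B σ ℓ) = ∑ i ∈ sampled σ ℓ Finset.univ, ‖T (B i)‖ ^ 2 := by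
  rw [sampled, Finset.sum_filter]
  refine Finset.sum_congr rfl fun i _ => ?_
  rw [downsample_apply]
  split_ifs <;> simp [hT.norm_zero]

variable {S : Ω → Seed c K ε n} (hS : IsRandomSeed μ S)

include hS

theorem IsRandomSeed.measurableSet_keep (ℓ : Fin (rates n + 1)) (i : Fin n) :
    MeasurableSet {ω | (S ω).keep ℓ i = true} :=
  ((measurable_pi_apply i).comp (hS.measurable_keep ℓ)) (measurableSet_singleton true)

theorem IsRandomSeed.measurable_finset_sampled {β : Type*} [MeasurableSpace β]
    {f : Finset (Fin n) → β} (ℓ : Fin (rates n + 1)) (I : Finset (Fin n)) :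
    Measurable fun ω => f (sampled (S ω) ℓ I) :=
  (measurable_of_countable fun κ : Fin n → Bool => f {i ∈ I | κ i = true}).comp
    (hS.measurable_keep ℓ)

theorem lintegral_mass_downsample {T : (Fin m → ℝ) → EuclideanSpace ℝ (Fin m)}
    (hT : IsSketchable T) (B : Matrix (Fin n) (Fin m) ℝ) (ℓ : Fin (rates n + 1)) :
    ∫⁻ ω, ENNReal.ofReal (mass T (downsample B (S ω) ℓ)) ∂μ =
      ENNReal.ofReal (mass T B / 2 ^ (ℓ : ℕ)) := by
  have hsum (ω : Ω) : ENNReal.ofReal (mass T (downsample B (S ω) ℓ)) =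
      ∑ i, {ω | (S ω).keep ℓ i = true}.indicator
        (fun _ => ENNReal.ofReal (‖T (B i)‖ ^ 2)) ω := by
    rw [mass_downsample hT, ENNReal.ofReal_sum_of_nonneg fun i _ => by positivity, sampled,
      Finset.sum_filter]
    simp only [Set.indicator_apply, Set.mem_ofPred_eq]
  simp only [hsum]
  rw [lintegral_finsetSum _ fun i _ => measurable_const.indicator (hS.measurableSet_keep ℓ i)]
  simp only [lintegral_indicator_const (hS.measurableSet_keep ℓ _), hS.keep_prob]
  rw [← Finset.sum_mul, ← ENNReal.ofReal_sum_of_nonneg fun i _ => by positivity,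
    div_eq_mul_inv, ENNReal.ofReal_mul (mass_nonneg T B), ENNReal.ofReal_inv_of_pos (by positivity),
    ENNReal.ofReal_pow zero_le_two, ENNReal.inv_pow, ENNReal.ofReal_ofNat, mass]

theorem measure_mass_downsample_le {T : (Fin m → ℝ) → EuclideanSpace ℝ (Fin m)}
    (hT : IsSketchable T) (B : Matrix (Fin n) (Fin m) ℝ) {a : ℝ} (ha : 0 < a) :
    μ {ω | ∃ ℓ : Fin (rates n + 1), a * ((rates n : ℝ) + 1) * (mass T B / 2 ^ (ℓ : ℕ)) <
      mass T (downsample B (S ω) ℓ)} ≤ (ENNReal.ofReal a)⁻¹ := by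
  have hmeas (ℓ : Fin (rates n + 1)) : Measurable fun ω => mass T (downsample B (S ω) ℓ) := by
    simp only [mass_downsample hT]
    exact hS.measurable_finset_sampled (f := fun I => ∑ i ∈ I, ‖T (B i)‖ ^ 2) ℓ Finset.univ
  have hmarkov (ℓ : Fin (rates n + 1)) := measure_mul_lt_le_inv (hmeas ℓ)
    (div_nonneg (mass_nonneg T B) (by positivity)) (lintegral_mass_downsample hS hT B ℓ).le
    (show 0 < a * ((rates n : ℝ) + 1) by positivity)
  have hrates : ENNReal.ofReal ((rates n : ℝ) + 1) = rates n + 1 := by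
    rw [ENNReal.ofReal_add (by positivity) zero_le_one, ENNReal.ofReal_natCast, ENNReal.ofReal_one]
  rw [Set.ofPred_exists]
  calc _ ≤ ∑ ℓ : Fin (rates n + 1), _ := measure_iUnion_fintype_le _ _
    _ ≤ ∑ _ : Fin (rates n + 1), (ENNReal.ofReal (a * ((rates n : ℝ) + 1)))⁻¹ :=
        Finset.sum_le_sum fun ℓ _ => hmarkov ℓ
    _ = (ENNReal.ofReal a)⁻¹ := by
        rw [Finset.sum_const, Finset.card_univ, Fintype.card_fin, nsmul_eq_mul,
          ENNReal.ofReal_mul ha.le, hrates, ENNReal.mul_inv (by simp) (by simp), mul_left_comm]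
        push_cast
        rw [ENNReal.mul_inv_cancel (by simp) (by finiteness), mul_one]

omit hS

/-- The number of survivors of `I` at rate `2⁻ℓ` deviates from its expectation by less than `t`. -/
def IsConcentrated (σ : Seed c K ε n) (ℓ : Fin (rates n + 1)) (I : Finset (Fin n)) (t : ℝ) : Prop :=
  |((sampled σ ℓ I).card : ℝ) - I.card / 2 ^ (ℓ : ℕ)| < t

/-- Downsampling at rate `2⁻ℓ` leaves in expectation between `s` and `2s` rows of `I`, at most `3s`
rows of `O` and at most `V` rows of `G`. -/
structure IsBalancedRate (s V : ℝ) (I O G : Finset (Fin n)) (ℓ : ℕ) : Prop where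
  le_inner : s ≤ I.card / 2 ^ ℓ
  inner_lt : I.card / 2 ^ ℓ < 2 * s
  outer_le : O.card / 2 ^ ℓ ≤ 3 * s
  above_le : G.card / 2 ^ ℓ ≤ V

theorem IsBalancedRate.eq {s V : ℝ} {I O G : Finset (Fin n)} {k l : ℕ}
    (hk : IsBalancedRate s V I O G k) (hl : IsBalancedRate s V I O G l) : k = l := by
  wlog hkl : k ≤ l generalizing k l
  · exact (this hl hk (le_of_not_ge hkl)).symm
  by_contra hne
  have hpow : (2 : ℝ) ^ (k + 1) ≤ 2 ^ l := pow_le_pow_right₀ one_le_two (by lia)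
  have hlow := hl.le_inner
  have hhigh := hk.inner_lt
  rw [le_div_iff₀ (by positivity)] at hlow
  rw [div_lt_iff₀ (by positivity)] at hhigh
  rw [pow_succ] at hpow
  nlinarith [pow_pos (zero_lt_two (α := ℝ)) k]

variable [IsProbabilityMeasure μ]

include hS

theorem measure_not_isConcentrated_le (ℓ : Fin (rates n + 1)) (I : Finset (Fin n)) {t : ℝ}
    (ht : 0 < t) :
    μ {ω | ¬ IsConcentrated (S ω) ℓ I t} ≤
      ENNReal.ofReal (I.card / 2 ^ (ℓ : ℕ) / t ^ 2) := by
  simp only [IsConcentrated, not_lt, sampled, div_eq_mul_inv (I.card : ℝ)]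
  refine measure_le_abs_card_filter_sub_le (fun i => (measurable_pi_apply i).comp
    (hS.measurable_keep ℓ)) (fun i j hij => (hS.keep_indep ℓ).indepFun hij) (fun i => ?_) I ht
  refine (congrArg ENNReal.toReal (hS.keep_prob ℓ i)).trans ?_
  simp

theorem IsBalancedRate.measure_not_isConcentrated_le {s t V : ℝ} (ht : 0 < t) (hV : 0 < V)
    {I O G : Finset (Fin n)} {ℓ : Fin (rates n + 1)} (hℓ : IsBalancedRate s V I O G ℓ) :
    μ {ω | ¬ (IsConcentrated (S ω) ℓ I t ∧ IsConcentrated (S ω) ℓ O t ∧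
      IsConcentrated (S ω) ℓ G V)} ≤ ENNReal.ofReal (5 * s / t ^ 2 + 1 / V) := by
  have hI : (I.card : ℝ) / 2 ^ (ℓ : ℕ) / t ^ 2 ≤ 2 * s / t ^ 2 := by
    gcongr; exact hℓ.inner_lt.le
  have hO : (O.card : ℝ) / 2 ^ (ℓ : ℕ) / t ^ 2 ≤ 3 * s / t ^ 2 := by
    gcongr; exact hℓ.outer_le
  have hG : (G.card : ℝ) / 2 ^ (ℓ : ℕ) / V ^ 2 ≤ V / V ^ 2 := by
    gcongr; exact hℓ.above_le
  simp only [not_and_or, Set.ofPred_or]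
  calc _ ≤ ENNReal.ofReal (I.card / 2 ^ (ℓ : ℕ) / t ^ 2) +
        (ENNReal.ofReal (O.card / 2 ^ (ℓ : ℕ) / t ^ 2) +
          ENNReal.ofReal (G.card / 2 ^ (ℓ : ℕ) / V ^ 2)) := by
        refine (measure_union_le _ _).trans (add_le_add ?_
          ((measure_union_le _ _).trans (add_le_add ?_ ?_)))
        all_goals exact HSketch.measure_not_isConcentrated_le hS ℓ _ (by assumption)
    _ ≤ ENNReal.ofReal (5 * s / t ^ 2 + 1 / V) := by
        rw [← ENNReal.ofReal_add (by positivity) (by positivity),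
          ← ENNReal.ofReal_add (by positivity) (by positivity)]
        refine ENNReal.ofReal_le_ofReal ((add_le_add hI (add_le_add hO hG)).trans_eq ?_)
        field_simp
        ring

/-- Since at most one rate is balanced, there is no union bound over the rates. -/
theorem measure_exists_not_isConcentrated_le {s t V : ℝ} (ht : 0 < t) (hV : 0 < V)
    (I O G : Finset (Fin n)) :
    μ {ω | ∃ ℓ : Fin (rates n + 1), IsBalancedRate s V I O G ℓ ∧
      ¬ (IsConcentrated (S ω) ℓ I t ∧ IsConcentrated (S ω) ℓ O t ∧
        IsConcentrated (S ω) ℓ G V)} ≤ ENNReal.ofReal (5 * s / t ^ 2 + 1 / V) := by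
  by_cases hexists : ∃ ℓ : Fin (rates n + 1), IsBalancedRate s V I O G ℓ
  · obtain ⟨ℓ, hℓ⟩ := hexists
    refine (measure_mono ?_).trans (hℓ.measure_not_isConcentrated_le hS ht hV)
    rintro ω ⟨ℓ', hℓ', hω⟩
    rwa [← Fin.ext (hℓ'.eq hℓ)]
  · have hempty : {ω | ∃ ℓ : Fin (rates n + 1), IsBalancedRate s V I O G ℓ ∧
        ¬ (IsConcentrated (S ω) ℓ I t ∧ IsConcentrated (S ω) ℓ O t ∧
          IsConcentrated (S ω) ℓ G V)} = ∅ :=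
      Set.eq_empty_of_forall_notMem fun ω ⟨ℓ, hℓ, _⟩ => hexists ⟨ℓ, hℓ⟩
    rw [hempty, measure_empty]
    exact zero_le

/-- The rows may be selected by means of the random shift, which is independent of the
downsampling. -/
theorem measure_exists_not_isConcentrated_shift_le {I O G : ℝ → Finset (Fin n)}
    (hI : ∀ i, MeasurableSet {z | i ∈ I z}) (hO : ∀ i, MeasurableSet {z | i ∈ O z})
    (hG : ∀ i, MeasurableSet {z | i ∈ G z}) {s t V : ℝ} (ht : 0 < t) (hV : 0 < V) :
    μ {ω | ∃ ℓ : Fin (rates n + 1),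
      IsBalancedRate s V (I (S ω).ζ) (O (S ω).ζ) (G (S ω).ζ) ℓ ∧
        ¬ (IsConcentrated (S ω) ℓ (I (S ω).ζ) t ∧ IsConcentrated (S ω) ℓ (O (S ω).ζ) t ∧
          IsConcentrated (S ω) ℓ (G (S ω).ζ) V)} ≤ ENNReal.ofReal (5 * s / t ^ 2 + 1 / V) := by
  let _ : MeasurableSpace (Finset (Fin n)) := ⊤
  have hselect : Measurable fun z => (I z, O z, G z) :=
    (measurable_finset hI).prodMk ((measurable_finset hO).prodMk (measurable_finset hG))
  exact measure_mem_le_of_indepFun (hselect.comp hS.measurable_ζ)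
    (hS.ζ_indep.comp hselect measurable_fst)
    (D := fun p => {κ : Fin (rates n + 1) → Fin n → Bool | ∃ ℓ : Fin (rates n + 1),
      IsBalancedRate s V p.1 p.2.1 p.2.2 ℓ ∧
        ¬ (|((p.1.filter fun i => κ ℓ i = true).card : ℝ) - p.1.card / 2 ^ (ℓ : ℕ)| < t ∧
          |((p.2.1.filter fun i => κ ℓ i = true).card : ℝ) - p.2.1.card / 2 ^ (ℓ : ℕ)| < t ∧
          |((p.2.2.filter fun i => κ ℓ i = true).card : ℝ) - p.2.2.card / 2 ^ (ℓ : ℕ)| < V)})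
    (fun _ => (Set.toFinite _).measurableSet)
    fun p => measure_exists_not_isConcentrated_le hS ht hV p.1 p.2.1 p.2.2

end Downsampling

section Shift

theorem sum_geometric_filter_le {u b : ℝ} (hu : 0 ≤ u) (hb : 0 ≤ b) (N : ℕ) :
    ∑ j ∈ Finset.range N with 2 ^ j * u ≤ b, 2 ^ j * u ≤ 2 * b := by
  have hgeom (k : ℕ) : ∑ j ∈ Finset.range k, 2 ^ j * u ≤ 2 ^ k * u := by
    rw [← Finset.sum_mul, geom_sum_eq (by norm_num)]
    gcongr
    linarith
  induction N with
  | zero => simpa using hb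
  | succ k ih =>
    rw [Finset.range_add_one, Finset.filter_insert]
    split_ifs with h
    · rw [Finset.sum_insert (by simp)]
      have := Finset.sum_le_sum_of_subset_of_nonneg
        (Finset.filter_subset (fun j => 2 ^ j * u ≤ b) (Finset.range k))
        fun j _ _ => (by positivity : 0 ≤ 2 ^ j * u)
      linarith [hgeom k]
    · exact ih

variable {n : ℕ} {α β Mhat : ℝ} {x : Fin n → ℝ}

/-- The indices whose entries lie between `α` and `β` times the reference value `zM̂/2^j` of
level `j`. -/
noncomputable def strip (α β Mhat : ℝ) (x : Fin n → ℝ) (j : ℕ) (z : ℝ) : Finset (Fin n) :=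
  {i | x i ∈ Set.Icc (α * (z * Mhat / 2 ^ j)) (β * (z * Mhat / 2 ^ j))}

/-- The sum of the entries lying between `α` and `β` times the reference value of some level
`j < N`. -/
noncomputable def stripMass (α β Mhat : ℝ) (N : ℕ) (x : Fin n → ℝ) (z : ℝ) : ℝ :=
  ∑ j ∈ Finset.range N, ∑ i ∈ strip α β Mhat x j z, x i

theorem mem_strip {i : Fin n} {j : ℕ} {z : ℝ} : i ∈ strip α β Mhat x j z ↔
    α * (z * Mhat / 2 ^ j) ≤ x i ∧ x i ≤ β * (z * Mhat / 2 ^ j) := by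
  simp [strip]

theorem measurableSet_strip (α β Mhat : ℝ) (x : Fin n → ℝ) (j : ℕ) (i : Fin n) :
    MeasurableSet {z | i ∈ strip α β Mhat x j z} := by
  simp only [mem_strip]
  exact (measurableSet_le (f := fun z => α * (z * Mhat / 2 ^ j)) (by fun_prop)
    measurable_const).inter (measurableSet_le (g := fun z => β * (z * Mhat / 2 ^ j))
      measurable_const (by fun_prop))

theorem measurable_stripMass (α β Mhat : ℝ) (N : ℕ) (x : Fin n → ℝ) :
    Measurable (stripMass α β Mhat N x) := by
  refine Finset.measurable_fun_sum _ fun j _ => ?_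
  let _ : MeasurableSpace (Finset (Fin n)) := ⊤
  exact (measurable_from_top (f := fun I : Finset (Fin n) => ∑ i ∈ I, x i)).comp
    (measurable_finset (measurableSet_strip α β Mhat x j))

variable {Ω : Type*} [MeasurableSpace Ω] {μ : Measure Ω} {Z : Ω → ℝ} (hZ : Measurable Z)
  (hunif : pdf.IsUniform Z (Set.Icc (1 / 2) 1) μ volume)

include hZ hunif

theorem measure_uniform_le {D : Set ℝ} (hD : MeasurableSet D) {a b : ℝ}
    (h : D ∩ Set.Icc (1 / 2) 1 ⊆ Set.Icc a b) :
    μ (Z ⁻¹' D) ≤ ENNReal.ofReal (2 * (b - a)) := by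
  rw [← Measure.map_apply hZ hD, show μ.map Z = _ from hunif,
    ProbabilityTheory.cond_apply measurableSet_Icc, Set.inter_comm, Real.volume_Icc,
    ENNReal.ofReal_mul zero_le_two]
  refine mul_le_mul' ?_ ((measure_mono h).trans_eq Real.volume_Icc)
  rw [← ENNReal.ofReal_inv_of_pos (by norm_num)]
  norm_num

theorem measure_uniform_notMem : μ {ω | Z ω ∉ Set.Icc (1 / 2 : ℝ) 1} = 0 := by
  have := measure_uniform_le hZ hunif (D := (Set.Icc (1 / 2) 1)ᶜ) measurableSet_Icc.compl
    (a := 0) (b := 0) (by simp)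
  rw [sub_self, mul_zero, ENNReal.ofReal_zero] at this
  exact le_antisymm this zero_le

theorem measure_mem_strip_le (hα : 0 < α) (hβ : 0 < β) (hM : 0 < Mhat) (i : Fin n) (j : ℕ) :
    μ {ω | i ∈ strip α β Mhat x j (Z ω)} ≤ ENNReal.ofReal (if 2 ^ j * (x i / Mhat) ≤ β then
      2 * ((β - α) / (α * β)) * (2 ^ j * (x i / Mhat)) else 0) := by
  set u := 2 ^ j * (x i / Mhat) with hu
  have hstrip (z : ℝ) (hz : i ∈ strip α β Mhat x j z) : α * z ≤ u ∧ u ≤ β * z := by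
    obtain ⟨hlow, hhigh⟩ := mem_strip.1 hz
    rw [← mul_div_assoc, div_le_iff₀ (by positivity)] at hlow
    rw [← mul_div_assoc, le_div_iff₀ (by positivity)] at hhigh
    rw [hu, ← mul_div_assoc, le_div_iff₀ hM, div_le_iff₀ hM]
    constructor <;> linarith
  split_ifs with hle
  · refine (measure_uniform_le hZ hunif (measurableSet_strip α β Mhat x j i)
      (a := u / β) (b := u / α) ?_).trans_eq ?_
    · intro z hz
      obtain ⟨hlow, hhigh⟩ := hstrip z hz.1
      rw [Set.mem_Icc, div_le_iff₀ hβ, le_div_iff₀ hα]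
      constructor <;> linarith
    · congr 1
      field_simp
  · refine (measure_uniform_le hZ hunif (measurableSet_strip α β Mhat x j i)
      (a := 0) (b := 0) ?_).trans (by simp)
    intro z hz
    exact absurd ((hstrip z hz.1).2.trans (mul_le_of_le_one_right hβ.le hz.2.2)) hle

theorem sum_measure_mem_strip_le (hα : 1 ≤ α) (hαβ : α < β) (hM : 0 < Mhat) {i : Fin n}
    (hx : 0 ≤ x i) (N : ℕ) :
    ∑ j ∈ Finset.range N, μ {ω | i ∈ strip α β Mhat x j (Z ω)} ≤
      ENNReal.ofReal (4 * (β - α)) := by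
  have hα0 : 0 < α := by linarith
  have hβ : 0 < β := by linarith
  have hβα : 0 ≤ β - α := by linarith
  have hterm (j : ℕ) : 0 ≤ 2 * ((β - α) / (α * β)) * (2 ^ j * (x i / Mhat)) := by positivity
  calc ∑ j ∈ Finset.range N, μ {ω | i ∈ strip α β Mhat x j (Z ω)}
      ≤ ENNReal.ofReal (2 * ((β - α) / (α * β)) *
          ∑ j ∈ Finset.range N with 2 ^ j * (x i / Mhat) ≤ β, 2 ^ j * (x i / Mhat)) := by
        rw [Finset.mul_sum, Finset.sum_filter, ENNReal.ofReal_sum_of_nonneg fun j _ => by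
          split_ifs <;> [exact hterm j; exact le_rfl]]
        exact Finset.sum_le_sum fun j _ => measure_mem_strip_le hZ hunif hα0 hβ hM i j
    _ ≤ ENNReal.ofReal (2 * ((β - α) / (α * β)) * (2 * β)) := by
        gcongr
        exact sum_geometric_filter_le (by positivity) hβ.le N
    _ = ENNReal.ofReal (4 * ((β - α) / α)) := by
        congr 1
        field_simp
        ring
    _ ≤ ENNReal.ofReal (4 * (β - α)) := by
        gcongr
        exact div_le_self hβα hα

theorem lintegral_stripMass_le (hα : 1 ≤ α) (hαβ : α < β) (hM : 0 < Mhat) (hx : ∀ i, 0 ≤ x i)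
    (N : ℕ) :
    ∫⁻ ω, ENNReal.ofReal (stripMass α β Mhat N x (Z ω)) ∂μ ≤
      ENNReal.ofReal (4 * (β - α) * ∑ i, x i) := by
  have hmeas (j : ℕ) (i : Fin n) : MeasurableSet {ω | i ∈ strip α β Mhat x j (Z ω)} :=
    hZ (measurableSet_strip α β Mhat x j i)
  have hsum (ω : Ω) : ENNReal.ofReal (stripMass α β Mhat N x (Z ω)) =
      ∑ i, ∑ j ∈ Finset.range N, {ω | i ∈ strip α β Mhat x j (Z ω)}.indicator
        (fun _ => ENNReal.ofReal (x i)) ω := by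
    rw [stripMass, Finset.sum_comm, ENNReal.ofReal_sum_of_nonneg fun j _ =>
      Finset.sum_nonneg fun i _ => hx i]
    refine Finset.sum_congr rfl fun j _ => ?_
    rw [ENNReal.ofReal_sum_of_nonneg fun i _ => hx i]
    simp only [Set.indicator_apply, Set.mem_ofPred_eq]
    rw [← Finset.sum_filter]
    exact Finset.sum_congr (by ext; simp) fun _ _ => rfl
  simp only [hsum]
  rw [lintegral_finsetSum _ fun i _ => Finset.measurable_fun_sum _ fun j _ =>
    measurable_const.indicator (hmeas j i), ENNReal.ofReal_mul (by linarith),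
    ENNReal.ofReal_sum_of_nonneg fun i _ => hx i, Finset.mul_sum]
  refine Finset.sum_le_sum fun i _ => ?_
  rw [lintegral_finsetSum _ fun j _ => measurable_const.indicator (hmeas j i)]
  simp only [lintegral_indicator_const (hmeas _ i)]
  rw [← Finset.mul_sum, mul_comm]
  gcongr
  exact sum_measure_mem_strip_le hZ hunif hα hαβ hM (hx i) N

theorem measure_stripMass_le (hα : 1 ≤ α) (hαβ : α < β) (hM : 0 < Mhat) (hx : ∀ i, 0 ≤ x i)
    {η : ℝ} (hη : 0 < η) (N : ℕ) :
    μ {ω | η * ∑ i, x i < stripMass α β Mhat N x (Z ω)} ≤ ENNReal.ofReal (4 * (β - α) / η) := by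
  have hαβ' : 0 < β - α := by linarith
  have hmarkov := measure_mul_lt_le_inv ((measurable_stripMass α β Mhat N x).comp hZ)
    (mul_nonneg (by positivity) (Finset.sum_nonneg fun i _ => hx i))
    (lintegral_stripMass_le hZ hunif hα hαβ hM hx N) (c := η / (4 * (β - α))) (by positivity)
  have hcancel : η / (4 * (β - α)) * (4 * (β - α) * ∑ i, x i) = η * ∑ i, x i := by field_simp
  rwa [hcancel, ← ENNReal.ofReal_inv_of_pos (by positivity), inv_div] at hmarkov

end Shift

section Parameters

theorem le_two_pow_ceil_logb {x : ℝ} (hx : 0 < x) : x ≤ 2 ^ ⌈Real.logb 2 x⌉₊ := by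
  rw [← Real.rpow_natCast, ← Real.logb_le_iff_le_rpow one_lt_two hx]
  exact Nat.le_ceil _

theorem two_pow_ceil_logb_le {x : ℝ} (hx : 1 ≤ x) : (2 : ℝ) ^ ⌈Real.logb 2 x⌉₊ ≤ 2 * x := by
  have hceil := Nat.ceil_lt_add_one (Real.logb_nonneg one_lt_two hx)
  calc (2 : ℝ) ^ ⌈Real.logb 2 x⌉₊ = 2 ^ ((⌈Real.logb 2 x⌉₊ : ℕ) : ℝ) :=
        (Real.rpow_natCast 2 _).symm
    _ ≤ 2 ^ (Real.logb 2 x + 1) := Real.rpow_le_rpow_of_exponent_le one_le_two hceil.le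
    _ = 2 * x := by
        rw [Real.rpow_add two_pos, Real.rpow_logb two_pos (by norm_num) (by linarith),
          Real.rpow_one, mul_comm]

theorem natCast_le_two_pow_rates {n : ℕ} (hn : 0 < n) : (n : ℝ) ≤ 2 ^ rates n :=
  le_two_pow_ceil_logb (by exact_mod_cast hn)

variable {K ε : ℝ} {n : ℕ}

theorem le_two_pow_levels (hK : 1 ≤ K) (hε : 0 < ε) (hn : 0 < n) :
    K * n / ε ≤ 2 ^ levels K ε n :=
  le_two_pow_ceil_logb (by positivity)

theorem le_levels (hK : 1 ≤ K) (hε : 0 < ε) (hn : 0 < n) {k : ℕ} (hk : ε ≤ (1 / 2) ^ k) :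
    k ≤ levels K ε n := by
  have hn' : (1 : ℝ) ≤ n := by exact_mod_cast hn
  have hpow : (2 : ℝ) ^ k ≤ K * n / ε := by
    rw [le_div_iff₀ hε]
    calc (2 : ℝ) ^ k * ε ≤ 2 ^ k * (1 / 2) ^ k := by gcongr
      _ = 1 := by rw [← mul_pow]; norm_num
      _ ≤ K * n := one_le_mul_of_one_le_of_one_le hK hn'
  exact (pow_le_pow_iff_right₀ one_lt_two).1 (hpow.trans (le_two_pow_levels hK hε hn))

theorem rates_add_one_le_levels (hK : 1 ≤ K) (hε : 0 < ε) (hε2 : ε ≤ 1 / 2) (hn : 0 < n) :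
    rates n + 1 ≤ levels K ε n := by
  have hn' : (1 : ℝ) ≤ n := by exact_mod_cast hn
  rw [rates, ← Nat.ceil_add_one (Real.logb_nonneg one_lt_two hn')]
  refine Nat.ceil_mono ?_
  calc Real.logb 2 n + 1 = Real.logb 2 (n * 2) := by
        rw [Real.logb_mul (by positivity) two_ne_zero, Real.logb_self_eq_one one_lt_two]
    _ ≤ Real.logb 2 (K * n / ε) := by
        refine Real.logb_le_logb_of_le one_lt_two (by positivity) ((le_div_iff₀ hε).2 ?_)
        nlinarith

/-- The constants for which the algorithm is analysed. The value of `cR` makes room for the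
union bound over all queries to all structures. -/
noncomputable def stdConstants : Constants where
  cw := 1
  cR := 8
  ν := 1 / 20
  cφ₀ := 1
  cφ := 1
  cΛ := 1
  cw_pos := one_pos
  cR_pos := by norm_num
  ν_pos := by norm_num
  ν_le := le_rfl
  cφ₀_pos := one_pos
  cφ_pos := one_pos
  cΛ_pos := one_pos

theorem phi_stdConstants_pos (hK : 1 ≤ K) (hε : 0 < ε) (hL : 0 < levels K ε n)
    (ℓ : Fin (rates n + 1)) : 0 < phi stdConstants K ε n ℓ := by
  unfold phi
  split_ifs <;> simp only [stdConstants, one_mul] <;> positivity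

theorem phi_stdConstants_le (hK : 1 ≤ K) (hε : 0 < ε) (hL : 0 < levels K ε n)
    (ℓ : Fin (rates n + 1)) : phi stdConstants K ε n ℓ ≤ ε ^ 3 / (levels K ε n : ℝ) ^ 3 := by
  unfold phi
  split_ifs <;> simp only [stdConstants, one_mul, le_refl]
  gcongr
  exact le_mul_of_one_le_left (by positivity) hK

theorem le_width (hK : 1 ≤ K) (hε : 0 < ε) (hL : 0 < levels K ε n) (ℓ : Fin (rates n + 1)) :
    8000 * (levels K ε n : ℝ) ^ 6 / ε ^ 6 ≤ width stdConstants K ε n ℓ := by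
  have hφ := phi_stdConstants_pos hK hε hL ℓ
  have hφ' := phi_stdConstants_le hK hε hL ℓ
  calc 8000 * (levels K ε n : ℝ) ^ 6 / ε ^ 6
      = 1 / ((ε ^ 3 / (levels K ε n : ℝ) ^ 3) ^ 2 * (1 / 20) ^ 3) := by
        field_simp; norm_num
    _ ≤ 1 / (phi stdConstants K ε n ℓ ^ 2 * (1 / 20) ^ 3) := by gcongr
    _ ≤ width stdConstants K ε n ℓ := Nat.le_ceil _

theorem le_topSize (K ε : ℝ) (n : ℕ) :
    (levels K ε n : ℝ) ^ 3 / ε ^ 3 ≤ topSize stdConstants K ε n := by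
  simpa only [topSize, stdConstants, one_mul] using
    Nat.le_ceil ((levels K ε n : ℝ) ^ 3 / ε ^ 3)

theorem tol_sq_le {m : ℕ} (hK : 1 ≤ K) (hε : 0 < ε) (hL : 0 < levels K ε n)
    (T : (Fin m → ℝ) → EuclideanSpace ℝ (Fin m)) (B : Matrix (Fin n) (Fin m) ℝ)
    (σ : Seed stdConstants K ε n) (ℓ : Fin (rates n + 1)) :
    tol T B σ ℓ ^ 2 ≤ mass T (downsample B σ ℓ) * (ε ^ 6 / (levels K ε n : ℝ) ^ 6) := by
  have hmass := mass_nonneg T (downsample B σ ℓ)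
  rw [tol, Real.sq_sqrt (by positivity)]
  calc 128 * mass T (downsample B σ ℓ) / width stdConstants K ε n ℓ
      ≤ 128 * mass T (downsample B σ ℓ) / (8000 * (levels K ε n : ℝ) ^ 6 / ε ^ 6) := by
        gcongr
        exact le_width hK hε hL ℓ
    _ = 128 / 8000 * (mass T (downsample B σ ℓ) * (ε ^ 6 / (levels K ε n : ℝ) ^ 6)) := by
        field_simp
    _ ≤ mass T (downsample B σ ℓ) * (ε ^ 6 / (levels K ε n : ℝ) ^ 6) :=
        mul_le_of_le_one_left (by positivity) (by norm_num)

end Parameters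

section Covering

variable {n : ℕ} {lo up Mhat z : ℝ} {x : Fin n → ℝ}

theorem exists_mem_strip_or_mem_strip (hM : 0 ≤ Mhat) (hlo : 0 ≤ lo) (hz : 1 / 2 ≤ z) {i : Fin n}
    {J : ℕ} (hle : x i ≤ lo * Mhat) (hJ : lo * (z * Mhat / 2 ^ J) ≤ x i) :
    ∃ j ∈ Finset.range (J + 1),
      i ∈ strip lo up Mhat x j z ∨ i ∈ strip up (2 * lo) Mhat x j z := by
  classical
  have hex : ∃ j, lo * (z * Mhat / 2 ^ j) ≤ x i := ⟨J, hJ⟩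
  obtain ⟨j, hj⟩ : ∃ j, j = Nat.find hex := ⟨_, rfl⟩
  have hlow : lo * (z * Mhat / 2 ^ j) ≤ x i := hj ▸ Nat.find_spec hex
  have hhigh : x i ≤ 2 * lo * (z * Mhat / 2 ^ j) := by
    rcases j with _ | k
    · rw [pow_zero, div_one]
      nlinarith [mul_nonneg hlo hM]
    · have hk := Nat.find_min hex (m := k) (by lia)
      rw [pow_succ]
      calc x i ≤ lo * (z * Mhat / 2 ^ k) := (not_le.1 hk).le
        _ = 2 * lo * (z * Mhat / (2 ^ k * 2)) := by field_simp
  refine ⟨j, Finset.mem_range_succ_iff.2 (hj ▸ Nat.find_min' hex hJ), ?_⟩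
  rcases le_total (x i) (up * (z * Mhat / 2 ^ j)) with h | h
  · exact Or.inl (mem_strip.2 ⟨hlow, h⟩)
  · exact Or.inr (mem_strip.2 ⟨h, hhigh⟩)

theorem stripMass_eq_sum_ite (α β Mhat : ℝ) (N : ℕ) (x : Fin n → ℝ) (z : ℝ) :
    stripMass α β Mhat N x z =
      ∑ i, ∑ j ∈ Finset.range N, if i ∈ strip α β Mhat x j z then x i else 0 := by
  rw [stripMass, Finset.sum_comm]
  exact Finset.sum_congr rfl fun j _ => by rw [← Finset.sum_filter, Finset.filter_mem_eq_inter,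
    Finset.univ_inter]

theorem sum_le_stripMass_add_stripMass (hM : 0 ≤ Mhat) (hlo : 0 ≤ lo) (hz : 1 / 2 ≤ z)
    (hx : ∀ i, 0 ≤ x i) (hle : ∀ i, x i ≤ lo * Mhat) (J : ℕ) :
    ∑ i with lo * (z * Mhat / 2 ^ J) ≤ x i, x i ≤
      stripMass lo up Mhat (J + 1) x z + stripMass up (2 * lo) Mhat (J + 1) x z := by
  rw [stripMass_eq_sum_ite, stripMass_eq_sum_ite, ← Finset.sum_add_distrib, Finset.sum_filter]
  refine Finset.sum_le_sum fun i _ => ?_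
  have hnonneg (α β : ℝ) (j : ℕ) : 0 ≤ if i ∈ strip α β Mhat x j z then x i else 0 := by
    split_ifs <;> [exact hx i; exact le_rfl]
  have hlow := Finset.sum_nonneg fun j (_ : j ∈ Finset.range (J + 1)) => hnonneg lo up j
  have hhigh := Finset.sum_nonneg fun j (_ : j ∈ Finset.range (J + 1)) => hnonneg up (2 * lo) j
  split_ifs with hJ
  · obtain ⟨j, hj, hmem | hmem⟩ := exists_mem_strip_or_mem_strip (up := up) hM hlo hz (hle i) hJ
    · have := Finset.single_le_sum (fun j _ => hnonneg lo up j) hj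
      rw [if_pos hmem] at this
      linarith
    · have := Finset.single_le_sum (fun j _ => hnonneg up (2 * lo) j) hj
      rw [if_pos hmem] at this
      linarith
  · exact add_nonneg hlow hhigh

theorem stripMass_mono (α β Mhat z : ℝ) (hx : ∀ i, 0 ≤ x i) {N N' : ℕ} (hN : N ≤ N') :
    stripMass α β Mhat N x z ≤ stripMass α β Mhat N' x z :=
  Finset.sum_le_sum_of_subset_of_nonneg (Finset.range_mono hN) fun _ _ _ =>
    Finset.sum_nonneg fun i _ => hx i

theorem sum_strip_le_stripMass (α β Mhat z : ℝ) (hx : ∀ i, 0 ≤ x i) {j N : ℕ}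
    (hj : j ∈ Finset.range N) :
    ∑ i ∈ strip α β Mhat x j z, x i ≤ stripMass α β Mhat N x z :=
  Finset.single_le_sum (f := fun j => ∑ i ∈ strip α β Mhat x j z, x i)
    (fun _ _ => Finset.sum_nonneg fun i _ => hx i) hj

end Covering

section Levels

variable {c : Constants} {K ε : ℝ} {n m : ℕ} (T : (Fin m → ℝ) → EuclideanSpace ℝ (Fin m))
  (B : Matrix (Fin n) (Fin m) ℝ) (Mhat : ℝ)

/-- The squared norm of the transformed `i`-th row. -/
noncomputable def rowMass (i : Fin n) : ℝ := ‖T (B i)‖ ^ 2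

/-- The relative width of the zones around the ends of a level in which the estimate of a row may
fall on the wrong side. -/
noncomputable def margin (K ε : ℝ) (n : ℕ) : ℝ := ε / (10 ^ 5 * levels K ε n)

/-- The number of rows of a level that are to survive the downsampling, up to a factor of `2`. -/
noncomputable def sampleSize (K ε : ℝ) (n : ℕ) : ℝ := (levels K ε n : ℝ) ^ 2 / ε ^ 2

/-- The rows whose estimates are in level `j` whenever they survive. -/
noncomputable def innerRows (K ε : ℝ) (j : ℕ) (z : ℝ) : Finset (Fin n) :=
  strip ((1 + ε) * (1 + margin K ε n)) ((2 - ε) * (1 - margin K ε n)) Mhat (rowMass T B) j z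

/-- The rows whose estimates may be in level `j`. -/
noncomputable def outerRows (K ε : ℝ) (j : ℕ) (z : ℝ) : Finset (Fin n) :=
  strip ((1 + ε) * (1 - margin K ε n)) ((2 - ε) * (1 + margin K ε n)) Mhat (rowMass T B) j z

/-- The rows whose estimates may be in one of the levels `0, …, j`. -/
noncomputable def rowsAbove (j : ℕ) (z : ℝ) : Finset (Fin n) :=
  {i | z * Mhat / 2 ^ j ≤ rowMass T B i}

/-- The estimates of the heavy hitters of the structure for the full matrix. -/
noncomputable def topEstimates (σ : Seed c K ε n) (i : Fin n) : ℝ :=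
  if i ∈ heavyHitters T B σ 0 then estimate T B σ 0 i else 0

/-- The assumptions on the input of the algorithm. The bound on `K * ε` makes the number `L` of
levels at least `250` and absorbs all the numerical constants. -/
structure IsValidInput (K ε : ℝ) : Prop where
  sketchable : IsSketchable T
  one_le_K : 1 ≤ K
  ε_pos : 0 < ε
  Kε_le : K * ε ≤ (1 / 2) ^ 250
  mass_pos : 0 < mass T B
  mass_le : mass T B ≤ Mhat
  le_mass : Mhat ≤ K * mass T B

/-- The seeds for which the algorithm succeeds: the structures are accurate, little mass is close
to the ends of the levels, and the numbers of sampled rows are close to their expectations. -/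
structure IsFavourable (σ : Seed stdConstants K ε n) : Prop where
  shift_mem : σ.ζ ∈ Set.Icc (1 / 2 : ℝ) 1
  keep_zero : ∀ i, σ.keep 0 i = true
  accurate : ∀ ℓ i, |‖T (answer T B σ ℓ i)‖ - ‖T (downsample B σ ℓ i)‖| ≤ tol T B σ ℓ
  mass_le : ∀ ℓ : Fin (rates n + 1),
    mass T (downsample B σ ℓ) ≤ 100 * ((rates n : ℝ) + 1) * (mass T B / 2 ^ (ℓ : ℕ))
  gap : stripMass ((2 - ε) * (1 - margin K ε n)) (2 * ((1 + ε) * (1 + margin K ε n))) Mhat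
    (levels K ε n + 1) (rowMass T B) σ.ζ ≤ 1 / 4 * mass T B
  low : stripMass ((1 + ε) * (1 - margin K ε n)) ((1 + ε) * (1 + margin K ε n)) Mhat
    (levels K ε n + 1) (rowMass T B) σ.ζ ≤ ε / (16 * ((levels K ε n : ℝ) + 1)) * mass T B
  high : stripMass ((2 - ε) * (1 - margin K ε n)) ((2 - ε) * (1 + margin K ε n)) Mhat
    (levels K ε n + 1) (rowMass T B) σ.ζ ≤ ε / (16 * ((levels K ε n : ℝ) + 1)) * mass T B
  top_gap : stripMass (2 - ε) (2 * (1 + ε)) Mhat (levels K ε n + 1) (topEstimates T B σ) σ.ζ ≤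
    1 / 2 * ∑ i, topEstimates T B σ i
  sample : ∀ j ∈ Finset.range (levels K ε n + 1), ∀ ℓ : Fin (rates n + 1),
    IsBalancedRate (sampleSize K ε n) (8 * ((levels K ε n : ℝ) + 1) * sampleSize K ε n)
      (innerRows T B Mhat K ε j σ.ζ) (outerRows T B Mhat K ε j σ.ζ)
      (rowsAbove T B Mhat j σ.ζ) ℓ →
    IsConcentrated σ ℓ (innerRows T B Mhat K ε j σ.ζ) (2 * ε * sampleSize K ε n) ∧
      IsConcentrated σ ℓ (outerRows T B Mhat K ε j σ.ζ) (2 * ε * sampleSize K ε n) ∧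
      IsConcentrated σ ℓ (rowsAbove T B Mhat j σ.ζ)
        (8 * ((levels K ε n : ℝ) + 1) * sampleSize K ε n)

variable {T B Mhat}

theorem rowMass_nonneg (i : Fin n) : 0 ≤ rowMass T B i := sq_nonneg _

theorem rowMass_le_mass (i : Fin n) : rowMass T B i ≤ mass T B :=
  Finset.single_le_sum (fun i _ => rowMass_nonneg i) (Finset.mem_univ i)

theorem estimate_nonneg (σ : Seed c K ε n) (ℓ : Fin (rates n + 1)) (i : Fin n) :
    0 ≤ estimate T B σ ℓ i := sq_nonneg _

theorem topEstimates_nonneg (σ : Seed c K ε n) (i : Fin n) : 0 ≤ topEstimates T B σ i := by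
  unfold topEstimates
  split_ifs <;> [exact estimate_nonneg σ 0 i; exact le_rfl]

theorem keep_of_norm_pos (hT : IsSketchable T) {σ : Seed c K ε n} {ℓ : Fin (rates n + 1)}
    {i : Fin n} (h : 0 < ‖T (downsample B σ ℓ i)‖ ^ 2) : σ.keep ℓ i = true := by
  by_contra hk
  simp [downsample_apply, hk, hT.norm_zero] at h

theorem downsample_apply_of_keep {σ : Seed c K ε n} {ℓ : Fin (rates n + 1)} {i : Fin n}
    (hk : σ.keep ℓ i = true) : downsample B σ ℓ i = B i := by
  rw [downsample_apply, if_pos hk]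

theorem mass_downsample_le (hT : IsSketchable T) (B : Matrix (Fin n) (Fin m) ℝ)
    (σ : Seed c K ε n) (ℓ : Fin (rates n + 1)) : mass T (downsample B σ ℓ) ≤ mass T B := by
  rw [mass_downsample hT]
  exact Finset.sum_le_sum_of_subset_of_nonneg (Finset.subset_univ _) fun _ _ _ => sq_nonneg _

end Levels

namespace IsValidInput

variable {n m : ℕ} {T : (Fin m → ℝ) → EuclideanSpace ℝ (Fin m)} {B : Matrix (Fin n) (Fin m) ℝ}
  {Mhat K ε : ℝ} (hV : IsValidInput T B Mhat K ε)

include hV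

theorem ε_le_pow : ε ≤ (1 / 2) ^ 250 :=
  (le_mul_of_one_le_left hV.ε_pos.le hV.one_le_K).trans hV.Kε_le

theorem ε_le : ε ≤ 1 / 10 ^ 15 := hV.ε_le_pow.trans (by norm_num)

theorem Mhat_pos : 0 < Mhat := hV.mass_pos.trans_le hV.mass_le

theorem n_pos : 0 < n := by
  rcases Nat.eq_zero_or_pos n with rfl | hn
  · simpa [mass] using hV.mass_pos
  · exact hn

theorem le_levels : 250 ≤ levels K ε n :=
  HSketch.le_levels hV.one_le_K hV.ε_pos hV.n_pos hV.ε_le_pow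

theorem levels_pos : 0 < levels K ε n := lt_of_lt_of_le (by norm_num) hV.le_levels

theorem le_levels_cast : (250 : ℝ) ≤ levels K ε n := by exact_mod_cast hV.le_levels

theorem rates_add_one_le : (rates n : ℝ) + 1 ≤ levels K ε n := by
  exact_mod_cast rates_add_one_le_levels hV.one_le_K hV.ε_pos
    (hV.ε_le.trans (by norm_num)) hV.n_pos

theorem margin_pos : 0 < margin K ε n :=
  div_pos hV.ε_pos (by have := hV.levels_pos; positivity)

theorem margin_le : margin K ε n ≤ ε / 2 :=
  div_le_div_of_nonneg_left hV.ε_pos.le two_pos (by linarith [hV.le_levels_cast])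

theorem one_le_sampleSize : 1 ≤ sampleSize K ε n := by
  have hε := hV.ε_pos
  rw [sampleSize, one_le_div (by positivity)]
  exact (pow_le_one₀ hε.le (by linarith [hV.ε_le])).trans
    (one_le_pow₀ (by linarith [hV.le_levels_cast]))

theorem one_le_lower : 1 ≤ (1 + ε) * (1 - margin K ε n) := by
  nlinarith [hV.ε_pos, hV.ε_le, hV.margin_pos, hV.margin_le]

theorem upper_le_two : (2 - ε) * (1 - margin K ε n) ≤ 2 := by
  nlinarith [hV.ε_pos, hV.ε_le, hV.margin_pos, hV.margin_le]

end IsValidInput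

namespace IsFavourable

variable {n m : ℕ} {T : (Fin m → ℝ) → EuclideanSpace ℝ (Fin m)} {B : Matrix (Fin n) (Fin m) ℝ}
  {Mhat K ε : ℝ} {σ : Seed stdConstants K ε n} (hF : IsFavourable T B Mhat σ)
  (hV : IsValidInput T B Mhat K ε)

include hF hV

theorem scale_pos (j : ℕ) : 0 < σ.ζ * Mhat / 2 ^ j := by
  have hζ : 0 < σ.ζ := by linarith [hF.shift_mem.1]
  have := hV.Mhat_pos
  positivity

theorem shift_mul_le : σ.ζ * Mhat ≤ K * mass T B :=
  (mul_le_of_le_one_left hV.Mhat_pos.le hF.shift_mem.2).trans hV.le_mass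

theorem le_shift_mul : mass T B / 2 ≤ σ.ζ * Mhat := by
  nlinarith [hF.shift_mem.1, hV.mass_le, hV.mass_pos]

end IsFavourable

theorem le_mul_sqrt {a b t : ℝ} (ha : 0 ≤ a) (h : b ^ 2 ≤ a ^ 2 * t) : b ≤ a * √t := by
  calc b ≤ √(a ^ 2 * t) := Real.le_sqrt_of_sq_le h
    _ = a * √t := by rw [Real.sqrt_mul (sq_nonneg a), Real.sqrt_sq ha]

theorem sq_mem_Icc_of_abs_sub_le {a x t κ : ℝ} (ha : 0 ≤ a) (hx : 0 ≤ x) (hκ : 0 ≤ κ)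
    (hκ1 : κ ≤ 1) (hax : |a - x| ≤ κ * √t) (ht : t ≤ x ^ 2) :
    a ^ 2 ∈ Set.Icc ((1 - κ) ^ 2 * x ^ 2) ((1 + κ) ^ 2 * x ^ 2) := by
  have hsqrt : κ * √t ≤ κ * x := mul_le_mul_of_nonneg_left (Real.sqrt_le_iff.2 ⟨hx, ht⟩) hκ
  obtain ⟨hlow, hhigh⟩ := abs_le.1 hax
  rw [← mul_pow, ← mul_pow]
  exact ⟨pow_le_pow_left₀ (mul_nonneg (by linarith) hx) (by linarith) 2,
    pow_le_pow_left₀ ha (by linarith) 2⟩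

theorem exists_div_two_pow_mem_Ico {s : ℝ} (hs : 1 ≤ s) {N n : ℕ} (hN : s ≤ N) (hNn : N ≤ n) :
    ∃ ℓ : Fin (rates n + 1), (N : ℝ) / 2 ^ (ℓ : ℕ) ∈ Set.Ico s (2 * s) := by
  have hs0 : 0 < s := by linarith
  have hn : 0 < n := by
    have : (0 : ℝ) < N := by linarith
    exact (Nat.cast_pos.1 this).trans_le hNn
  obtain ⟨l, hlow, hhigh⟩ := exists_nat_pow_near ((one_le_div hs0).2 hN) one_lt_two
  have hl : l ≤ rates n := by
    refine (pow_le_pow_iff_right₀ (one_lt_two (α := ℝ))).1 ?_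
    calc (2 : ℝ) ^ l ≤ N / s := hlow
      _ ≤ N := div_le_self N.cast_nonneg hs
      _ ≤ n := by exact_mod_cast hNn
      _ ≤ 2 ^ rates n := natCast_le_two_pow_rates hn
  refine ⟨⟨l, Nat.lt_succ_of_le hl⟩, ?_, ?_⟩
  · rwa [le_div_comm₀ hs0 (by positivity)]
  · rw [div_lt_iff₀ hs0, pow_succ] at hhigh
    rw [div_lt_iff₀ (by positivity)]
    linarith

theorem sqrt_twenty_mem : √20 ∈ Set.Icc (4 : ℝ) 5 :=
  ⟨Real.le_sqrt_of_sq_le (by norm_num), Real.sqrt_le_iff.2 (by norm_num)⟩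

section LevelMass

variable {c : Constants} {K ε Mhat : ℝ} {n m : ℕ} {T : (Fin m → ℝ) → EuclideanSpace ℝ (Fin m)}
  {B : Matrix (Fin n) (Fin m) ℝ} {σ : Seed c K ε n} {j : ℕ} {ℓ : Fin (rates n + 1)}

theorem mem_levelElements {i : Fin n} : i ∈ levelElements T B Mhat σ j ℓ ↔
    i ∈ heavyHitters T B σ ℓ ∧ estimate T B σ ℓ i ∈
      Set.Icc ((1 + ε) * (σ.ζ * Mhat / 2 ^ j)) ((2 - ε) * (σ.ζ * Mhat / 2 ^ j)) :=
  Finset.mem_filter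

theorem mem_admissible_iff : ℓ ∈ admissible T B Mhat σ j ↔
    ((levelElements T B Mhat σ j ℓ).card : ℝ) ∈
      Set.Icc ((1 - √20 * ε) * sampleSize K ε n) (2 * (1 + √20 * ε) * sampleSize K ε n) := by
  simp [admissible, sampleSize, mul_div_assoc]

theorem levelMass_of_chosen (h : chosen T B Mhat σ j = some ℓ) : levelMass T B Mhat σ j =
    (∑ i ∈ levelElements T B Mhat σ j ℓ, estimate T B σ ℓ i) * 2 ^ (ℓ : ℕ) := by
  rw [levelMass, h]

theorem levelMass_of_chosen_none (h : chosen T B Mhat σ j = none) :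
    levelMass T B Mhat σ j = 0 := by
  rw [levelMass, h]

theorem levelMass_nonneg (T : (Fin m → ℝ) → EuclideanSpace ℝ (Fin m))
    (B : Matrix (Fin n) (Fin m) ℝ) (Mhat : ℝ) (σ : Seed c K ε n) (j : ℕ) :
    0 ≤ levelMass T B Mhat σ j := by
  rcases h : chosen T B Mhat σ j with _ | ℓ
  · rw [levelMass_of_chosen_none h]
  · rw [levelMass_of_chosen h]
    exact mul_nonneg (Finset.sum_nonneg fun i _ => estimate_nonneg σ ℓ i) (by positivity)

theorem levelMass_le_sum (T : (Fin m → ℝ) → EuclideanSpace ℝ (Fin m))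
    (B : Matrix (Fin n) (Fin m) ℝ) (Mhat : ℝ) (σ : Seed c K ε n) {J : Finset ℕ} (hj : j ∈ J) :
    levelMass T B Mhat σ j ≤ ∑ j' ∈ J, levelMass T B Mhat σ j' :=
  Finset.single_le_sum (fun j' _ => levelMass_nonneg T B Mhat σ j') hj

theorem chosen_of_le (h : j ≤ lastHeavyLevel K ε n) : chosen T B Mhat σ j = some 0 := by
  rw [chosen, if_pos h]

theorem levelMass_of_le (h : j ≤ lastHeavyLevel K ε n) : levelMass T B Mhat σ j =
    ∑ i ∈ levelElements T B Mhat σ j 0, estimate T B σ 0 i := by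
  rw [levelMass_of_chosen (chosen_of_le h), Fin.val_zero, pow_zero, mul_one]

theorem exists_chosen_of_admissible (h : lastHeavyLevel K ε n < j)
    (hℓ : ℓ ∈ admissible T B Mhat σ j) :
    ∃ ℓ' ∈ admissible T B Mhat σ j, chosen T B Mhat σ j = some ℓ' ∧ ℓ ≤ ℓ' := by
  refine ⟨(admissible T B Mhat σ j).max' ⟨ℓ, hℓ⟩, Finset.max'_mem _ _, ?_,
    Finset.le_max' _ _ hℓ⟩
  rw [chosen, if_neg (not_le.2 h), dif_pos ⟨ℓ, hℓ⟩]

theorem mem_admissible_of_chosen (h : lastHeavyLevel K ε n < j)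
    (hc : chosen T B Mhat σ j = some ℓ) : ℓ ∈ admissible T B Mhat σ j := by
  rw [chosen, if_neg (not_le.2 h)] at hc
  split_ifs at hc with hne
  rw [← Option.some.inj hc]
  exact Finset.max'_mem _ hne

end LevelMass

theorem IsValidInput.le_two_pow_lastHeavyLevel {n m : ℕ}
    {T : (Fin m → ℝ) → EuclideanSpace ℝ (Fin m)} {B : Matrix (Fin n) (Fin m) ℝ} {Mhat K ε : ℝ}
    (hV : IsValidInput T B Mhat K ε) :
    4 * K * (levels K ε n : ℝ) ^ 3 / ε ^ 3 ≤ 2 ^ lastHeavyLevel K ε n := by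
  have := hV.ε_pos
  have := hV.one_le_K
  have := hV.levels_pos
  exact le_two_pow_ceil_logb (by positivity)

theorem IsValidInput.two_pow_lastHeavyLevel_le {n m : ℕ}
    {T : (Fin m → ℝ) → EuclideanSpace ℝ (Fin m)} {B : Matrix (Fin n) (Fin m) ℝ} {Mhat K ε : ℝ}
    (hV : IsValidInput T B Mhat K ε) :
    (2 : ℝ) ^ lastHeavyLevel K ε n ≤ 8 * K * (levels K ε n : ℝ) ^ 3 / ε ^ 3 := by
  have hε := hV.ε_pos
  refine (two_pow_ceil_logb_le ?_).trans_eq (by ring)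
  rw [le_div_iff₀ (by positivity)]
  have hε3 : ε ^ 3 ≤ 1 := pow_le_one₀ hε.le (by linarith [hV.ε_le])
  have hL3 : (1 : ℝ) ≤ (levels K ε n : ℝ) ^ 3 := one_le_pow₀ (by linarith [hV.le_levels_cast])
  nlinarith [hV.one_le_K]

namespace IsFavourable

variable {n m : ℕ} {T : (Fin m → ℝ) → EuclideanSpace ℝ (Fin m)} {B : Matrix (Fin n) (Fin m) ℝ}
  {Mhat K ε : ℝ} {σ : Seed stdConstants K ε n} (hF : IsFavourable T B Mhat σ)
  (hV : IsValidInput T B Mhat K ε) {j : ℕ} {ℓ : Fin (rates n + 1)}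

include hF hV

theorem sum_rowMass_lt_le : ∑ i with rowMass T B i <
    (1 + ε) * (1 + margin K ε n) * (σ.ζ * Mhat / 2 ^ levels K ε n), rowMass T B i ≤
      2 * ε * mass T B := by
  have hε := hV.ε_pos
  have hM := hV.mass_pos
  have hn : (0 : ℝ) < n := by exact_mod_cast hV.n_pos
  have hscale : σ.ζ * Mhat / 2 ^ levels K ε n ≤ ε * mass T B / n := by
    have hL := le_two_pow_levels hV.one_le_K hε hV.n_pos
    rw [div_le_iff₀ hε] at hL
    rw [div_le_div_iff₀ (by positivity) hn]
    calc σ.ζ * Mhat * n ≤ K * mass T B * n :=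
          mul_le_mul_of_nonneg_right (hF.shift_mul_le hV) hn.le
      _ = mass T B * (K * n) := by ring
      _ ≤ mass T B * (2 ^ levels K ε n * ε) := by gcongr
      _ = ε * mass T B * 2 ^ levels K ε n := by ring
  have hlo : (1 + ε) * (1 + margin K ε n) ≤ 2 := by
    nlinarith [hV.ε_le, hV.margin_le, hV.margin_pos]
  calc ∑ i with rowMass T B i <
        (1 + ε) * (1 + margin K ε n) * (σ.ζ * Mhat / 2 ^ levels K ε n), rowMass T B i
      ≤ ∑ i with rowMass T B i <
        (1 + ε) * (1 + margin K ε n) * (σ.ζ * Mhat / 2 ^ levels K ε n),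
          2 * (ε * mass T B / n) :=
        Finset.sum_le_sum fun i hi => (Finset.mem_filter.1 hi).2.le.trans
          (mul_le_mul hlo hscale (hF.scale_pos hV _).le two_pos.le)
    _ ≤ ∑ _i : Fin n, 2 * (ε * mass T B / n) :=
        Finset.sum_le_sum_of_subset_of_nonneg (Finset.filter_subset _ _)
          fun _ _ _ => by positivity
    _ = 2 * ε * mass T B := by
        rw [Finset.sum_const, Finset.card_univ, Fintype.card_fin, nsmul_eq_mul]
        field_simp

theorem exists_level : ∃ j ∈ Finset.range (levels K ε n + 1),
    mass T B / (2 * ((levels K ε n : ℝ) + 1)) ≤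
      ∑ i ∈ innerRows T B Mhat K ε j σ.ζ, rowMass T B i := by
  by_contra! hsmall
  have hM := hV.mass_pos
  have hε := hV.ε_pos
  have hlo : 1 ≤ (1 + ε) * (1 + margin K ε n) := by nlinarith [hV.margin_pos]
  have hle (i : Fin n) : rowMass T B i ≤ (1 + ε) * (1 + margin K ε n) * Mhat :=
    (rowMass_le_mass i).trans (hV.mass_le.trans (le_mul_of_one_le_left hV.Mhat_pos.le hlo))
  have hbelow := hF.sum_rowMass_lt_le hV
  have habove := sum_le_stripMass_add_stripMass (up := (2 - ε) * (1 - margin K ε n))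
    hV.Mhat_pos.le (by linarith) hF.shift_mem.1 rowMass_nonneg hle (levels K ε n)
  have hgap := hF.gap
  have hinner : stripMass ((1 + ε) * (1 + margin K ε n)) ((2 - ε) * (1 - margin K ε n)) Mhat
      (levels K ε n + 1) (rowMass T B) σ.ζ ≤ mass T B / 2 := by
    calc _ ≤ ∑ _j ∈ Finset.range (levels K ε n + 1),
          mass T B / (2 * ((levels K ε n : ℝ) + 1)) :=
          Finset.sum_le_sum fun j hj => (hsmall j hj).le
      _ = mass T B / 2 := by
          rw [Finset.sum_const, Finset.card_range, nsmul_eq_mul]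
          push_cast
          field_simp
  have hsplit : mass T B = ∑ i with rowMass T B i <
        (1 + ε) * (1 + margin K ε n) * (σ.ζ * Mhat / 2 ^ levels K ε n), rowMass T B i +
      ∑ i with (1 + ε) * (1 + margin K ε n) * (σ.ζ * Mhat / 2 ^ levels K ε n) ≤ rowMass T B i,
        rowMass T B i := by
    simp only [← not_lt, Finset.sum_filter_add_sum_filter_not]
    rfl
  nlinarith [hV.ε_le]

section Accuracy

variable (hτ : tol T B σ ℓ ≤ margin K ε n / 8 * √(σ.ζ * Mhat / 2 ^ j))

include hτ

theorem estimate_mem {i : Fin n} (hi : i ∈ innerRows T B Mhat K ε j σ.ζ)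
    (hk : σ.keep ℓ i = true) : estimate T B σ ℓ i ∈
      Set.Icc ((1 + ε) * (σ.ζ * Mhat / 2 ^ j)) ((2 - ε) * (σ.ζ * Mhat / 2 ^ j)) := by
  have hε := hV.ε_pos
  have hε1 := hV.ε_le
  have hρ := hV.margin_pos
  have hρ1 := hV.margin_le
  have ht := hF.scale_pos hV j
  obtain ⟨hlow, hhigh⟩ := mem_strip.1 hi
  have hacc := hF.accurate ℓ i
  rw [downsample_apply_of_keep hk] at hacc
  set t := σ.ζ * Mhat / 2 ^ j
  set ρ := margin K ε n
  obtain ⟨hlow', hhigh'⟩ := sq_mem_Icc_of_abs_sub_le (norm_nonneg _) (norm_nonneg _)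
    (by positivity) (by linarith) (hacc.trans hτ)
    ((le_mul_of_one_le_left ht.le (by nlinarith)).trans hlow)
  have hfactor_low : 1 ≤ (1 - ρ / 8) ^ 2 * (1 + ρ) :=
    calc 1 ≤ (1 - ρ / 4) * (1 + ρ) := by nlinarith
      _ ≤ (1 - ρ / 8) ^ 2 * (1 + ρ) := by gcongr; nlinarith
  have hfactor_high : (1 + ρ / 8) ^ 2 * (1 - ρ) ≤ 1 := by nlinarith
  constructor
  · calc (1 + ε) * t ≤ ((1 - ρ / 8) ^ 2 * (1 + ρ)) * ((1 + ε) * t) :=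
          le_mul_of_one_le_left (by positivity) hfactor_low
      _ = (1 - ρ / 8) ^ 2 * ((1 + ε) * (1 + ρ) * t) := by ring
      _ ≤ (1 - ρ / 8) ^ 2 * rowMass T B i := by gcongr
      _ ≤ estimate T B σ ℓ i := hlow'
  · calc estimate T B σ ℓ i ≤ (1 + ρ / 8) ^ 2 * rowMass T B i := hhigh'
      _ ≤ (1 + ρ / 8) ^ 2 * ((2 - ε) * (1 - ρ) * t) := by gcongr
      _ = ((1 + ρ / 8) ^ 2 * (1 - ρ)) * ((2 - ε) * t) := by ring
      _ ≤ (2 - ε) * t :=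
          mul_le_of_le_one_left (mul_nonneg (by linarith) ht.le) hfactor_high

theorem mem_sampled_rowsAbove {i : Fin n}
    (h : (1 + ε) * (σ.ζ * Mhat / 2 ^ j) ≤ estimate T B σ ℓ i) :
    i ∈ sampled σ ℓ (rowsAbove T B Mhat j σ.ζ) ∧
      (estimate T B σ ℓ i ≤ (2 - ε) * (σ.ζ * Mhat / 2 ^ j) →
        i ∈ sampled σ ℓ (outerRows T B Mhat K ε j σ.ζ)) := by
  have hε := hV.ε_pos
  have hε1 := hV.ε_le
  have hρ := hV.margin_pos
  have hρ1 := hV.margin_le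
  have ht := hF.scale_pos hV j
  have hacc := hF.accurate ℓ i
  rw [abs_sub_comm] at hacc
  obtain ⟨hlow, hhigh⟩ := sq_mem_Icc_of_abs_sub_le (norm_nonneg _) (norm_nonneg _)
    (by positivity) (by linarith) (hacc.trans hτ) (le_trans (by nlinarith) h)
  change _ * estimate T B σ ℓ i ≤ _ at hlow
  change _ ≤ _ * estimate T B σ ℓ i at hhigh
  have hone := hV.one_le_lower
  simp only [sampled, rowsAbove, outerRows, Finset.mem_filter, Finset.mem_univ, true_and, mem_strip]
  set t := σ.ζ * Mhat / 2 ^ j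
  set ρ := margin K ε n
  have hlow' : (1 + ε) * (1 - ρ) * t ≤ ‖T (downsample B σ ℓ i)‖ ^ 2 := by
    calc (1 + ε) * (1 - ρ) * t = (1 - ρ) * ((1 + ε) * t) := by ring
      _ ≤ (1 - ρ / 8) ^ 2 * estimate T B σ ℓ i :=
          mul_le_mul (by nlinarith) h (by positivity) (by positivity)
      _ ≤ ‖T (downsample B σ ℓ i)‖ ^ 2 := hlow
  have ht' : t ≤ ‖T (downsample B σ ℓ i)‖ ^ 2 :=
    (le_mul_of_one_le_left ht.le hone).trans hlow'
  have hk := keep_of_norm_pos hV.sketchable (ht.trans_le ht')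
  rw [downsample_apply_of_keep hk] at hhigh hlow' ht'
  refine ⟨⟨ht', hk⟩, fun hle => ⟨⟨hlow', hhigh.trans ?_⟩, hk⟩⟩
  calc (1 + ρ / 8) ^ 2 * estimate T B σ ℓ i ≤ (1 + ρ) * ((2 - ε) * t) :=
        mul_le_mul (by nlinarith) hle (sq_nonneg _) (by positivity)
    _ = (2 - ε) * (1 + ρ) * t := by ring

end Accuracy

theorem norm_answer_mem (hτ : tol T B σ ℓ ≤ ε * √(σ.ζ * Mhat / 2 ^ j)) {i : Fin n}
    (hi : i ∈ levelElements T B Mhat σ j ℓ) : ‖T (answer T B σ ℓ i)‖ ^ 2 ∈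
      Set.Icc ((1 - 3 * ε) * ‖T (B i)‖ ^ 2) ((1 + 3 * ε) * ‖T (B i)‖ ^ 2) := by
  have hε := hV.ε_pos
  have hε1 := hV.ε_le
  have ht := hF.scale_pos hV j
  have hacc := hF.accurate ℓ i
  rw [abs_sub_comm] at hacc
  have hta : σ.ζ * Mhat / 2 ^ j ≤ ‖T (answer T B σ ℓ i)‖ ^ 2 :=
    (le_mul_of_one_le_left ht.le (by linarith)).trans (mem_levelElements.1 hi).2.1
  obtain ⟨hlow, hhigh⟩ := sq_mem_Icc_of_abs_sub_le (norm_nonneg _) (norm_nonneg _) hε.le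
    (by linarith) (hacc.trans hτ) hta
  have ha : 0 < ‖T (answer T B σ ℓ i)‖ ^ 2 := ht.trans_le hta
  have hsq : 0 < (1 - ε) ^ 2 := by nlinarith
  have hk : σ.keep ℓ i = true := keep_of_norm_pos hV.sketchable ((mul_pos hsq ha).trans_le hlow)
  rw [downsample_apply_of_keep hk] at hlow hhigh
  have hfactor_low : (1 - 3 * ε) * (1 + ε) ^ 2 ≤ 1 := by nlinarith [pow_pos hε 3]
  have hfactor_high : 1 ≤ (1 + 3 * ε) * (1 - ε) ^ 2 := by nlinarith [pow_pos hε 3]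
  set a := ‖T (answer T B σ ℓ i)‖ ^ 2
  constructor
  · calc (1 - 3 * ε) * ‖T (B i)‖ ^ 2 ≤ (1 - 3 * ε) * ((1 + ε) ^ 2 * a) :=
          mul_le_mul_of_nonneg_left hhigh (by linarith)
      _ = ((1 - 3 * ε) * (1 + ε) ^ 2) * a := by ring
      _ ≤ a := mul_le_of_le_one_left ha.le hfactor_low
  · calc a ≤ ((1 + 3 * ε) * (1 - ε) ^ 2) * a :=
          le_mul_of_one_le_left ha.le hfactor_high
      _ = (1 + 3 * ε) * ((1 - ε) ^ 2 * a) := by ring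
      _ ≤ (1 + 3 * ε) * ‖T (B i)‖ ^ 2 := by gcongr

end IsFavourable

theorem outerRows_sdiff_innerRows_subset {n m : ℕ} (T : (Fin m → ℝ) → EuclideanSpace ℝ (Fin m))
    (B : Matrix (Fin n) (Fin m) ℝ) (Mhat K ε : ℝ) (j : ℕ) (z : ℝ) :
    outerRows T B Mhat K ε j z \ innerRows T B Mhat K ε j z ⊆
      strip ((1 + ε) * (1 - margin K ε n)) ((1 + ε) * (1 + margin K ε n)) Mhat (rowMass T B) j z ∪
      strip ((2 - ε) * (1 - margin K ε n)) ((2 - ε) * (1 + margin K ε n)) Mhat (rowMass T B) j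
        z := by
  intro i hi
  obtain ⟨hout, hin⟩ := Finset.mem_sdiff.1 hi
  obtain ⟨hlow, hhigh⟩ := mem_strip.1 hout
  rw [Finset.mem_union, mem_strip, mem_strip]
  rcases le_or_gt (rowMass T B i) ((1 + ε) * (1 + margin K ε n) * (z * Mhat / 2 ^ j)) with h | h
  · exact Or.inl ⟨hlow, h⟩
  · exact Or.inr ⟨le_of_not_ge fun h' => hin (mem_strip.2 ⟨h.le, h'⟩), hhigh⟩

theorem card_rowsAbove_mul_le {n m : ℕ} (T : (Fin m → ℝ) → EuclideanSpace ℝ (Fin m))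
    (B : Matrix (Fin n) (Fin m) ℝ) (Mhat : ℝ) (j : ℕ) (z : ℝ) :
    ((rowsAbove T B Mhat j z).card : ℝ) * (z * Mhat / 2 ^ j) ≤ mass T B := by
  rw [← nsmul_eq_mul]
  exact (Finset.card_nsmul_le_sum _ (rowMass T B) _ fun i hi => (Finset.mem_filter.1 hi).2).trans
    (Finset.sum_le_sum_of_subset_of_nonneg (Finset.subset_univ _) fun _ _ _ => rowMass_nonneg _)

theorem IsValidInput.sampleSize_mul_le_topSize {n m : ℕ}
    {T : (Fin m → ℝ) → EuclideanSpace ℝ (Fin m)} {B : Matrix (Fin n) (Fin m) ℝ}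
    {Mhat K ε : ℝ} (hV : IsValidInput T B Mhat K ε) :
    16 * ((levels K ε n : ℝ) + 1) * sampleSize K ε n ≤ topSize stdConstants K ε n := by
  have hε := hV.ε_pos
  have hL := hV.le_levels_cast
  refine le_trans ?_ (le_topSize K ε n)
  rw [sampleSize, ← mul_div_assoc, div_le_div_iff₀ (by positivity) (by positivity)]
  calc 16 * ((levels K ε n : ℝ) + 1) * (levels K ε n : ℝ) ^ 2 * ε ^ 3
      = (16 * ((levels K ε n : ℝ) + 1) * ε) * ((levels K ε n : ℝ) ^ 2 * ε ^ 2) := by ring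
    _ ≤ (levels K ε n : ℝ) * ((levels K ε n : ℝ) ^ 2 * ε ^ 2) := by
        gcongr
        nlinarith [hV.ε_le]
    _ = (levels K ε n : ℝ) ^ 3 * ε ^ 2 := by ring

namespace IsFavourable

variable {n m : ℕ} {T : (Fin m → ℝ) → EuclideanSpace ℝ (Fin m)} {B : Matrix (Fin n) (Fin m) ℝ}
  {Mhat K ε : ℝ} {σ : Seed stdConstants K ε n} (hF : IsFavourable T B Mhat σ)
  (hV : IsValidInput T B Mhat K ε) {j : ℕ} {ℓ : Fin (rates n + 1)}

include hF hV

section HeavyLevels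

theorem le_scale (hj : j ≤ lastHeavyLevel K ε n) :
    mass T B * ε ^ 3 / (16 * K * (levels K ε n : ℝ) ^ 3) ≤ σ.ζ * Mhat / 2 ^ j := by
  have hε := hV.ε_pos
  have hL := hV.levels_pos
  have hK := hV.one_le_K
  have hM := hV.mass_pos
  have hshift := hF.le_shift_mul hV
  have hpow : (2 : ℝ) ^ j ≤ 8 * K * (levels K ε n : ℝ) ^ 3 / ε ^ 3 :=
    (pow_le_pow_right₀ one_le_two hj).trans hV.two_pow_lastHeavyLevel_le
  calc mass T B * ε ^ 3 / (16 * K * (levels K ε n : ℝ) ^ 3)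
      = (mass T B / 2) / (8 * K * (levels K ε n : ℝ) ^ 3 / ε ^ 3) := by field_simp; ring
    _ ≤ σ.ζ * Mhat / 2 ^ j :=
        div_le_div₀ ((half_pos hM).le.trans hshift) hshift (by positivity) hpow

theorem tol_zero_le (hj : j ≤ lastHeavyLevel K ε n) :
    tol T B σ 0 ≤ margin K ε n / 8 * √(σ.ζ * Mhat / 2 ^ j) := by
  have hε := hV.ε_pos
  have hL := hV.le_levels_cast
  have hK := hV.one_le_K
  have hM := hV.mass_pos
  have hKε : 1024 * 10 ^ 10 * (K * ε) / levels K ε n ≤ 1 := by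
    rw [div_le_one (by linarith)]
    linarith [hV.Kε_le]
  refine le_mul_sqrt (div_nonneg hV.margin_pos.le (by norm_num)) ?_
  calc tol T B σ 0 ^ 2 ≤ mass T (downsample B σ 0) * (ε ^ 6 / (levels K ε n : ℝ) ^ 6) :=
        tol_sq_le hK hε hV.levels_pos T B σ 0
    _ ≤ mass T B * (ε ^ 6 / (levels K ε n : ℝ) ^ 6) := by
        gcongr
        exact mass_downsample_le hV.sketchable B σ 0
    _ = (1024 * 10 ^ 10 * (K * ε) / levels K ε n) * ((margin K ε n / 8) ^ 2 *
          (mass T B * ε ^ 3 / (16 * K * (levels K ε n : ℝ) ^ 3))) := by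
        rw [margin]; field_simp; ring
    _ ≤ (margin K ε n / 8) ^ 2 * (mass T B * ε ^ 3 / (16 * K * (levels K ε n : ℝ) ^ 3)) :=
        mul_le_of_le_one_left (by positivity) hKε
    _ ≤ (margin K ε n / 8) ^ 2 * (σ.ζ * Mhat / 2 ^ j) :=
        mul_le_mul_of_nonneg_left (hF.le_scale hV hj) (sq_nonneg _)

theorem estimate_zero_le (i : Fin n) : estimate T B σ 0 i ≤ (1 + ε) * Mhat := by
  have hε := hV.ε_pos
  have hε1 := hV.ε_le
  have hM := hV.mass_pos
  have htol : tol T B σ 0 ≤ ε / 4 * √(mass T B) := by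
    refine le_mul_sqrt (by positivity) ?_
    calc tol T B σ 0 ^ 2 ≤ mass T (downsample B σ 0) * (ε ^ 6 / (levels K ε n : ℝ) ^ 6) :=
          tol_sq_le hV.one_le_K hε hV.levels_pos T B σ 0
      _ ≤ mass T B * ε ^ 6 := by
          gcongr
          · exact mass_downsample_le hV.sketchable B σ 0
          · exact div_le_self (by positivity) (one_le_pow₀ (by linarith [hV.le_levels_cast]))
      _ = (2 * ε) ^ 4 * ((ε / 4) ^ 2 * mass T B) := by ring
      _ ≤ (ε / 4) ^ 2 * mass T B :=
          mul_le_of_le_one_left (by positivity) (pow_le_one₀ (by positivity) (by linarith))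
  have hnorm : ‖T (downsample B σ 0 i)‖ ≤ √(mass T B) :=
    Real.le_sqrt_of_sq_le ((rowMass_le_mass (B := downsample B σ 0) i).trans
      (mass_downsample_le hV.sketchable B σ 0))
  have hacc := (abs_le.1 (hF.accurate 0 i)).2
  calc estimate T B σ 0 i ≤ ((1 + ε / 4) * √(mass T B)) ^ 2 :=
        pow_le_pow_left₀ (norm_nonneg _) (by linarith) 2
    _ = (1 + ε / 4) ^ 2 * mass T B := by rw [mul_pow, Real.sq_sqrt hM.le]
    _ ≤ (1 + ε) * Mhat := mul_le_mul (by nlinarith) hV.mass_le hM.le (by positivity)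

theorem sum_strip_topEstimates_le (hj : j ≤ lastHeavyLevel K ε n) :
    ∑ i ∈ strip (1 + ε) (2 - ε) Mhat (topEstimates T B σ) j σ.ζ, topEstimates T B σ i ≤
      levelMass T B Mhat σ j := by
  have hscale : 0 < (1 + ε) * (σ.ζ * Mhat / 2 ^ j) :=
    mul_pos (by linarith [hV.ε_pos]) (hF.scale_pos hV j)
  have hmem {i : Fin n} (hi : i ∈ strip (1 + ε) (2 - ε) Mhat (topEstimates T B σ) j σ.ζ) :
      i ∈ heavyHitters T B σ 0 := by
    by_contra hnot
    have := (mem_strip.1 hi).1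
    rw [topEstimates, if_neg hnot] at this
    exact hscale.not_ge this
  have heq {i : Fin n} (hi : i ∈ heavyHitters T B σ 0) :
      topEstimates T B σ i = estimate T B σ 0 i := if_pos hi
  rw [levelMass_of_le hj, Finset.sum_congr rfl fun i hi => heq (hmem hi)]
  refine Finset.sum_le_sum_of_subset_of_nonneg (fun i hi => ?_)
    fun i _ _ => estimate_nonneg σ 0 i
  exact mem_levelElements.2 ⟨hmem hi, heq (hmem hi) ▸ mem_strip.1 hi⟩

theorem sum_heavyHitters_le (hjL : j ≤ levels K ε n) (hj : j ≤ lastHeavyLevel K ε n)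
    (hbig : ∀ i ∈ heavyHitters T B σ 0, (1 + ε) * (σ.ζ * Mhat / 2 ^ j) ≤ estimate T B σ 0 i) :
    1 / 2 * ∑ i ∈ heavyHitters T B σ 0, estimate T B σ 0 i ≤
      ∑ j ∈ Finset.range (levels K ε n + 1), levelMass T B Mhat σ j := by
  have hε := hV.ε_pos
  have hM := hV.Mhat_pos
  have hx := topEstimates_nonneg (T := T) (B := B) σ
  have hle (i : Fin n) : topEstimates T B σ i ≤ (1 + ε) * Mhat := by
    unfold topEstimates
    split_ifs <;> [exact hF.estimate_zero_le hV i; positivity]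
  have hcover := sum_le_stripMass_add_stripMass (up := 2 - ε) hM.le (by linarith)
    hF.shift_mem.1 hx hle j
  have hgap := (stripMass_mono (2 - ε) (2 * (1 + ε)) Mhat σ.ζ hx (Nat.succ_le_succ hjL)).trans
    hF.top_gap
  have hlevels : stripMass (1 + ε) (2 - ε) Mhat (j + 1) (topEstimates T B σ) σ.ζ ≤
      ∑ j ∈ Finset.range (levels K ε n + 1), levelMass T B Mhat σ j :=
    calc _ ≤ ∑ j' ∈ Finset.range (j + 1), levelMass T B Mhat σ j' :=
          Finset.sum_le_sum fun j' hj' => hF.sum_strip_topEstimates_le hV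
            ((Nat.le_of_lt_succ (Finset.mem_range.1 hj')).trans hj)
      _ ≤ ∑ j ∈ Finset.range (levels K ε n + 1), levelMass T B Mhat σ j :=
          Finset.sum_le_sum_of_subset_of_nonneg (Finset.range_mono (Nat.succ_le_succ hjL))
            fun j' _ _ => levelMass_nonneg T B Mhat σ j'
  have htotal : ∑ i, topEstimates T B σ i = ∑ i ∈ heavyHitters T B σ 0, estimate T B σ 0 i := by
    simp [topEstimates]
  have hall : ∑ i ∈ heavyHitters T B σ 0, estimate T B σ 0 i ≤
      ∑ i with (1 + ε) * (σ.ζ * Mhat / 2 ^ j) ≤ topEstimates T B σ i, topEstimates T B σ i := by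
    have heq {i : Fin n} (hi : i ∈ heavyHitters T B σ 0) :
        topEstimates T B σ i = estimate T B σ 0 i := if_pos hi
    rw [← Finset.sum_congr rfl fun i hi => heq hi]
    refine Finset.sum_le_sum_of_subset_of_nonneg (fun i hi => ?_) fun i _ _ => hx i
    exact (Finset.mem_filter_univ i).2 ((hbig i hi).trans_eq (heq hi).symm)
  linarith

theorem le_levelMass_of_subset (hj : j ≤ lastHeavyLevel K ε n)
    (hmass : mass T B / (2 * ((levels K ε n : ℝ) + 1)) ≤
      ∑ i ∈ innerRows T B Mhat K ε j σ.ζ, rowMass T B i)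
    (hsub : innerRows T B Mhat K ε j σ.ζ ⊆ heavyHitters T B σ 0) :
    mass T B / (4 * ((levels K ε n : ℝ) + 1)) ≤ levelMass T B Mhat σ j := by
  have hmem {i : Fin n} (hi : i ∈ innerRows T B Mhat K ε j σ.ζ) :=
    hF.estimate_mem hV (hF.tol_zero_le hV hj) hi (hF.keep_zero i)
  have hscale := hF.scale_pos hV j
  have hrow {i : Fin n} (hi : i ∈ innerRows T B Mhat K ε j σ.ζ) :
      rowMass T B i ≤ 2 * estimate T B σ 0 i :=
    calc rowMass T B i ≤ 2 * (σ.ζ * Mhat / 2 ^ j) :=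
          (mem_strip.1 hi).2.trans (mul_le_mul_of_nonneg_right hV.upper_le_two hscale.le)
      _ ≤ 2 * estimate T B σ 0 i := mul_le_mul_of_nonneg_left
          ((le_mul_of_one_le_left hscale.le (by linarith [hV.ε_pos])).trans (hmem hi).1) zero_le_two
  have hdouble : ∑ i ∈ innerRows T B Mhat K ε j σ.ζ, rowMass T B i ≤
      2 * levelMass T B Mhat σ j := by
    rw [levelMass_of_le hj, Finset.mul_sum]
    exact (Finset.sum_le_sum fun i hi => hrow hi).trans (Finset.sum_le_sum_of_subset_of_nonneg
      (fun i hi => mem_levelElements.2 ⟨hsub hi, hmem hi⟩)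
      fun i _ _ => mul_nonneg zero_le_two (estimate_nonneg σ 0 i))
  calc mass T B / (4 * ((levels K ε n : ℝ) + 1))
      = mass T B / (2 * ((levels K ε n : ℝ) + 1)) / 2 := by rw [div_div]; ring
    _ ≤ levelMass T B Mhat σ j := by linarith

/-- A missing row means that the list of heavy hitters is full of larger estimates, which carry
enough mass by themselves. -/
theorem le_sum_levelMass_of_notMem (hjL : j ≤ levels K ε n) (hj : j ≤ lastHeavyLevel K ε n)
    {i₀ : Fin n} (hi₀ : i₀ ∈ innerRows T B Mhat K ε j σ.ζ) (hnot : i₀ ∉ heavyHitters T B σ 0) :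
    mass T B / (32 * K) ≤ ∑ j ∈ Finset.range (levels K ε n + 1), levelMass T B Mhat σ j := by
  have hε := hV.ε_pos
  have hL := hV.levels_pos
  have hM := hV.mass_pos
  have hK := hV.one_le_K
  have hscale := hF.scale_pos hV j
  have hbig (i : Fin n) (hi : i ∈ heavyHitters T B σ 0) :
      (1 + ε) * (σ.ζ * Mhat / 2 ^ j) ≤ estimate T B σ 0 i :=
    (hF.estimate_mem hV (hF.tol_zero_le hV hj) hi₀ (hF.keep_zero i₀)).1.trans
      (le_of_notMem_topIndices hnot hi)
  have hcard : (levels K ε n : ℝ) ^ 3 / ε ^ 3 ≤ (heavyHitters T B σ 0).card :=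
    (le_topSize K ε n).trans (by exact_mod_cast le_card_topIndices_of_notMem hnot)
  have hsum : mass T B / (16 * K) ≤ ∑ i ∈ heavyHitters T B σ 0, estimate T B σ 0 i :=
    calc mass T B / (16 * K) = (levels K ε n : ℝ) ^ 3 / ε ^ 3 *
          (mass T B * ε ^ 3 / (16 * K * (levels K ε n : ℝ) ^ 3)) := by field_simp
      _ ≤ (heavyHitters T B σ 0).card * ((1 + ε) * (σ.ζ * Mhat / 2 ^ j)) := by
          refine mul_le_mul hcard ((hF.le_scale hV hj).trans ?_) (by positivity) (by positivity)
          exact le_mul_of_one_le_left hscale.le (by linarith)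
      _ ≤ ∑ i ∈ heavyHitters T B σ 0, estimate T B σ 0 i := by
          rw [← nsmul_eq_mul]
          exact Finset.card_nsmul_le_sum _ _ _ hbig
  calc mass T B / (32 * K) = 1 / 2 * (mass T B / (16 * K)) := by ring
    _ ≤ 1 / 2 * ∑ i ∈ heavyHitters T B σ 0, estimate T B σ 0 i := by gcongr
    _ ≤ _ := hF.sum_heavyHitters_le hV hjL hj hbig

end HeavyLevels

section LightLevels

theorem scale_le (hj : lastHeavyLevel K ε n < j) :
    σ.ζ * Mhat / 2 ^ j ≤ mass T B * ε ^ 3 / (8 * (levels K ε n : ℝ) ^ 3) := by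
  have hε := hV.ε_pos
  have hL := hV.levels_pos
  have hK := hV.one_le_K
  have hM := hV.mass_pos
  have hpow : 8 * K * (levels K ε n : ℝ) ^ 3 / ε ^ 3 ≤ 2 ^ j :=
    calc 8 * K * (levels K ε n : ℝ) ^ 3 / ε ^ 3
        = 2 * (4 * K * (levels K ε n : ℝ) ^ 3 / ε ^ 3) := by ring
      _ ≤ 2 * 2 ^ lastHeavyLevel K ε n := by gcongr; exact hV.le_two_pow_lastHeavyLevel
      _ = 2 ^ (lastHeavyLevel K ε n + 1) := by ring
      _ ≤ 2 ^ j := pow_le_pow_right₀ one_le_two hj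
  calc σ.ζ * Mhat / 2 ^ j ≤ K * mass T B / (8 * K * (levels K ε n : ℝ) ^ 3 / ε ^ 3) :=
        div_le_div₀ (by positivity) (hF.shift_mul_le hV) (by positivity) hpow
    _ = mass T B * ε ^ 3 / (8 * (levels K ε n : ℝ) ^ 3) := by field_simp

theorem mass_le_card_innerRows (hmass : mass T B / (2 * ((levels K ε n : ℝ) + 1)) ≤
      ∑ i ∈ innerRows T B Mhat K ε j σ.ζ, rowMass T B i) :
    mass T B ≤ 4 * ((levels K ε n : ℝ) + 1) * (σ.ζ * Mhat / 2 ^ j) *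
      (innerRows T B Mhat K ε j σ.ζ).card := by
  have hscale := hF.scale_pos hV j
  have hcard := hmass.trans (Finset.sum_le_card_nsmul _ _ (2 * (σ.ζ * Mhat / 2 ^ j)) fun i hi =>
    (mem_strip.1 hi).2.trans (mul_le_mul_of_nonneg_right hV.upper_le_two hscale.le))
  rw [nsmul_eq_mul, div_le_iff₀ (by positivity)] at hcard
  linarith

theorem sampleSize_le_card_innerRows (hj : lastHeavyLevel K ε n < j)
    (hN : mass T B ≤ 4 * ((levels K ε n : ℝ) + 1) * (σ.ζ * Mhat / 2 ^ j) *
      (innerRows T B Mhat K ε j σ.ζ).card) :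
    sampleSize K ε n ≤ (innerRows T B Mhat K ε j σ.ζ).card := by
  have hε := hV.ε_pos
  have hL := hV.le_levels_cast
  have hM := hV.mass_pos
  have hscale := hF.scale_le hV hj
  have hLε : ((levels K ε n : ℝ) + 1) * ε / (2 * levels K ε n) ≤ 1 := by
    rw [div_le_one (by linarith)]
    nlinarith [hV.ε_le]
  refine le_of_mul_le_mul_left ?_ hM
  calc mass T B * sampleSize K ε n
      ≤ 4 * ((levels K ε n : ℝ) + 1) *
          (mass T B * ε ^ 3 / (8 * (levels K ε n : ℝ) ^ 3)) *
          (innerRows T B Mhat K ε j σ.ζ).card * sampleSize K ε n :=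
        mul_le_mul_of_nonneg_right (hN.trans (by gcongr)) (by linarith [hV.one_le_sampleSize])
    _ = ((levels K ε n : ℝ) + 1) * ε / (2 * levels K ε n) *
          (mass T B * (innerRows T B Mhat K ε j σ.ζ).card) := by
        rw [sampleSize]; field_simp; ring
    _ ≤ mass T B * (innerRows T B Mhat K ε j σ.ζ).card :=
        mul_le_of_le_one_left (by positivity) hLε

theorem card_outerRows_le (hjL : j ≤ levels K ε n)
    (hN : mass T B ≤ 4 * ((levels K ε n : ℝ) + 1) * (σ.ζ * Mhat / 2 ^ j) *
      (innerRows T B Mhat K ε j σ.ζ).card) :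
    ((outerRows T B Mhat K ε j σ.ζ).card : ℝ) ≤
      (1 + ε / 2) * (innerRows T B Mhat K ε j σ.ζ).card := by
  have hε := hV.ε_pos
  have hscale := hF.scale_pos hV j
  have hjN := Finset.mem_range_succ_iff.2 hjL
  have hlow := (sum_strip_le_stripMass ((1 + ε) * (1 - margin K ε n))
    ((1 + ε) * (1 + margin K ε n)) Mhat σ.ζ (rowMass_nonneg (T := T) (B := B)) hjN).trans hF.low
  have hhigh := (sum_strip_le_stripMass ((2 - ε) * (1 - margin K ε n))
    ((2 - ε) * (1 + margin K ε n)) Mhat σ.ζ (rowMass_nonneg (T := T) (B := B)) hjN).trans hF.high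
  set I := innerRows T B Mhat K ε j σ.ζ
  set O := outerRows T B Mhat K ε j σ.ζ
  set t := σ.ζ * Mhat / 2 ^ j
  have hdiff : ((O \ I).card : ℝ) * t ≤ ε / 2 * I.card * t :=
    calc ((O \ I).card : ℝ) * t ≤ ∑ i ∈ O \ I, rowMass T B i := by
          rw [← nsmul_eq_mul]
          exact Finset.card_nsmul_le_sum _ _ _ fun i hi =>
            (le_mul_of_one_le_left hscale.le hV.one_le_lower).trans
              (mem_strip.1 (Finset.mem_sdiff.1 hi).1).1
      _ ≤ _ := Finset.sum_le_sum_of_subset_of_nonneg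
          (outerRows_sdiff_innerRows_subset T B Mhat K ε j σ.ζ) fun i _ _ => rowMass_nonneg i
      _ ≤ _ := le_trans (le_add_of_nonneg_right (Finset.sum_nonneg fun i _ => rowMass_nonneg i))
          (Finset.sum_union_inter.trans_le (add_le_add hlow hhigh))
      _ = ε / (8 * ((levels K ε n : ℝ) + 1)) * mass T B := by field_simp; ring
      _ ≤ ε / (8 * ((levels K ε n : ℝ) + 1)) *
          (4 * ((levels K ε n : ℝ) + 1) * t * I.card) := by gcongr
      _ = ε / 2 * I.card * t := by field_simp; ring
  have hcard : (O.card : ℝ) ≤ (O \ I).card + I.card := by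
    exact_mod_cast Finset.card_le_card_sdiff_add_card
  linarith [le_of_mul_le_mul_right hdiff hscale]

theorem tol_sq_le (ℓ : Fin (rates n + 1)) :
    tol T B σ ℓ ^ 2 ≤ 100 * (mass T B / 2 ^ (ℓ : ℕ)) * (ε ^ 6 / (levels K ε n : ℝ) ^ 5) := by
  have hε := hV.ε_pos
  have hL := hV.levels_pos
  have hM := hV.mass_pos
  calc tol T B σ ℓ ^ 2
      ≤ mass T (downsample B σ ℓ) * (ε ^ 6 / (levels K ε n : ℝ) ^ 6) :=
        HSketch.tol_sq_le hV.one_le_K hε hL T B σ ℓ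
    _ ≤ 100 * (levels K ε n : ℝ) * (mass T B / 2 ^ (ℓ : ℕ)) *
          (ε ^ 6 / (levels K ε n : ℝ) ^ 6) := by
        gcongr
        refine (hF.mass_le ℓ).trans ?_
        gcongr
        exact hV.rates_add_one_le
    _ = 100 * (mass T B / 2 ^ (ℓ : ℕ)) * (ε ^ 6 / (levels K ε n : ℝ) ^ 5) := by field_simp

theorem tol_le_of_mass_div_le (h : mass T B / 2 ^ (ℓ : ℕ) ≤
      8 * ((levels K ε n : ℝ) + 1) * sampleSize K ε n * (σ.ζ * Mhat / 2 ^ j)) :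
    tol T B σ ℓ ≤ margin K ε n / 8 * √(σ.ζ * Mhat / 2 ^ j) := by
  have hε := hV.ε_pos
  have hε1 := hV.ε_le
  have hL := hV.le_levels_cast
  have hs := hV.one_le_sampleSize
  have hscale := hF.scale_pos hV j
  refine le_mul_sqrt (div_nonneg hV.margin_pos.le (by norm_num)) ((hF.tol_sq_le hV ℓ).trans ?_)
  set t := σ.ζ * Mhat / 2 ^ j
  set L : ℝ := (levels K ε n : ℝ) with hLdef
  calc 100 * (mass T B / 2 ^ (ℓ : ℕ)) * (ε ^ 6 / L ^ 5)
      ≤ 100 * (8 * (2 * L) * sampleSize K ε n * t) * (ε ^ 6 / L ^ 5) := by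
        gcongr
        refine h.trans ?_
        gcongr
        linarith
    _ = (1600 * 64 * 10 ^ 10 * ε ^ 2) * ((margin K ε n / 8) ^ 2 * t) := by
        rw [margin, sampleSize, ← hLdef]; field_simp; ring
    _ ≤ (margin K ε n / 8) ^ 2 * t := mul_le_of_le_one_left (by positivity) (by nlinarith)

theorem mass_div_two_pow_le (hN : mass T B ≤ 4 * ((levels K ε n : ℝ) + 1) *
      (σ.ζ * Mhat / 2 ^ j) * (innerRows T B Mhat K ε j σ.ζ).card)
    (hℓ : ((innerRows T B Mhat K ε j σ.ζ).card : ℝ) / 2 ^ (ℓ : ℕ) < 2 * sampleSize K ε n) :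
    mass T B / 2 ^ (ℓ : ℕ) ≤
      8 * ((levels K ε n : ℝ) + 1) * sampleSize K ε n * (σ.ζ * Mhat / 2 ^ j) := by
  have hscale := hF.scale_pos hV j
  calc mass T B / 2 ^ (ℓ : ℕ) ≤ 4 * ((levels K ε n : ℝ) + 1) * (σ.ζ * Mhat / 2 ^ j) *
          (innerRows T B Mhat K ε j σ.ζ).card / 2 ^ (ℓ : ℕ) := by gcongr
    _ = 4 * ((levels K ε n : ℝ) + 1) * (σ.ζ * Mhat / 2 ^ j) *
          ((innerRows T B Mhat K ε j σ.ζ).card / 2 ^ (ℓ : ℕ)) := by ring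
    _ ≤ 4 * ((levels K ε n : ℝ) + 1) * (σ.ζ * Mhat / 2 ^ j) * (2 * sampleSize K ε n) :=
        mul_le_mul_of_nonneg_left hℓ.le (by positivity)
    _ = _ := by ring

theorem card_outerRows_div_le (hjL : j ≤ levels K ε n)
    (hN : mass T B ≤ 4 * ((levels K ε n : ℝ) + 1) * (σ.ζ * Mhat / 2 ^ j) *
      (innerRows T B Mhat K ε j σ.ζ).card)
    (hℓ : ((innerRows T B Mhat K ε j σ.ζ).card : ℝ) / 2 ^ (ℓ : ℕ) < 2 * sampleSize K ε n) :
    ((outerRows T B Mhat K ε j σ.ζ).card : ℝ) / 2 ^ (ℓ : ℕ) ≤ (2 + ε) * sampleSize K ε n := by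
  have hε := hV.ε_pos
  calc ((outerRows T B Mhat K ε j σ.ζ).card : ℝ) / 2 ^ (ℓ : ℕ)
      ≤ (1 + ε / 2) * (innerRows T B Mhat K ε j σ.ζ).card / 2 ^ (ℓ : ℕ) := by
        gcongr
        exact hF.card_outerRows_le hV hjL hN
    _ = (1 + ε / 2) * ((innerRows T B Mhat K ε j σ.ζ).card / 2 ^ (ℓ : ℕ)) := by ring
    _ ≤ (1 + ε / 2) * (2 * sampleSize K ε n) := mul_le_mul_of_nonneg_left hℓ.le (by positivity)
    _ = (2 + ε) * sampleSize K ε n := by ring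

theorem isBalancedRate (hjL : j ≤ levels K ε n)
    (hN : mass T B ≤ 4 * ((levels K ε n : ℝ) + 1) * (σ.ζ * Mhat / 2 ^ j) *
      (innerRows T B Mhat K ε j σ.ζ).card)
    (hℓ : ((innerRows T B Mhat K ε j σ.ζ).card : ℝ) / 2 ^ (ℓ : ℕ) ∈
      Set.Ico (sampleSize K ε n) (2 * sampleSize K ε n)) :
    IsBalancedRate (sampleSize K ε n) (8 * ((levels K ε n : ℝ) + 1) * sampleSize K ε n)
      (innerRows T B Mhat K ε j σ.ζ) (outerRows T B Mhat K ε j σ.ζ)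
      (rowsAbove T B Mhat j σ.ζ) ℓ where
  le_inner := hℓ.1
  inner_lt := hℓ.2
  outer_le := (hF.card_outerRows_div_le hV hjL hN hℓ.2).trans
    (mul_le_mul_of_nonneg_right (by linarith [hV.ε_le]) (by linarith [hV.one_le_sampleSize]))
  above_le := by
    refine le_of_mul_le_mul_right ?_ (hF.scale_pos hV j)
    rw [div_mul_eq_mul_div]
    exact (div_le_div_of_nonneg_right (card_rowsAbove_mul_le T B Mhat j σ.ζ) (by positivity)).trans
      (hF.mass_div_two_pow_le hV hN hℓ.2)

theorem sampled_innerRows_subset (hτ : tol T B σ ℓ ≤ margin K ε n / 8 * √(σ.ζ * Mhat / 2 ^ j))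
    (htop : (sampled σ ℓ (rowsAbove T B Mhat j σ.ζ)).card ≤ topSize stdConstants K ε n) :
    sampled σ ℓ (innerRows T B Mhat K ε j σ.ζ) ⊆ levelElements T B Mhat σ j ℓ := by
  intro i hi
  obtain ⟨hinner, hkeep⟩ := Finset.mem_filter.1 hi
  have hmem := hF.estimate_mem hV hτ hinner hkeep
  refine mem_levelElements.2 ⟨mem_topIndices_of_card_le ?_, hmem⟩
  refine (Finset.card_le_card fun i' hi' => ?_).trans htop
  exact (hF.mem_sampled_rowsAbove hV hτ (hmem.1.trans ((Finset.mem_filter_univ i').1 hi'))).1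

theorem levelElements_subset (hτ : tol T B σ ℓ ≤ margin K ε n / 8 * √(σ.ζ * Mhat / 2 ^ j)) :
    levelElements T B Mhat σ j ℓ ⊆ sampled σ ℓ (outerRows T B Mhat K ε j σ.ζ) := fun _ hi =>
  have hmem := (mem_levelElements.1 hi).2
  (hF.mem_sampled_rowsAbove hV hτ hmem.1).2 hmem.2

theorem mem_admissible (hjL : j ≤ levels K ε n)
    (hN : mass T B ≤ 4 * ((levels K ε n : ℝ) + 1) * (σ.ζ * Mhat / 2 ^ j) *
      (innerRows T B Mhat K ε j σ.ζ).card)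
    (hℓ : ((innerRows T B Mhat K ε j σ.ζ).card : ℝ) / 2 ^ (ℓ : ℕ) ∈
      Set.Ico (sampleSize K ε n) (2 * sampleSize K ε n)) :
    ℓ ∈ admissible T B Mhat σ j := by
  have hbalanced := hF.isBalancedRate hV hjL hN hℓ
  obtain ⟨hinner, houter, habove⟩ :=
    hF.sample j (Finset.mem_range_succ_iff.2 hjL) ℓ hbalanced
  have houterRate := hF.card_outerRows_div_le hV hjL hN hℓ.2
  have hτ := hF.tol_le_of_mass_div_le hV (hF.mass_div_two_pow_le hV hN hℓ.2)
  have hs := hV.one_le_sampleSize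
  have hεs : 0 ≤ ε * sampleSize K ε n := mul_nonneg hV.ε_pos.le (by linarith)
  have hsqrt : 4 * (ε * sampleSize K ε n) ≤ √20 * (ε * sampleSize K ε n) :=
    mul_le_mul_of_nonneg_right sqrt_twenty_mem.1 hεs
  have htop : (sampled σ ℓ (rowsAbove T B Mhat j σ.ζ)).card ≤ topSize stdConstants K ε n := by
    suffices ((sampled σ ℓ (rowsAbove T B Mhat j σ.ζ)).card : ℝ) ≤
      topSize stdConstants K ε n by exact_mod_cast this
    have hrate := hbalanced.above_le
    have hdev := (abs_lt.1 habove).2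
    have hcapacity := hV.sampleSize_mul_le_topSize
    linarith
  have hle : ((sampled σ ℓ (innerRows T B Mhat K ε j σ.ζ)).card : ℝ) ≤
      (levelElements T B Mhat σ j ℓ).card := by
    exact_mod_cast Finset.card_le_card (hF.sampled_innerRows_subset hV hτ htop)
  have hge : ((levelElements T B Mhat σ j ℓ).card : ℝ) ≤
      (sampled σ ℓ (outerRows T B Mhat K ε j σ.ζ)).card := by
    exact_mod_cast Finset.card_le_card (hF.levelElements_subset hV hτ)
  have hinnerDev := (abs_lt.1 hinner).1
  have houterDev := (abs_lt.1 houter).2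
  have hinnerRate := hℓ.1
  exact mem_admissible_iff.2 ⟨by linarith, by linarith⟩

theorem le_levelMass_of_light (hjL : j ≤ levels K ε n) (hj : lastHeavyLevel K ε n < j)
    (hmass : mass T B / (2 * ((levels K ε n : ℝ) + 1)) ≤
      ∑ i ∈ innerRows T B Mhat K ε j σ.ζ, rowMass T B i) :
    mass T B / (16 * ((levels K ε n : ℝ) + 1)) ≤ levelMass T B Mhat σ j := by
  have hN := hF.mass_le_card_innerRows hV hmass
  obtain ⟨ℓ₀, hℓ₀⟩ := exists_div_two_pow_mem_Ico hV.one_le_sampleSize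
    (hF.sampleSize_le_card_innerRows hV hj hN)
    ((Finset.card_le_univ _).trans_eq (Fintype.card_fin n))
  have hrate := hF.mass_div_two_pow_le hV hN hℓ₀.2
  obtain ⟨ℓ, hadm, hchosen, hle⟩ :=
    exists_chosen_of_admissible hj (hF.mem_admissible hV hjL hN hℓ₀)
  have hs := hV.one_le_sampleSize
  have hscale := hF.scale_pos hV j
  have hcard : sampleSize K ε n / 2 ≤ (levelElements T B Mhat σ j ℓ).card := by
    refine le_trans ?_ (mem_admissible_iff.1 hadm).1
    have hsmall : √20 * ε ≤ 1 / 2 := by nlinarith [sqrt_twenty_mem.2, hV.ε_le, hV.ε_pos]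
    nlinarith
  have hsum : (levelElements T B Mhat σ j ℓ).card * (σ.ζ * Mhat / 2 ^ j) ≤
      ∑ i ∈ levelElements T B Mhat σ j ℓ, estimate T B σ ℓ i := by
    rw [← nsmul_eq_mul]
    exact Finset.card_nsmul_le_sum _ _ _ fun i hi =>
      (le_mul_of_one_le_left hscale.le (by linarith [hV.ε_pos])).trans
        (mem_levelElements.1 hi).2.1
  rw [levelMass_of_chosen hchosen, div_le_iff₀ (by positivity)]
  rw [div_le_iff₀ (by positivity)] at hrate
  calc mass T B ≤ 8 * ((levels K ε n : ℝ) + 1) * sampleSize K ε n * (σ.ζ * Mhat / 2 ^ j) *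
          2 ^ (ℓ₀ : ℕ) := hrate
    _ = (sampleSize K ε n / 2 * (σ.ζ * Mhat / 2 ^ j) * 2 ^ (ℓ₀ : ℕ)) *
          (16 * ((levels K ε n : ℝ) + 1)) := by ring
    _ ≤ (∑ i ∈ levelElements T B Mhat σ j ℓ, estimate T B σ ℓ i) * 2 ^ (ℓ : ℕ) *
          (16 * ((levels K ε n : ℝ) + 1)) :=
        mul_le_mul_of_nonneg_right (mul_le_mul
          ((mul_le_mul_of_nonneg_right hcard hscale.le).trans hsum)
          (pow_le_pow_right₀ one_le_two hle) (by positivity)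
          (Finset.sum_nonneg fun i _ => estimate_nonneg σ ℓ i)) (by positivity)

end LightLevels

theorem le_sum_levelMass : mass T B / (32 * K * ((levels K ε n : ℝ) + 1)) ≤
    ∑ j ∈ Finset.range (levels K ε n + 1), levelMass T B Mhat σ j := by
  have hM := hV.mass_pos
  have hK := hV.one_le_K
  have hL := hV.le_levels_cast
  obtain ⟨j, hj, hmass⟩ := hF.exists_level hV
  have hjL := Finset.mem_range_succ_iff.1 hj
  rcases le_or_gt j (lastHeavyLevel K ε n) with hheavy | hlight
  · by_cases hsub : innerRows T B Mhat K ε j σ.ζ ⊆ heavyHitters T B σ 0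
    · refine le_trans ?_ ((hF.le_levelMass_of_subset hV hheavy hmass hsub).trans
        (levelMass_le_sum T B Mhat σ hj))
      exact div_le_div_of_nonneg_left hM.le (by positivity) (by nlinarith)
    · obtain ⟨i, hi, hnot⟩ := Finset.not_subset.1 hsub
      refine le_trans ?_ (hF.le_sum_levelMass_of_notMem hV hjL hheavy hi hnot)
      exact div_le_div_of_nonneg_left hM.le (by positivity) (by nlinarith)
  · refine le_trans ?_ ((hF.le_levelMass_of_light hV hjL hlight hmass).trans
      (levelMass_le_sum T B Mhat σ hj))
    exact div_le_div_of_nonneg_left hM.le (by positivity) (by nlinarith)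

theorem scale_mul_two_pow_le (hτ : ε * √(σ.ζ * Mhat / 2 ^ j) < tol T B σ ℓ) :
    σ.ζ * Mhat / 2 ^ j * 2 ^ (ℓ : ℕ) ≤ 100 * mass T B * (ε ^ 4 / (levels K ε n : ℝ) ^ 5) := by
  have hε := hV.ε_pos
  have hL := hV.levels_pos
  have hsq : ε ^ 2 * (σ.ζ * Mhat / 2 ^ j) ≤ tol T B σ ℓ ^ 2 := by
    have := pow_le_pow_left₀ (by positivity) hτ.le 2
    rwa [mul_pow, Real.sq_sqrt (hF.scale_pos hV j).le] at this
  refine le_of_mul_le_mul_left ?_ (by positivity : 0 < ε ^ 2)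
  calc ε ^ 2 * (σ.ζ * Mhat / 2 ^ j * 2 ^ (ℓ : ℕ))
      = ε ^ 2 * (σ.ζ * Mhat / 2 ^ j) * 2 ^ (ℓ : ℕ) := by ring
    _ ≤ 100 * (mass T B / 2 ^ (ℓ : ℕ)) * (ε ^ 6 / (levels K ε n : ℝ) ^ 5) * 2 ^ (ℓ : ℕ) :=
        mul_le_mul_of_nonneg_right (hsq.trans (hF.tol_sq_le hV ℓ)) (by positivity)
    _ = ε ^ 2 * (100 * mass T B * (ε ^ 4 / (levels K ε n : ℝ) ^ 5)) := by field_simp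

theorem levelMass_le_of_inaccurate (hc : chosen T B Mhat σ j = some ℓ)
    (hτ : ε * √(σ.ζ * Mhat / 2 ^ j) < tol T B σ ℓ) :
    levelMass T B Mhat σ j ≤ 800 * mass T B * ε ^ 2 / (levels K ε n : ℝ) ^ 3 := by
  have hε := hV.ε_pos
  have hL := hV.levels_pos
  have hscale := hF.scale_pos hV j
  rcases le_or_gt j (lastHeavyLevel K ε n) with hheavy | hlight
  · rw [chosen_of_le hheavy] at hc
    rw [← Option.some.inj hc] at hτ
    refine absurd (hF.tol_zero_le hV hheavy) (not_le.2 (lt_of_le_of_lt ?_ hτ))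
    exact mul_le_mul_of_nonneg_right (by linarith [hV.margin_le]) (Real.sqrt_nonneg _)
  have hs := hV.one_le_sampleSize
  have hcard : ((levelElements T B Mhat σ j ℓ).card : ℝ) ≤ 4 * sampleSize K ε n := by
    refine (mem_admissible_iff.1 (mem_admissible_of_chosen hlight hc)).2.trans ?_
    have hsmall : √20 * ε ≤ 1 := by nlinarith [sqrt_twenty_mem.2, hV.ε_le]
    nlinarith
  have hsum : ∑ i ∈ levelElements T B Mhat σ j ℓ, estimate T B σ ℓ i ≤
      (levelElements T B Mhat σ j ℓ).card * (2 * (σ.ζ * Mhat / 2 ^ j)) := by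
    rw [← nsmul_eq_mul]
    exact Finset.sum_le_card_nsmul _ _ _ fun i hi => (mem_levelElements.1 hi).2.2.trans
      (mul_le_mul_of_nonneg_right (by linarith) hscale.le)
  rw [levelMass_of_chosen hc]
  calc (∑ i ∈ levelElements T B Mhat σ j ℓ, estimate T B σ ℓ i) * 2 ^ (ℓ : ℕ)
      ≤ 4 * sampleSize K ε n * (2 * (σ.ζ * Mhat / 2 ^ j)) * 2 ^ (ℓ : ℕ) :=
        mul_le_mul_of_nonneg_right
          (hsum.trans (mul_le_mul_of_nonneg_right hcard (by positivity))) (by positivity)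
    _ = 8 * sampleSize K ε n * (σ.ζ * Mhat / 2 ^ j * 2 ^ (ℓ : ℕ)) := by ring
    _ ≤ 8 * sampleSize K ε n * (100 * mass T B * (ε ^ 4 / (levels K ε n : ℝ) ^ 5)) :=
        mul_le_mul_of_nonneg_left (hF.scale_mul_two_pow_le hV hτ) (by linarith)
    _ = 800 * mass T B * ε ^ 2 / (levels K ε n : ℝ) ^ 3 := by
        rw [sampleSize]; field_simp; ring

end IsFavourable

section Probability

variable {Ω : Type*} [MeasurableSpace Ω] {μ : Measure Ω}
  {n m : ℕ} {T : (Fin m → ℝ) → EuclideanSpace ℝ (Fin m)} {B : Matrix (Fin n) (Fin m) ℝ}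
  {K ε Mhat : ℝ} {S : Ω → Seed stdConstants K ε n}

theorem le_four_pow_reps {n : ℕ} (hn : 0 < n) :
    100 * (((rates n : ℝ) + 1) * n) ≤ 4 ^ reps stdConstants n := by
  set N : ℝ := ((rates n : ℝ) + 1) * n with hN
  have hN1 : 1 ≤ N := by
    rw [hN]
    exact one_le_mul_of_one_le_of_one_le (by simp) (by exact_mod_cast hn)
  have hquery : 2 * (n : ℝ) / (1 / ((rates n : ℝ) + 1)) = 2 * N := by rw [hN]; field_simp
  have hreps : 8 * Real.log (2 * N) ≤ reps stdConstants n := by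
    rw [reps, hquery]; exact Nat.le_ceil _
  calc 100 * N ≤ (2 * N) ^ 8 := by
        rw [mul_pow]
        linarith [le_self_pow₀ hN1 (by norm_num : 8 ≠ 0)]
    _ = Real.exp (8 * Real.log (2 * N)) := by
        rw [mul_comm 8, Real.exp_mul, Real.exp_log (by linarith)]; norm_cast
    _ ≤ Real.exp (reps stdConstants n) := Real.exp_le_exp.2 hreps
    _ = Real.exp 1 ^ reps stdConstants n := by rw [← Real.exp_nat_mul, mul_one]
    _ ≤ 4 ^ reps stdConstants n := by
        gcongr
        linarith [Real.exp_one_lt_d9]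

theorem reps_stdConstants_pos {n : ℕ} (hn : 0 < n) : 0 < reps stdConstants n := by
  rw [Nat.pos_iff_ne_zero]
  intro hreps
  have hn1 : (1 : ℝ) ≤ n := by exact_mod_cast hn
  have hpow := le_four_pow_reps hn
  rw [hreps, pow_zero] at hpow
  nlinarith [(rates n).cast_nonneg (α := ℝ)]

theorem ofReal_le_hundredth {x : ℝ} (h : x ≤ 1 / 100) : ENNReal.ofReal x ≤ 100⁻¹ := by
  refine (ENNReal.ofReal_le_ofReal h).trans_eq ?_
  rw [one_div, ENNReal.ofReal_inv_of_pos (by norm_num), ENNReal.ofReal_ofNat]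

theorem IsValidInput.measure_gap_le (hV : IsValidInput T B Mhat K ε) (hS : IsRandomSeed μ S) :
    μ {ω | 1 / 4 * mass T B < stripMass ((2 - ε) * (1 - margin K ε n))
      (2 * ((1 + ε) * (1 + margin K ε n))) Mhat (levels K ε n + 1) (rowMass T B) (S ω).ζ} ≤
      100⁻¹ := by
  have hε := hV.ε_pos
  have hε_le := hV.ε_le
  have hmargin := hV.margin_pos
  have hmargin_le := hV.margin_le
  exact (measure_stripMass_le hS.measurable_ζ hS.ζ_uniform (by nlinarith) (by nlinarith)
    hV.Mhat_pos rowMass_nonneg (by norm_num) _).trans (ofReal_le_hundredth (by nlinarith))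

theorem IsValidInput.measure_edge_le (hV : IsValidInput T B Mhat K ε) (hS : IsRandomSeed μ S)
    {a : ℝ} (ha : 1 + ε ≤ a) (ha2 : a ≤ 2) :
    μ {ω | ε / (16 * ((levels K ε n : ℝ) + 1)) * mass T B <
      stripMass (a * (1 - margin K ε n)) (a * (1 + margin K ε n)) Mhat (levels K ε n + 1)
        (rowMass T B) (S ω).ζ} ≤ 100⁻¹ := by
  have hε := hV.ε_pos
  have hL := hV.le_levels_cast
  have hmargin := hV.margin_pos
  have hmargin_le := hV.margin_le
  have hratio : margin K ε n / (ε / (16 * ((levels K ε n : ℝ) + 1))) ≤ 32 / 10 ^ 5 := by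
    rw [margin, div_div_div_eq, div_le_div_iff₀ (by positivity) (by norm_num)]
    nlinarith
  refine (measure_stripMass_le hS.measurable_ζ hS.ζ_uniform (by nlinarith) (by nlinarith)
    hV.Mhat_pos rowMass_nonneg (by positivity) _).trans (ofReal_le_hundredth ?_)
  calc 4 * (a * (1 + margin K ε n) - a * (1 - margin K ε n)) /
        (ε / (16 * ((levels K ε n : ℝ) + 1)))
      = 8 * a * (margin K ε n / (ε / (16 * ((levels K ε n : ℝ) + 1)))) := by ring
    _ ≤ 1 / 100 := by nlinarith

variable [IsProbabilityMeasure μ]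

theorem measure_not_accurate_le (hS : IsRandomSeed μ S) (hT : IsSketchable T) (hn : 0 < n)
    (B : Matrix (Fin n) (Fin m) ℝ) :
    μ {ω | ∃ ℓ i, tol T B (S ω) ℓ <
      |‖T (answer T B (S ω) ℓ i)‖ - ‖T (downsample B (S ω) ℓ i)‖|} ≤ 100⁻¹ := by
  rw [Set.ofPred_exists]
  refine (measure_iUnion_fintype_le _ _).trans ((Finset.sum_le_sum fun ℓ _ =>
    measure_answer_le hS (reps_stdConstants_pos hn) hT B ℓ).trans ?_)
  rw [Finset.sum_const, Finset.card_univ, Fintype.card_fin, nsmul_eq_mul, ← mul_assoc,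
    ← ENNReal.inv_pow, ← div_eq_mul_inv, ENNReal.le_inv_iff_mul_le, ← ENNReal.mul_div_right_comm]
  refine ENNReal.div_le_of_le_mul ?_
  rw [one_mul, mul_comm]
  exact_mod_cast le_four_pow_reps hn

theorem IsRandomSeed.measure_keep_zero (hS : IsRandomSeed μ S) :
    μ {ω | ∃ i, (S ω).keep 0 i ≠ true} = 0 := by
  rw [Set.ofPred_exists]
  refine measure_iUnion_null fun i => ?_
  have hone := hS.keep_prob 0 i
  rw [Fin.val_zero, pow_zero] at hone
  exact (prob_compl_eq_zero_iff (hS.measurableSet_keep 0 i)).2 hone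

theorem measure_lt_stripMass_topEstimates_le (hS : IsRandomSeed μ S) {α β : ℝ} (hα : 1 ≤ α)
    (hαβ : α < β) (hM : 0 < Mhat) {η : ℝ} (hη : 0 < η) (N : ℕ) :
    μ {ω | η * ∑ i, topEstimates T B (S ω) i <
      stripMass α β Mhat N (topEstimates T B (S ω)) (S ω).ζ} ≤
      ENNReal.ofReal (4 * (β - α) / η) := by
  -- The estimates do not depend on the shift.
  set x : (Fin (rates n + 1) → Fin n → Bool) ×
      ((ℓ : Fin (rates n + 1)) → Fin (reps stdConstants n) → Fin n →
        Fin (width stdConstants K ε n ℓ)) ×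
      (Fin (rates n + 1) → Fin (reps stdConstants n) → Fin n → ℤˣ) → Fin n → ℝ := fun y =>
    topEstimates T B (⟨y.1, y.2.1, y.2.2, 0⟩ : Seed stdConstants K ε n)
  have hsketch : Measurable fun ω => ((S ω).keep, (S ω).hash, (S ω).sign) :=
    (measurable_pi_iff.2 hS.measurable_keep).prodMk
      ((measurable_pi_iff.2 fun ℓ => measurable_pi_iff.2 (hS.measurable_hash ℓ)).prodMk
        (measurable_pi_iff.2 fun ℓ => measurable_pi_iff.2 (hS.measurable_sign ℓ)))
  exact measure_mem_le_of_indepFun hsketch hS.ζ_indep.symm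
    (D := fun y => {z | η * ∑ i, x y i < stripMass α β Mhat N (x y) z})
    (fun y => measurableSet_lt measurable_const (measurable_stripMass _ _ _ _ _))
    fun y => measure_stripMass_le hS.measurable_ζ hS.ζ_uniform hα hαβ hM
      (fun i => topEstimates_nonneg _ i) hη N

theorem measurableSet_mem_innerRows (j : ℕ) (i : Fin n) :
    MeasurableSet {z | i ∈ innerRows T B Mhat K ε j z} :=
  measurableSet_strip ..

theorem measurableSet_mem_outerRows (j : ℕ) (i : Fin n) :
    MeasurableSet {z | i ∈ outerRows T B Mhat K ε j z} :=
  measurableSet_strip ..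

theorem measurableSet_mem_rowsAbove (j : ℕ) (i : Fin n) :
    MeasurableSet {z | i ∈ rowsAbove T B Mhat j z} := by
  simp only [rowsAbove, Finset.mem_filter, Finset.mem_univ, true_and]
  exact measurableSet_le (by fun_prop) measurable_const

theorem IsValidInput.sum_sample_le (hV : IsValidInput T B Mhat K ε) :
    ((levels K ε n : ℝ) + 1) * (5 * sampleSize K ε n / (2 * ε * sampleSize K ε n) ^ 2 +
      1 / (8 * ((levels K ε n : ℝ) + 1) * sampleSize K ε n)) ≤ 1 / 100 := by
  have hε := hV.ε_pos
  have hL250 := hV.le_levels_cast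
  set L : ℝ := (levels K ε n : ℝ)
  have hs : ε ^ 2 * sampleSize K ε n = L ^ 2 := mul_div_cancel₀ _ (pow_ne_zero 2 hε.ne')
  have hs0 : 0 < sampleSize K ε n := zero_lt_one.trans_le hV.one_le_sampleSize
  have hsL : L ^ 2 ≤ sampleSize K ε n := by
    rw [← hs]
    exact mul_le_of_le_one_left hs0.le (pow_le_one₀ hε.le (by linarith [hV.ε_le]))
  have hfirst : 5 * sampleSize K ε n / (2 * ε * sampleSize K ε n) ^ 2 = 5 / (4 * L ^ 2) := by
    rw [← hs]; field_simp; norm_num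
  have hsecond : 1 / (8 * (L + 1) * sampleSize K ε n) ≤ 1 / (8 * L ^ 2) :=
    one_div_le_one_div_of_le (by positivity) (by nlinarith)
  calc (L + 1) * (5 * sampleSize K ε n / (2 * ε * sampleSize K ε n) ^ 2 +
        1 / (8 * (L + 1) * sampleSize K ε n))
      ≤ (3 / 2 * L) * (5 / (4 * L ^ 2) + 1 / (8 * L ^ 2)) := by
        rw [hfirst]; gcongr; linarith
    _ = 33 / (16 * L) := by field_simp; ring
    _ ≤ 1 / 100 := by
        rw [div_le_div_iff₀ (by positivity) (by norm_num)]; linarith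

theorem measure_not_sample_le (hS : IsRandomSeed μ S) (hV : IsValidInput T B Mhat K ε) :
    μ {ω | ∃ j ∈ Finset.range (levels K ε n + 1), ∃ ℓ : Fin (rates n + 1),
      IsBalancedRate (sampleSize K ε n) (8 * ((levels K ε n : ℝ) + 1) * sampleSize K ε n)
        (innerRows T B Mhat K ε j (S ω).ζ) (outerRows T B Mhat K ε j (S ω).ζ)
        (rowsAbove T B Mhat j (S ω).ζ) ℓ ∧
      ¬ (IsConcentrated (S ω) ℓ (innerRows T B Mhat K ε j (S ω).ζ) (2 * ε * sampleSize K ε n) ∧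
        IsConcentrated (S ω) ℓ (outerRows T B Mhat K ε j (S ω).ζ) (2 * ε * sampleSize K ε n) ∧
        IsConcentrated (S ω) ℓ (rowsAbove T B Mhat j (S ω).ζ)
          (8 * ((levels K ε n : ℝ) + 1) * sampleSize K ε n))} ≤ 100⁻¹ := by
  have hε := hV.ε_pos
  have hs0 : 0 < sampleSize K ε n := zero_lt_one.trans_le hV.one_le_sampleSize
  have hlevel (j : ℕ) := measure_exists_not_isConcentrated_shift_le hS
    (s := sampleSize K ε n)
    (measurableSet_mem_innerRows (T := T) (B := B) (Mhat := Mhat) (K := K) (ε := ε) j)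
    (measurableSet_mem_outerRows (T := T) (B := B) (Mhat := Mhat) (K := K) (ε := ε) j)
    (measurableSet_mem_rowsAbove (T := T) (B := B) (Mhat := Mhat) j)
    (by positivity : 0 < 2 * ε * sampleSize K ε n)
    (by positivity : 0 < 8 * ((levels K ε n : ℝ) + 1) * sampleSize K ε n)
  have hunion := (measure_biUnion_finset_le (Finset.range (levels K ε n + 1)) _).trans
    (Finset.sum_le_sum fun j _ => hlevel j)
  refine (measure_mono ?_).trans (hunion.trans ?_)
  · rintro ω ⟨j, hj, hω⟩
    exact Set.mem_biUnion hj hω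
  · rw [Finset.sum_const, Finset.card_range, nsmul_eq_mul, ← ENNReal.ofReal_natCast,
      ← ENNReal.ofReal_mul (by positivity), Nat.cast_add_one]
    exact ofReal_le_hundredth hV.sum_sample_le

theorem IsValidInput.measure_not_isFavourable_le (hV : IsValidInput T B Mhat K ε)
    (hS : IsRandomSeed μ S) : μ {ω | ¬ IsFavourable T B Mhat (S ω)} ≤ 7 * 100⁻¹ := by
  have hε := hV.ε_pos
  have hε_le := hV.ε_le
  have hshift := measure_uniform_notMem hS.measurable_ζ hS.ζ_uniform
  have haccurate := measure_not_accurate_le hS hV.sketchable hV.n_pos B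
  have hmass := measure_mass_downsample_le hS hV.sketchable B (a := 100) (by norm_num)
  rw [ENNReal.ofReal_ofNat] at hmass
  have hlow := hV.measure_edge_le hS le_rfl (by linarith)
  have hhigh := hV.measure_edge_le hS (a := 2 - ε) (by linarith) (by linarith)
  have htop := (measure_lt_stripMass_topEstimates_le (T := T) (B := B) hS (α := 2 - ε)
    (β := 2 * (1 + ε)) (by linarith) (by linarith) hV.Mhat_pos one_half_pos
    (levels K ε n + 1)).trans (ofReal_le_hundredth (by linarith))
  have hunion {s t : Set Ω} {a b : ℝ≥0∞} (hs : μ s ≤ a) (ht : μ t ≤ b) : μ (s ∪ t) ≤ a + b :=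
    (measure_union_le s t).trans (add_le_add hs ht)
  refine (measure_mono ?_).trans ((hunion hshift.le (hunion hS.measure_keep_zero.le
    (hunion haccurate (hunion hmass (hunion (hV.measure_gap_le hS) (hunion hlow (hunion hhigh
    (hunion htop (measure_not_sample_le hS hV))))))))).trans_eq (by ring))
  intro ω hω
  by_contra hgood
  simp only [Set.mem_union, not_or, Set.mem_ofPred_eq, not_exists, not_lt, not_not]
    at hgood
  obtain ⟨hshift, hkeep, haccurate, hmass, hgap, hlow, hhigh, htop, hsample⟩ := hgood
  exact hω ⟨hshift, hkeep, haccurate, hmass, hgap, hlow, hhigh, htop, fun j hj ℓ hℓ =>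
    by_contra fun h => hsample j ⟨hj, ℓ, hℓ, h⟩⟩

end Probability

section Pick

variable {α : Type} [Fintype α] {wt : α → ℝ}

theorem pick_some (hpos : ∑ a, ENNReal.ofReal (wt a) ≠ 0) (a : α) :
    pick wt (some a) = ENNReal.ofReal (wt a) * (∑ a, ENNReal.ofReal (wt a))⁻¹ := by
  classical
  rw [pick, dif_neg hpos, PMF.map_apply, tsum_eq_single a fun b hb => by simp [hb.symm]]
  simp [PMF.normalize_apply]

theorem sum_ofReal_ne_zero (hwt : ∀ a, 0 ≤ wt a) (hpos : 0 < ∑ a, wt a) :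
    ∑ a, ENNReal.ofReal (wt a) ≠ 0 := by
  rw [← ENNReal.ofReal_sum_of_nonneg fun a _ => hwt a]
  exact (ENNReal.ofReal_pos.2 hpos).ne'

theorem exists_of_mem_support_pick (hpos : ∑ a, ENNReal.ofReal (wt a) ≠ 0) {x : Option α}
    (hx : x ∈ (pick wt).support) : ∃ a, x = some a ∧ 0 < wt a := by
  have hx' := hx
  rw [pick, dif_neg hpos, PMF.mem_support_map_iff] at hx'
  obtain ⟨a, -, rfl⟩ := hx'
  rw [PMF.mem_support_iff, pick_some hpos] at hx
  exact ⟨a, rfl, ENNReal.ofReal_pos.1 (pos_iff_ne_zero.2 (left_ne_zero_of_mul hx))⟩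

theorem sum_pick_some_of_nonneg (hwt : ∀ a, 0 ≤ wt a) (hpos : 0 < ∑ a, wt a) (G : Finset α) :
    ∑ a ∈ G, pick wt (some a) = ENNReal.ofReal ((∑ a ∈ G, wt a) / ∑ a, wt a) := by
  rw [ENNReal.ofReal_div_of_pos hpos, ENNReal.ofReal_sum_of_nonneg fun a _ => hwt a,
    ENNReal.ofReal_sum_of_nonneg fun a _ => hwt a, ENNReal.div_eq_inv_mul, mul_comm,
    Finset.sum_mul]
  exact Finset.sum_congr rfl fun a _ => pick_some (sum_ofReal_ne_zero hwt hpos) a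

theorem le_bind_pick {β : Type*} (hwt : ∀ a, 0 ≤ wt a) (hpos : 0 < ∑ a, wt a)
    (F : Option α → PMF β) (s : Set β) {γ q : ℝ}
    (hF : ∀ a, wt a ≤ γ ∨ (F (some a)).toOuterMeasure s = 1) (hγ : 0 ≤ γ)
    (hq : Fintype.card α * γ ≤ q * ∑ a, wt a) :
    ENNReal.ofReal (1 - q) ≤ ((pick wt).bind F).toOuterMeasure s := by
  classical
  set G : Finset α := {a | (F (some a)).toOuterMeasure s = 1}
  have hbad : ∑ a with (F (some a)).toOuterMeasure s ≠ 1, wt a ≤ Fintype.card α * γ := by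
    refine (Finset.sum_le_card_nsmul _ _ γ fun a ha =>
      (hF a).resolve_right (Finset.mem_filter.1 ha).2).trans ?_
    rw [nsmul_eq_mul]
    gcongr
    exact Finset.card_le_univ _
  have hgood : 1 - q ≤ (∑ a ∈ G, wt a) / ∑ a, wt a := by
    rw [le_div_iff₀ hpos]
    linarith [Finset.sum_filter_add_sum_filter_not Finset.univ
      (fun a => (F (some a)).toOuterMeasure s = 1) wt]
  calc ENNReal.ofReal (1 - q) ≤ ENNReal.ofReal ((∑ a ∈ G, wt a) / ∑ a, wt a) :=
        ENNReal.ofReal_le_ofReal hgood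
    _ = ∑ a ∈ G, pick wt (some a) * (F (some a)).toOuterMeasure s := by
        rw [← sum_pick_some_of_nonneg hwt hpos]
        refine Finset.sum_congr rfl fun a ha => ?_
        rw [(Finset.mem_filter.1 ha).2, mul_one]
    _ = ∑ x ∈ G.map Function.Embedding.some, pick wt x * (F x).toOuterMeasure s := by
        simp only [Finset.sum_map, Function.Embedding.some_apply]
    _ ≤ ∑' x, pick wt x * (F x).toOuterMeasure s := ENNReal.sum_le_tsum _
    _ = ((pick wt).bind F).toOuterMeasure s := (PMF.toOuterMeasure_bind_apply ..).symm

end Pick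

section Output

variable {n m : ℕ} {T : (Fin m → ℝ) → EuclideanSpace ℝ (Fin m)} {B : Matrix (Fin n) (Fin m) ℝ}
  {Mhat K ε : ℝ}

theorem answer_pick_levelElements_eq_one {c : Constants} {σ : Seed c K ε n} {j : ℕ}
    {ℓ : Fin (rates n + 1)} {P : (Fin m → ℝ) → Prop}
    (hpos : 0 < ∑ i ∈ levelElements T B Mhat σ j ℓ, estimate T B σ ℓ i)
    (hP : ∀ i ∈ levelElements T B Mhat σ j ℓ, P (answer T B σ ℓ i)) :
    ((pick fun i : Fin n =>
      if i ∈ levelElements T B Mhat σ j ℓ then estimate T B σ ℓ i else 0).map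
        (Option.map (answer T B σ ℓ))).toOuterMeasure {v? | ∃ v, v? = some v ∧ P v} = 1 := by
  have hwt (i : Fin n) :
      0 ≤ if i ∈ levelElements T B Mhat σ j ℓ then estimate T B σ ℓ i else 0 := by
    split_ifs <;> [exact estimate_nonneg σ ℓ i; exact le_rfl]
  rw [← Finset.sum_ite_mem_eq] at hpos
  rw [PMF.toOuterMeasure_apply_eq_one_iff]
  intro x hx
  obtain ⟨y, hy, rfl⟩ := (PMF.mem_support_map_iff ..).1 hx
  obtain ⟨i, rfl, hi⟩ := exists_of_mem_support_pick (sum_ofReal_ne_zero hwt hpos) hy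
  exact ⟨_, rfl, hP i (by_contra fun hmem => hi.ne' (if_neg hmem))⟩

theorem IsValidInput.card_mul_levelMass_bound_le (hV : IsValidInput T B Mhat K ε) :
    ((levels K ε n : ℝ) + 1) * (800 * mass T B * ε ^ 2 / (levels K ε n : ℝ) ^ 3) ≤
      1 / 100 * (mass T B / (32 * K * ((levels K ε n : ℝ) + 1))) := by
  have hε := hV.ε_pos
  have hK := hV.one_le_K
  have hL := hV.le_levels_cast
  have hM := hV.mass_pos
  have hKε : 800 * ε * (K * ε) ≤ 1 / 10 ^ 10 := by nlinarith [hV.ε_le, hV.Kε_le]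
  set L : ℝ := (levels K ε n : ℝ)
  rw [← mul_div_assoc, ← mul_div_assoc, div_le_div_iff₀ (by positivity) (by positivity)]
  calc (L + 1) * (800 * mass T B * ε ^ 2) * (32 * K * (L + 1))
      = mass T B * (32 * (800 * ε * (K * ε)) * (L + 1) ^ 2) := by ring
    _ ≤ mass T B * (32 * (1 / 10 ^ 10) * (2 * L) ^ 2) := by gcongr; linarith
    _ = mass T B * (128 / 10 ^ 10 * L ^ 2) := by ring
    _ ≤ mass T B * (L / 100 * L ^ 2) := by
        have hcoeff : 128 / 10 ^ 10 ≤ L / 100 := by linarith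
        gcongr
    _ = 1 / 100 * mass T B * L ^ 3 := by ring

theorem IsFavourable.le_output {σ : Seed stdConstants K ε n} (hF : IsFavourable T B Mhat σ)
    (hV : IsValidInput T B Mhat K ε) {P : (Fin m → ℝ) → Prop}
    (hP : ∀ v u, ‖T v‖ ^ 2 ∈ Set.Icc ((1 - 3 * ε) * ‖T (B u)‖ ^ 2) ((1 + 3 * ε) * ‖T (B u)‖ ^ 2) →
      P v) :
    ENNReal.ofReal (1 - 1 / 100) ≤
      (output T B Mhat σ).toOuterMeasure {v? | ∃ v, v? = some v ∧ P v} := by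
  have hK := hV.one_le_K
  have hM := hV.mass_pos
  have htotal := hF.le_sum_levelMass hV
  rw [Finset.sum_range] at htotal
  have hγ : 0 ≤ 800 * mass T B * ε ^ 2 / (levels K ε n : ℝ) ^ 3 := by positivity
  have hpos : 0 < ∑ j : Fin (levels K ε n + 1), levelMass T B Mhat σ j :=
    lt_of_lt_of_le (by positivity) htotal
  have hweight (j : Fin (levels K ε n + 1)) : 0 ≤ levelMass T B Mhat σ j :=
    levelMass_nonneg T B Mhat σ j
  rw [output]
  refine le_bind_pick hweight hpos _ _ (fun j => ?_) hγ ?_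
  · rcases (levelMass_nonneg T B Mhat σ j).eq_or_lt with hzero | hpos
    · exact Or.inl (hzero.symm.trans_le hγ)
    rcases hchosen : chosen T B Mhat σ j with _ | ℓ
    · exact absurd (levelMass_of_chosen_none hchosen) hpos.ne'
    rcases lt_or_ge (ε * √(σ.ζ * Mhat / 2 ^ (j : ℕ))) (tol T B σ ℓ) with hinaccurate | haccurate
    · exact Or.inl (hF.levelMass_le_of_inaccurate hV hchosen hinaccurate)
    · rw [levelMass_of_chosen hchosen] at hpos
      simp only [hchosen]
      exact Or.inr (answer_pick_levelElements_eq_one (pos_of_mul_pos_left hpos (by positivity))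
        fun i hi => hP _ i (hF.norm_answer_mem hV haccurate hi))
  · rw [Fintype.card_fin, Nat.cast_add_one]
    exact hV.card_mul_levelMass_bound_le.trans (by gcongr)

end Output

section Signs

variable {ι : Type*} [Finite ι] {ν : Measure (ι → ℤˣ)} [IsProbabilityMeasure ν]

theorem integral_sign_mul_sign (hν : KWiseIndependent 2 ν id) {k l : ι} (hkl : k ≠ l) :
    ∫ s, ((s k : ℤ) : ℝ) * ((s l : ℤ) : ℝ) ∂ν = 0 := by
  have hcollision : ν {s | s k = s l} = (Fintype.card ℤˣ : ℝ≥0∞)⁻¹ :=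
    hν.measure_collision measurable_id hkl
  have hagree : ν.real {s | s k = s l} = 1 / 2 := by
    rw [Measure.real, hcollision, Fintype.card_units_int]
    simp
  have hprod (s : ι → ℤˣ) : ((s k : ℤ) : ℝ) * ((s l : ℤ) : ℝ) =
      2 * ({s : ι → ℤˣ | s k = s l}.indicator 1 s) - 1 := by
    rcases Int.units_eq_one_or (s k) with hk | hk <;>
      rcases Int.units_eq_one_or (s l) with hl | hl <;>
      simp [Set.indicator, hk, hl] <;> norm_num
  simp only [hprod]
  rw [integral_sub Integrable.of_finite (integrable_const _), integral_const_mul,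
    integral_indicator_one (Set.toFinite _).measurableSet, hagree]
  simp

theorem integral_sum_sign_mul_sq (hν : KWiseIndependent 2 ν id) (I : Finset ι) (a : ι → ℝ) :
    ∫ s, (∑ k ∈ I, ((s k : ℤ) : ℝ) * a k) ^ 2 ∂ν = ∑ k ∈ I, a k ^ 2 := by
  have hexpand (s : ι → ℤˣ) : (∑ k ∈ I, ((s k : ℤ) : ℝ) * a k) ^ 2 =
      ∑ k ∈ I, ∑ l ∈ I, a k * a l * (((s k : ℤ) : ℝ) * ((s l : ℤ) : ℝ)) := by
    rw [sq, Finset.sum_mul_sum]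
    exact Finset.sum_congr rfl fun k _ => Finset.sum_congr rfl fun l _ => by ring
  have hsq (k : ι) (s : ι → ℤˣ) : ((s k : ℤ) : ℝ) * ((s k : ℤ) : ℝ) = 1 := by
    rw [← Int.cast_mul, Int.units_coe_mul_self, Int.cast_one]
  simp only [hexpand]
  rw [integral_finsetSum _ fun _ _ => Integrable.of_finite]
  refine Finset.sum_congr rfl fun k hk => ?_
  rw [integral_finsetSum _ fun _ _ => Integrable.of_finite, Finset.sum_eq_single_of_mem k hk]
  · simp [hsq, sq]
  · intro l _ hlk
    rw [integral_const_mul, integral_sign_mul_sign hν hlk.symm, mul_zero]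

end Signs

theorem f_nonneg (x : ℝ) : 0 ≤ f x :=
  Real.log_nonneg (by linarith [abs_nonneg x])

theorem f_zero : f 0 = 0 := by simp [f]

theorem f_neg (x : ℝ) : f (-x) = f x := by simp [f]

theorem f_eq_zero_iff {x : ℝ} : f x = 0 ↔ x = 0 := by
  refine ⟨fun hx => by_contra fun hne => ?_, fun hx => hx ▸ f_zero⟩
  exact (Real.log_pos (by linarith [abs_pos.2 hne])).ne' hx

theorem f_le_f {x y : ℝ} (h : |x| ≤ |y|) : f x ≤ f y :=
  Real.log_le_log (by positivity) (by linarith)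

theorem f_add_le (x y : ℝ) : f (x + y) ≤ f x + f y := by
  rw [f, f, f, ← Real.log_mul (by positivity) (by positivity)]
  refine Real.log_le_log (by positivity) ?_
  nlinarith [abs_add_le x y, abs_nonneg x, abs_nonneg y]

theorem abs_mul_f_le {x y : ℝ} (h : |x| ≤ |y|) : |x| * f y ≤ |y| * f x := by
  rcases eq_or_ne y 0 with rfl | hy
  · simp [f_zero]
  have hy' : 0 < |y| := abs_pos.2 hy
  have hconcave : |x| / |y| * f y ≤ f x := by
    rw [f, f, ← Real.log_rpow (by positivity)]
    refine Real.log_le_log (by positivity) ?_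
    have hbernoulli := rpow_one_add_le_one_add_mul_self (s := |y|) (p := |x| / |y|) (by linarith)
      (by positivity) ((div_le_one hy').2 h)
    rwa [div_mul_cancel₀ _ hy'.ne'] at hbernoulli
  rwa [div_mul_eq_mul_div, div_le_iff₀ hy', mul_comm (f x)] at hconcave

theorem sq_mul_f_sq_le {x y : ℝ} (h : |x| ≤ |y|) : x ^ 2 * f y ^ 2 ≤ y ^ 2 * f x ^ 2 := by
  have hsq := pow_le_pow_left₀ (mul_nonneg (abs_nonneg x) (f_nonneg y)) (abs_mul_f_le h) 2
  rwa [mul_pow, mul_pow, sq_abs, sq_abs] at hsq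

theorem f_sq_le (x : ℝ) {y : ℝ} (hy : y ≠ 0) : f x ^ 2 ≤ (1 + x ^ 2 / y ^ 2) * f y ^ 2 := by
  rw [one_add_mul]
  rcases le_total |x| |y| with h | h
  · have hmono := pow_le_pow_left₀ (f_nonneg x) (f_le_f h) 2
    have hnonneg : 0 ≤ x ^ 2 / y ^ 2 * f y ^ 2 := by positivity
    linarith
  · have hconcave : f x ^ 2 ≤ x ^ 2 / y ^ 2 * f y ^ 2 := by
      rw [div_mul_eq_mul_div, le_div_iff₀ (by positivity), mul_comm]
      exact sq_mul_f_sq_le h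
    linarith [sq_nonneg (f y)]

theorem f_sqrt_sum_sq_le {ι : Type*} (I : Finset ι) (a : ι → ℝ) :
    f (√(∑ k ∈ I, a k ^ 2)) ^ 2 ≤ ∑ k ∈ I, f (a k) ^ 2 := by
  set Y := ∑ k ∈ I, a k ^ 2 with hY
  have hYnonneg : 0 ≤ Y := Finset.sum_nonneg fun k _ => sq_nonneg (a k)
  rcases hYnonneg.eq_or_lt with hY0 | hY0
  · rw [← hY0, Real.sqrt_zero, f_zero, zero_pow two_ne_zero]
    exact Finset.sum_nonneg fun k _ => sq_nonneg _
  have hterm : ∀ k ∈ I, a k ^ 2 * f (√Y) ^ 2 ≤ Y * f (a k) ^ 2 := by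
    intro k hk
    have hle : |a k| ≤ |√Y| :=
      (Real.abs_le_sqrt (Finset.single_le_sum (fun i _ => sq_nonneg (a i)) hk)).trans
        (le_abs_self _)
    have hconcave := sq_mul_f_sq_le hle
    rwa [Real.sq_sqrt hY0.le] at hconcave
  have hsum := Finset.sum_le_sum hterm
  rw [← Finset.sum_mul, ← Finset.mul_sum, ← hY] at hsum
  exact le_of_mul_le_mul_left hsum hY0

theorem integral_f_sum_sign_mul_sq_le {ι : Type*} [Finite ι] {ν : Measure (ι → ℤˣ)}
    [IsProbabilityMeasure ν] (hν : KWiseIndependent 2 ν id) (I : Finset ι) (a : ι → ℝ) :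
    ∫ s, f (∑ k ∈ I, ((s k : ℤ) : ℝ) * a k) ^ 2 ∂ν ≤ 2 * ∑ k ∈ I, f (a k) ^ 2 := by
  set Y := ∑ k ∈ I, a k ^ 2 with hY
  have hYnonneg : 0 ≤ Y := Finset.sum_nonneg fun k _ => sq_nonneg (a k)
  rcases hYnonneg.eq_or_lt with hY0 | hY0
  · have ha := (Finset.sum_eq_zero_iff_of_nonneg fun k _ => sq_nonneg (a k)).1 hY0.symm
    have hsum (s : ι → ℤˣ) : ∑ k ∈ I, ((s k : ℤ) : ℝ) * a k = 0 :=
      Finset.sum_eq_zero fun k hk => by rw [pow_eq_zero_iff two_ne_zero |>.1 (ha k hk), mul_zero]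
    simp only [hsum, f_zero, zero_pow two_ne_zero, integral_zero]
    positivity
  · calc ∫ s, f (∑ k ∈ I, ((s k : ℤ) : ℝ) * a k) ^ 2 ∂ν
        ≤ ∫ s, (1 + (∑ k ∈ I, ((s k : ℤ) : ℝ) * a k) ^ 2 / √Y ^ 2) * f (√Y) ^ 2 ∂ν :=
          integral_mono Integrable.of_finite Integrable.of_finite fun s =>
            f_sq_le _ (Real.sqrt_pos.2 hY0).ne'
      _ = 2 * f (√Y) ^ 2 := by
          rw [integral_mul_const, integral_add (integrable_const _) Integrable.of_finite,
            integral_div, integral_sum_sign_mul_sq hν, Real.sq_sqrt hY0.le, ← hY,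
            div_self hY0.ne', integral_const, probReal_univ, one_smul, one_add_one_eq_two]
      _ ≤ 2 * ∑ k ∈ I, f (a k) ^ 2 :=
          mul_le_mul_of_nonneg_left (f_sqrt_sum_sq_le I a) zero_le_two

theorem norm_g_sq {d : ℕ} (x : Fin (d + 1) → ℝ) :
    ‖g x‖ ^ 2 = (∑ t : Fin d, f (x t.castSucc) ^ 2) + x (Fin.last d) ^ 2 := by
  rw [EuclideanSpace.norm_sq_eq, Fin.sum_univ_castSucc]
  simp [g]

theorem norm_g_concat_sq {n d : ℕ} (A : Matrix (Fin n) (Fin d) ℝ) (b : Fin n → ℝ) (u : Fin n) :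
    ‖g (concat A b u)‖ ^ 2 = ‖fVec (A u)‖ ^ 2 + |b u| ^ 2 := by
  rw [norm_g_sq, EuclideanSpace.norm_sq_eq]
  simp [concat, fVec]

theorem norm_g_neg {d : ℕ} (x : Fin (d + 1) → ℝ) : ‖g (-x)‖ = ‖g x‖ := by
  rw [← sq_eq_sq₀ (norm_nonneg _) (norm_nonneg _), norm_g_sq, norm_g_sq]
  simp [f_neg]

theorem abs_g_add_apply_le {d : ℕ} (x y : Fin (d + 1) → ℝ) (t : Fin (d + 1)) :
    |g (x + y) t| ≤ |g x t| + |g y t| := by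
  induction t using Fin.lastCases with
  | last => simpa [g] using abs_add_le (x (Fin.last d)) (y (Fin.last d))
  | cast t =>
    simp only [g, Fin.snoc_castSucc, Pi.add_apply, abs_of_nonneg (f_nonneg _)]
    exact f_add_le _ _

theorem norm_g_add_le {d : ℕ} (x y : Fin (d + 1) → ℝ) : ‖g (x + y)‖ ≤ ‖g x‖ + ‖g y‖ := by
  set absG : (Fin (d + 1) → ℝ) → EuclideanSpace ℝ (Fin (d + 1)) := fun z =>
    WithLp.toLp 2 fun t => |g z t| with habsG
  have hnorm (z : Fin (d + 1) → ℝ) : ‖absG z‖ = ‖g z‖ := by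
    simp [habsG, EuclideanSpace.norm_eq]
  calc ‖g (x + y)‖ ≤ ‖absG x + absG y‖ := by
        rw [EuclideanSpace.norm_eq, EuclideanSpace.norm_eq]
        refine Real.sqrt_le_sqrt
          (Finset.sum_le_sum fun t _ => pow_le_pow_left₀ (norm_nonneg _) ?_ 2)
        exact (abs_g_add_apply_le x y t).trans (le_abs_self _)
    _ ≤ ‖absG x‖ + ‖absG y‖ := norm_add_le _ _
    _ = ‖g x‖ + ‖g y‖ := by rw [hnorm, hnorm]

theorem isSketchable_g {d : ℕ} : IsSketchable (g : (Fin (d + 1) → ℝ) → _) where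
  norm_neg := norm_g_neg
  norm_add_le := norm_g_add_le
  integral_norm_sq_le := by
    intro n ν _ hν I B
    have hν2 : KWiseIndependent 2 ν id := hν.mono (by norm_num)
    simp only [norm_g_sq]
    rw [integral_add Integrable.of_finite Integrable.of_finite,
      integral_finsetSum _ fun _ _ => Integrable.of_finite, integral_sum_sign_mul_sq hν2,
      Finset.sum_add_distrib, mul_add, Finset.sum_comm, Finset.mul_sum]
    refine add_le_add (Finset.sum_le_sum fun t _ => integral_f_sum_sign_mul_sq_le hν2 I _) ?_
    linarith [Finset.sum_nonneg fun k (_ : k ∈ I) => sq_nonneg (B k (Fin.last d))]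

theorem norm_g_eq_zero_iff {d : ℕ} {x : Fin (d + 1) → ℝ} : ‖g x‖ = 0 ↔ x = 0 := by
  rw [← pow_eq_zero_iff two_ne_zero, norm_g_sq,
    add_eq_zero_iff_of_nonneg (Finset.sum_nonneg fun t _ => sq_nonneg _) (sq_nonneg _),
    Finset.sum_eq_zero_iff_of_nonneg fun t _ => sq_nonneg _, funext_iff, Fin.forall_fin_succ']
  simp [f_eq_zero_iff]

theorem mass_g_pos {n d : ℕ} {B : Matrix (Fin n) (Fin (d + 1)) ℝ} (hB : B ≠ 0) :
    0 < mass g B := by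
  obtain ⟨i, hi⟩ := Function.ne_iff.1 hB
  have hrow : 0 < ‖g (B i)‖ := (norm_nonneg _).lt_of_ne' (norm_g_eq_zero_iff.not.2 hi)
  exact Finset.sum_pos' (fun _ _ => sq_nonneg _) ⟨i, Finset.mem_univ i, pow_pos hrow 2⟩

theorem concat_ne_zero {n d : ℕ} {A : Matrix (Fin n) (Fin d) ℝ} {b : Fin n → ℝ}
    (h : A ≠ 0 ∨ b ≠ 0) : concat A b ≠ 0 := by
  intro hzero
  have hentry (i : Fin n) (t : Fin (d + 1)) : concat A b i t = 0 := by rw [hzero]; rfl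
  refine h.elim (fun hA => hA ?_) fun hb => hb ?_
  · ext i t
    simpa [concat] using hentry i t.castSucc
  · ext i
    simpa [concat] using hentry i (Fin.last d)

end HSketch

theorem mainTheorem7_general :
    ∃ (c : HSketch.Constants) (C ε₀ : ℝ), 0 < C ∧ 0 < ε₀ ∧
      ∀ K : ℝ, 1 ≤ K → ∀ ε : ℝ, 0 < ε → K * ε ≤ ε₀ →
        ∀ (n m : ℕ) (T : (Fin m → ℝ) → EuclideanSpace ℝ (Fin m)), HSketch.IsSketchable T →
        ∀ B : Matrix (Fin n) (Fin m) ℝ, 0 < HSketch.mass T B →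
        ∀ Mhat : ℝ, HSketch.mass T B ≤ Mhat → Mhat ≤ K * HSketch.mass T B →
        ∀ (Ω : Type*) [MeasurableSpace Ω] (μ : Measure Ω) [IsProbabilityMeasure μ]
          (S : Ω → HSketch.Seed c K ε n), HSketch.IsRandomSeed μ S →
          9 / 10 ≤ HSketch.successProb T B Mhat μ S fun H =>
            ∃ u : Fin n, ‖T H‖ ^ 2 ∈
              Set.Icc ((1 - C * ε) * ‖T (B u)‖ ^ 2) ((1 + C * ε) * ‖T (B u)‖ ^ 2) := by
  refine ⟨HSketch.stdConstants, 3, (1 / 2) ^ 250, three_pos, by positivity, ?_⟩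
  intro K hK ε hε hKε n m T hT B hB Mhat hle hge Ω _ μ _ S hS
  have hV : HSketch.IsValidInput T B Mhat K ε := ⟨hT, hK, hε, hKε, hB, hle, hge⟩
  have hnumeric : (9 / 10 : ℝ≥0∞) ≤ ENNReal.ofReal (1 - 1 / 100) * (1 - 7 * 100⁻¹) := by
    rw [← ENNReal.ofReal_one, ← ENNReal.ofReal_ofNat 7, ← ENNReal.ofReal_ofNat 9,
      ← ENNReal.ofReal_ofNat 10, ← ENNReal.ofReal_ofNat 100,
      ← ENNReal.ofReal_div_of_pos (by norm_num), ← ENNReal.ofReal_inv_of_pos (by norm_num),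
      ← ENNReal.ofReal_mul (by norm_num), ← ENNReal.ofReal_sub _ (by norm_num),
      ← ENNReal.ofReal_mul (by norm_num)]
    exact ENNReal.ofReal_le_ofReal (by norm_num)
  exact hnumeric.trans (HSketch.mul_le_lintegral_of_measure_not_le
    (hV.measure_not_isFavourable_le hS) fun ω hω => hω.le_output hV fun _ u hu => ⟨u, hu⟩)

theorem mainTheorem7 :
    ∃ (c : HSketch.Constants) (C : ℝ), 0 < C ∧
      ∀ K : ℝ, 1 ≤ K → ∃ ε₀ : ℝ, 0 < ε₀ ∧ ∀ ε : ℝ, 0 < ε → ε ≤ ε₀ →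
        ∀ (n d : ℕ) (A : Matrix (Fin n) (Fin d) ℝ) (b : Fin n → ℝ), (A ≠ 0 ∨ b ≠ 0) →
        ∀ Mhat : ℝ, HSketch.mass HSketch.g (HSketch.concat A b) ≤ Mhat →
          Mhat ≤ K * HSketch.mass HSketch.g (HSketch.concat A b) →
        ∀ (Ω : Type*) [MeasurableSpace Ω] (μ : Measure Ω) [IsProbabilityMeasure μ]
          (S : Ω → HSketch.Seed c K ε n), HSketch.IsRandomSeed μ S →
          9 / 10 ≤ HSketch.successProb HSketch.g (HSketch.concat A b) Mhat μ S fun H =>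
            ∃ u : Fin n,
              (1 - C * ε) * (‖HSketch.fVec (A u)‖ ^ 2 + |b u| ^ 2) ≤ ‖HSketch.g H‖ ^ 2 ∧
              ‖HSketch.g H‖ ^ 2 ≤ (1 + C * ε) * (‖HSketch.fVec (A u)‖ ^ 2 + |b u| ^ 2) := by
  obtain ⟨c, C, ε₀, hC, hε₀, hgeneral⟩ := mainTheorem7_general
  refine ⟨c, C, hC, fun K hK => ⟨ε₀ / K, by positivity, ?_⟩⟩
  intro ε hε hεK n d A b hAb Mhat hle hge Ω _ μ _ S hS
  have hKε : K * ε ≤ ε₀ := by rwa [le_div_iff₀' (zero_lt_one.trans_le hK)] at hεK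
  simpa only [HSketch.norm_g_concat_sq, Set.mem_Icc] using
    hgeneral K hK ε hε hKε n (d + 1) HSketch.g HSketch.isSketchable_g (HSketch.concat A b)
      (HSketch.mass_g_pos (HSketch.concat_ne_zero hAb)) Mhat hle hge Ω μ S hS
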